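/- Let $K$ be a field of characteristic different from $2$ and $3$ that contains a primitive third root of unity $\omega$. The $\mathrm{G}_{32}$ arrangement in $\mathbb{P}^3_K$, with homogeneous coordinates $c_0,c_1,c_2,c_3$, consists of the $40$ hyperplanes defined by the linear forms $u_i$ ($i\in E$, $|E|=40$) $$\sqrt{-3}\,c_j,\quad c_1+\omega^k c_2+\omega^l c_3,\quad c_2-\omega^k c_3+\omega^l c_0,\quad c_3+\omega^k c_0-\omega^l c_1,\quad c_0+\omega^k c_1-\omega^l c_2,$$ where $0\le j\le 3$, $0\le k,l\le 2$ and $\sqrt{-3}=\omega-\omega^2$. Let $M$ be the matroid of linear independence of these forms on $E$, let $U\subset\mathbb{P}^3_K$ be the complement of the arrangement, embedded in the torus $\mathbb{G}_m^{E}/\mathbb{G}_m$ by the forms $u_i$. The *tropical linear space* of $M$ is the set of all classes $w\in\mathbb{R}^{E}/\mathbb{R}(1,\dots,1)$ such that on every circuit of $M$ the minimum of the coordinates of $w$ is attained at least twice. A *Bergman fan* of $M$ is a coarsest fan structure on this set, that is, a polyhedral fan with this support which is refined by every polyhedral fan with this support. The *nested set complex* of $M$ is the simplicial complex whose vertices are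 the connected flats $F\ne E$ of $M$ and in which a set $S$ of vertices is a face if and only if the join of any two or more pairwise incomparable members of $S$ is not a connected flat ($E$ counts as a connected flat if $M$ is connected). For $F\subseteq E$ let $e_F=\sum_{i\in F}e_i$. Then the Bergman complex of $M$ coincides with the nested set complex of $M$: there is a unique Bergman fan of $M$, and it is the simplicial fan over the nested set complex with vertices placed at the $e_F$. That is, for each face $S$ the vectors $e_F$, $F\in S$, are linearly independent in $\mathbb{R}^{E}/\mathbb{R}(1,\dots,1)$, and $S\mapsto\mathrm{cone}(e_F: F\in S)$ is a bijection from the faces (including the empty one) onto the cones of the Bergman fan. Moreover, the tropical compactification of $U$, i.e. the closure of $U$ in the toric variety over $K$ of the Bergman fan of $M$, coincides with the wonderful compactification of De Concini and Procesi, i.e. the closure of $U$ in $\mathbb{P}(V)\times\prod_F\mathbb{P}(V/X_F)$, where $V=K^4$, $F$ runs over all connected flats of $M$ and $X_F=\{v\in V: u_i(v)=0 \text{ for all } i\in F\}$: there is an isomorphism of varieties over $K$ between them that is the identity on $U$. -/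

import Mathlib

namespace Arr

/-! ### Matroids: the linear matroid of a vector configuration, connected flats, nested sets -/

section Matroids

/-- The matroid on `ι` of a finite family of vectors: a set is independent iff the subfamily it
indexes is linearly independent. -/
def linearMatroid {ι : Type} [Finite ι] {K V : Type*} [Field K] [AddCommGroup V] [Module K V]
    (a : ι → V) : Matroid ι :=
  (IndepMatroid.ofFinite (E := Set.univ) Set.finite_univ (fun I => LinearIndepOn K a I)
    (linearIndepOn_empty K a)
    (fun _ _ hJ hIJ => hJ.mono hIJ)
    (by
      intro I J hI hJ hlt
      by_contra! h
      have hsub : Submodule.span K (a '' J) ≤ Submodule.span K (a '' I) := by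
        rw [Submodule.span_le]
        rintro _ ⟨e, he, rfl⟩
        by_cases heI : e ∈ I
        · exact Submodule.subset_span ⟨e, heI, rfl⟩
        · by_contra hne
          exact h e he heI ((linearIndepOn_insert heI).2 ⟨hI, hne⟩)
      have hcard : ∀ S : Set ι, LinearIndepOn K a S →
          Module.finrank K (Submodule.span K (a '' S)) = S.ncard := by
        intro S hS
        have : Fintype S := Fintype.ofFinite S
        rw [Set.image_eq_range, finrank_span_eq_card hS, ← Nat.card_eq_fintype_card]
        rfl
      have : FiniteDimensional K (Submodule.span K (a '' I)) :=
        FiniteDimensional.span_of_finite K ((Set.toFinite I).image a)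
      have := Submodule.finrank_mono hsub
      rw [hcard I hI, hcard J hJ] at this
      omega)
    (fun I _ => Set.subset_univ I)).matroid

variable {ι : Type} (M : Matroid ι)

/-- A nonempty flat `F` such that the restriction of `M` to `F` is connected, that is, any two
distinct elements of `F` lie on a common circuit contained in `F` (an *irreducible* flat). -/
def IsConnectedFlat (F : Set ι) : Prop :=
  M.IsFlat F ∧ F.Nonempty ∧
    ∀ e ∈ F, ∀ f ∈ F, e ≠ f → ∃ C, M.IsCircuit C ∧ C ⊆ F ∧ e ∈ C ∧ f ∈ C

/-- The (reduced) nested set complex of the lattice of flats of `M`, for the building set of all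
connected flats. Its vertices are the connected flats other than the whole ground set. A set `S`
of vertices is a face iff the join of any two or more pairwise incomparable members of `S` is not
a connected flat. The empty face is included. -/
def nestedSetComplex : Set (Set (Set ι)) :=
  {S | (∀ F ∈ S, IsConnectedFlat M F ∧ F ≠ M.E) ∧
    ∀ T ⊆ S, T.Nontrivial → IsAntichain (· ⊆ ·) T → ¬ IsConnectedFlat M (M.closure (⋃₀ T))}

end Matroids

/-! ### Fans in the tropical projective torus -/

section Fans

/-- The tropical projective torus `ℝ^ι / ℝ(1, …, 1)`. -/
abbrev TropTorus (ι : Type) : Type := (ι → ℝ) ⧸ Submodule.span ℝ {(1 : ι → ℝ)}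

/-- The class of a vector in the tropical projective torus. -/
def TropTorus.mk {ι : Type} (w : ι → ℝ) : TropTorus ι := Submodule.Quotient.mk w

/-- The tropical linear space of a matroid (min-convention): the classes of all `w` whose minimum
over every circuit is attained at least twice. -/
def tropicalLinearSpace {ι : Type} (M : Matroid ι) : Set (TropTorus ι) :=
  TropTorus.mk '' {w | ∀ C, M.IsCircuit C →
    ∃ i ∈ C, ∃ j ∈ C, i ≠ j ∧ w i = w j ∧ ∀ k ∈ C, w i ≤ w k}

/-- `𝓕` is a polyhedral fan with support `X`. -/
structure IsFanStructure {V : Type*} [AddCommGroup V] [Module ℝ V]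
    (𝓕 : Set (PointedCone ℝ V)) (X : Set V) : Prop where
  finite : 𝓕.Finite
  polyhedral : ∀ σ ∈ 𝓕, σ.FG
  face_mem : ∀ σ ∈ 𝓕, ∀ τ : PointedCone ℝ V, τ.IsFaceOf σ → τ ∈ 𝓕
  inter_face : ∀ σ ∈ 𝓕, ∀ τ ∈ 𝓕, (σ ⊓ τ).IsFaceOf σ
  support : ⋃ σ ∈ 𝓕, (σ : Set V) = X

/-- `𝓕` is the coarsest fan structure on `X`: every fan structure on `X` is a refinement of it. -/
structure IsCoarsestFanStructure {V : Type*} [AddCommGroup V] [Module ℝ V]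
    (𝓕 : Set (PointedCone ℝ V)) (X : Set V) : Prop where
  isFan : IsFanStructure 𝓕 X
  coarsest : ∀ 𝓖 : Set (PointedCone ℝ V), IsFanStructure 𝓖 X → ∀ τ ∈ 𝓖, ∃ σ ∈ 𝓕, τ ≤ σ

/-- The Bergman fan of a matroid is the coarsest fan structure on its tropical linear space. -/
def IsBergmanFan {ι : Type} (M : Matroid ι) (𝓕 : Set (PointedCone ℝ (TropTorus ι))) : Prop :=
  IsCoarsestFanStructure 𝓕 (tropicalLinearSpace M)

open Classical in
/-- The class of the incidence vector `e_F = ∑_{i ∈ F} e_i`. -/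
noncomputable def incidenceVector {ι : Type} (F : Set ι) : TropTorus ι :=
  TropTorus.mk (fun i => if i ∈ F then 1 else 0)

/-- The cone spanned by the vectors `e_F`, `F ∈ S`. -/
noncomputable def incidenceCone {ι : Type} (S : Set (Set ι)) : PointedCone ℝ (TropTorus ι) :=
  PointedCone.hull ℝ (incidenceVector '' S)

/-- `𝓕` is the simplicial fan over the simplicial complex `Δ` whose vertices `F` are
placed at the vectors `e_F`: the vectors of each face are linearly independent, and mapping a face
to the cone that it spans is a bijection from `Δ` onto `𝓕`. -/
structure IsFanOver {ι : Type} (𝓕 : Set (PointedCone ℝ (TropTorus ι)))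
    (Δ : Set (Set (Set ι))) : Prop where
  linearIndep : ∀ S ∈ Δ, LinearIndepOn ℝ incidenceVector S
  bijOn : Set.BijOn incidenceCone Δ 𝓕

end Fans

/-! ### Toric varieties

Varieties over a field `K` are described by their points in an algebraically closed extension `L`
of `K`, with the `K`-Zariski topology and the `L`-valued functions that are locally given by
quotients of polynomials with coefficients in `K`. -/

section Toric

variable {ι : Type} [Fintype ι]

/-- The monoid `σ^∨ ∩ ℤ^ι_0` of a cone `σ` in the tropical projective torus, where `ℤ^ι_0` (the
integer vectors with coordinate sum zero) is the character lattice of the torus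
`𝔾_m^ι / 𝔾_m`. -/
def dualMonoid (σ : PointedCone ℝ (TropTorus ι)) : AddSubmonoid (ι → ℤ) where
  carrier := {m | ∑ i, m i = 0 ∧ ∀ w : ι → ℝ, TropTorus.mk w ∈ σ → 0 ≤ ∑ i, (m i : ℝ) * w i}
  zero_mem' := by simp
  add_mem' := by
    rintro a b ⟨ha, ha'⟩ ⟨hb, hb'⟩
    refine ⟨by simp [Finset.sum_add_distrib, ha, hb], fun w hw => ?_⟩
    have := add_nonneg (ha' w hw) (hb' w hw)
    simpa [add_mul, Finset.sum_add_distrib] using this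

theorem dualMonoid_anti {ρ σ : PointedCone ℝ (TropTorus ι)} (h : ρ ≤ σ) :
    dualMonoid σ ≤ dualMonoid ρ :=
  fun _ hm => ⟨hm.1, fun w hw => hm.2 w (h hw)⟩

variable (K L : Type*) [Field K] [Field L] [Algebra K L]

/-- The `L`-points of the affine toric variety `Spec K[σ^∨ ∩ ℤ^ι_0]`: the monoid homomorphisms
from `σ^∨ ∩ ℤ^ι_0` to `(L, ·)`. -/
def ToricChart (_K L : Type*) [Field _K] [Field L] [Algebra _K L]
    (σ : PointedCone ℝ (TropTorus ι)) : Type _ :=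
  Multiplicative (dualMonoid σ) →* L

variable {K L}

/-- The value of an element of `K[σ^∨ ∩ ℤ^ι_0]` at an `L`-point. -/
noncomputable def ToricChart.eval {σ : PointedCone ℝ (TropTorus ι)} (φ : ToricChart K L σ)
    (p : AddMonoidAlgebra K (dualMonoid σ)) : L :=
  AddMonoidAlgebra.lift K L (dualMonoid σ) φ p

/-- The `K`-Zariski topology. -/
instance {σ : PointedCone ℝ (TropTorus ι)} : TopologicalSpace (ToricChart K L σ) :=
  TopologicalSpace.generateFrom
    {U | ∃ p : AddMonoidAlgebra K (dualMonoid σ), U = {φ | φ.eval p ≠ 0}}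

/-- The morphism from the affine toric variety of `ρ` to that of `σ`, for `ρ ⊆ σ`. -/
def ToricChart.incl {ρ σ : PointedCone ℝ (TropTorus ι)} (h : ρ ≤ σ) (χ : ToricChart K L ρ) :
    ToricChart K L σ :=
  MonoidHom.comp (show Multiplicative (dualMonoid ρ) →* L from χ)
    (AddMonoidHom.toMultiplicative (AddSubmonoid.inclusion (dualMonoid_anti h)))

variable (K L)

/-- Two points of the charts of `σ` and `τ` are glued if they come from one point of the chart of
a cone of the fan that is contained in both `σ` and `τ`. -/
def ToricVariety.Glue (𝓕 : Set (PointedCone ℝ (TropTorus ι)))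
    (P Q : (σ : 𝓕) × ToricChart K L σ.1) : Prop :=
  ∃ ρ ∈ 𝓕, ∃ (h₁ : ρ ≤ P.1.1) (h₂ : ρ ≤ Q.1.1) (χ : ToricChart K L ρ),
    χ.incl h₁ = P.2 ∧ χ.incl h₂ = Q.2

/-- The (`L`-points of the) toric variety over `K` of a fan in the tropical projective torus: the
affine toric varieties of its cones, glued along those of common faces. -/
def ToricVariety (𝓕 : Set (PointedCone ℝ (TropTorus ι))) : Type _ :=
  Quot (ToricVariety.Glue K L 𝓕)

variable {K L}
variable {𝓕 : Set (PointedCone ℝ (TropTorus ι))}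

/-- The chart of a cone. -/
def ToricVariety.chart (σ : 𝓕) (φ : ToricChart K L σ.1) : ToricVariety K L 𝓕 :=
  Quot.mk _ ⟨σ, φ⟩

/-- A set is open iff its preimage in every chart is open. -/
instance : TopologicalSpace (ToricVariety K L 𝓕) :=
  ⨆ σ : 𝓕, TopologicalSpace.coinduced (ToricVariety.chart σ) inferInstance

/-- For an open set `W` of a subvariety `Z` of the toric variety, `f` is regular on `W`: in every
chart, `f` is near each point of `W` a quotient of two elements of `K[σ^∨ ∩ ℤ^ι_0]`. -/
def ToricVariety.IsRegularOn {Z : Set (ToricVariety K L 𝓕)} (W : Set Z) (f : Z → L) : Prop :=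
  ∀ (σ : 𝓕) (φ : ToricChart K L σ.1), ∀ z ∈ W, z.1 = chart σ φ →
    ∃ p q : AddMonoidAlgebra K (dualMonoid σ.1), φ.eval q ≠ 0 ∧
      ∀ y ∈ W, ∀ ψ : ToricChart K L σ.1, y.1 = chart σ ψ → ψ.eval q ≠ 0 →
        f y = ψ.eval p / ψ.eval q

/-- The point of the chart of `σ` given by the point `t` of the torus `𝔾_m^ι / 𝔾_m`. -/
def ToricChart.torusPoint (σ : PointedCone ℝ (TropTorus ι)) (t : ι → Lˣ) : ToricChart K L σ where
  toFun m := ((∏ i, t i ^ (Multiplicative.toAdd m).1 i : Lˣ) : L)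
  map_one' := by simp
  map_mul' m m' := by simp [zpow_add, Finset.prod_mul_distrib]

end Toric

/-! ### Products of projective spaces -/

section MultiProjective

open scoped LinearAlgebra.Projectivization

/-- The `L`-points of the product over `k : κ` of the projective spaces over `K` with homogeneous
coordinates indexed by `I k`. -/
def MultiProjective (_K L : Type*) [Field _K] [Field L] [Algebra _K L] {κ : Type}
    (I : κ → Type) : Type _ :=
  ∀ k, ℙ L (I k → L)

variable {K L : Type*} [Field K] [Field L] [Algebra K L] {κ : Type} {I : κ → Type}

/-- `p` is multihomogeneous of multidegree `d`. -/
def IsMultihomogeneous (p : MvPolynomial ((k : κ) × I k) K) (d : κ →₀ ℕ) : Prop :=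
  p.IsWeightedHomogeneous (fun s => Finsupp.single s.1 1) d

/-- The value of a polynomial at chosen homogeneous coordinates of a point. For a multihomogeneous
polynomial its vanishing does not depend on the choice, and neither does the quotient of two
values for polynomials of the same multidegree. -/
noncomputable def MultiProjective.eval (x : MultiProjective K L I)
    (p : MvPolynomial ((k : κ) × I k) K) : L :=
  MvPolynomial.aeval (fun s : (k : κ) × I k => (x s.1).rep s.2) p

/-- The `K`-Zariski topology. -/
instance : TopologicalSpace (MultiProjective K L I) :=
  TopologicalSpace.generateFrom
    {U | ∃ p d, IsMultihomogeneous p d ∧ U = {x : MultiProjective K L I | x.eval p ≠ 0}}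

/-- For an open set `W` of a subvariety `Z` of the product of projective spaces, `f` is regular
on `W`: near each point it is a quotient of two multihomogeneous polynomials over `K` of the same
multidegree. -/
def MultiProjective.IsRegularOn {Z : Set (MultiProjective K L I)} (W : Set Z) (f : Z → L) : Prop :=
  ∀ z ∈ W, ∃ p q d, IsMultihomogeneous p d ∧ IsMultihomogeneous q d ∧ z.1.eval q ≠ 0 ∧
    ∀ y ∈ W, y.1.eval q ≠ 0 → f y = y.1.eval p / y.1.eval q

end MultiProjective

/-! ### Compactifications of the complement of a hyperplane arrangement -/

section Compactifications

open scoped LinearAlgebra.Projectivization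

variable {ι : Type} [Fintype ι] {n : ℕ} {K : Type*} (L : Type*) [Field K] [Field L] [Algebra K L]

/-- The value of the linear form with coefficient vector `c` at the vector `v`. -/
def formValue {L : Type*} [Field L] [Algebra K L] (c : Fin n → K) (v : Fin n → L) : L :=
  ∑ j, algebraMap K L (c j) * v j

/-- The complement in projective space of the hyperplanes given by the linear forms `a i`. -/
def Complement (a : ι → Fin n → K) : Type _ :=
  {x : ℙ L (Fin n → L) // ∀ i, formValue (a i) x.rep ≠ 0}

variable {L} {a : ι → Fin n → K}

/-- The values of the linear forms at a point of the complement, as a point of `𝔾_m^ι` (its class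
in `𝔾_m^ι / 𝔾_m` does not depend on the chosen representative). -/
noncomputable def Complement.formUnits (x : Complement L a) : ι → Lˣ :=
  fun i => Units.mk0 (formValue (a i) x.1.rep) (x.2 i)

/-- The image of a point of the complement in the chart of `σ`, under the embedding of the
complement in the torus `𝔾_m^ι / 𝔾_m` by the linear forms. -/
noncomputable def Complement.toricPoint {𝓕 : Set (PointedCone ℝ (TropTorus ι))} (σ : 𝓕)
    (x : Complement L a) : ToricVariety K L 𝓕 :=
  ToricVariety.chart σ (ToricChart.torusPoint σ.1 x.formUnits)

variable (L a)

/-- The tropical compactification given by a fan `𝓕`: the closure of the complement in the toric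
variety of `𝓕`. -/
def tropicalCompactification (𝓕 : Set (PointedCone ℝ (TropTorus ι))) :
    Set (ToricVariety K L 𝓕) :=
  closure {P | ∃ (x : Complement L a) (σ : 𝓕), P = x.toricPoint σ}

/-- The homogeneous coordinates on the factors of `ℙ(V) × ∏_F ℙ(V / X_F)`, where `V = K^n`, the
product is over all connected flats `F`, and `X_F = {v | a i v = 0 for i ∈ F}`. The vector space
`V / X_F` is embedded in `K^F` by the linear forms `a i`, `i ∈ F`. -/
def wonderfulCoords : Option {F : Set ι // IsConnectedFlat (linearMatroid (K := K) a) F} → Type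
  | none => Fin n
  | some F => F.1

variable {L a}

/-- The image of a point of the complement in `ℙ(V) × ∏_F ℙ(V / X_F)`. -/
noncomputable def Complement.wonderfulPoint (x : Complement L a) :
    MultiProjective K L (wonderfulCoords a)
  | none => x.1
  | some F => Projectivization.mk L (fun i : F.1 => formValue (a i.1) x.1.rep) (by
      obtain ⟨i, hi⟩ := F.2.2.1
      exact fun h => x.2 i (congrFun h ⟨i, hi⟩))

variable (L a)

/-- The wonderful compactification of De Concini and Procesi for the irreducible flats: the
closure of the complement in `ℙ(V) × ∏_F ℙ(V / X_F)`. -/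
def wonderfulCompactification : Set (MultiProjective K L (wonderfulCoords a)) :=
  closure (Set.range Complement.wonderfulPoint)

/-- The tropical compactification given by `𝓕` and the wonderful compactification are isomorphic
as varieties over `K`, by an isomorphism that is the identity on the complement. -/
def CompactificationsCoincide (𝓕 : Set (PointedCone ℝ (TropTorus ι))) : Prop :=
  ∃ e : tropicalCompactification L a 𝓕 ≃ₜ wonderfulCompactification L a,
    (∀ (W : Set (wonderfulCompactification L a)), IsOpen W →
      ∀ f : wonderfulCompactification L a → L,
        MultiProjective.IsRegularOn W f ↔ ToricVariety.IsRegularOn (e ⁻¹' W) (f ∘ e)) ∧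
    ∀ (x : Complement L a) (σ : 𝓕) (z : tropicalCompactification L a 𝓕),
      z.1 = x.toricPoint σ → (e z).1 = x.wonderfulPoint

end Compactifications

/-! ### The arrangement -/

/-- Labels of the forty hyperplanes. -/
abbrev G32Index : Type := Fin 4 ⊕ Fin 4 × Fin 3 × Fin 3

/-- The forty linear forms in `c₀, c₁, c₂, c₃` (given by their coefficients) that define the
hyperplanes of the complex reflection arrangement `G₃₂`, for a primitive third root of unity `ω`;
note that `ω - ω² = √-3`. -/
def g32Form {K : Type*} [Field K] (ω : K) : G32Index → Fin 4 → K
  | .inl i => Pi.single i (ω - ω ^ 2)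
  | .inr (0, k, l) => ![0, 1, ω ^ (k : ℕ), ω ^ (l : ℕ)]
  | .inr (1, k, l) => ![ω ^ (l : ℕ), 0, 1, -ω ^ (k : ℕ)]
  | .inr (2, k, l) => ![ω ^ (k : ℕ), -ω ^ (l : ℕ), 0, 1]
  | .inr (3, k, l) => ![1, ω ^ (k : ℕ), -ω ^ (l : ℕ), 0]

/-- The matroid of the `G₃₂` arrangement. -/
def g32Matroid {K : Type*} [Field K] (ω : K) : Matroid G32Index :=
  linearMatroid (K := K) (g32Form ω)

end Arr

/-!
The theorem is deduced from two general statements about a connected matroid `M` on a ground set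
`E` with at least two elements, and from two properties of the arrangement.

**The Bergman fan.** A point `w` of the tropical linear space determines a nested set: the
connected components of the superlevel sets `{k | t ≤ w k}`, which are flats (`nestedSupport`).
Since `w` is a positive combination of the vectors `e_F` of its nested set, up to a constant, and
conversely every positive combination of the `e_F` of a nested set `S` is tropical with nested set
`S`, the cones over the nested sets form a fan on the tropical linear space
(`isFanStructure_nestedFan`). It is the coarsest one if no connected flat `F` is the union of two
proper subflats (`isBergmanFan_nestedFan`). Indeed, let `w` be in the relative interior of a
maximal cone `τ` of another fan structure, and let `F` be a component of a superlevel set. Near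
`w` the tropical linear space lies in the span of `τ` around `w`, so it contains with a segment
that starts at `w` also the opposite segment. Raising `w` on a proper flat of `F / {w > min}`
stays tropical; if lowering does too, then `F` is a union of two proper flats. Thus `F / {w > min}`
has rank one, which forces all points of `τ` to be constant on the blocks of `w`, and then `τ` is
contained in the cone over the nested set of `w` (`le_incidenceCone_of_isCore`).

**The compactifications.** Let `M` be the matroid of a connected arrangement such that the forms
span the dual of `V`. The monoid `σ^∨ ∩ ℤ^E_0` of the cone over a nested set `S` is generated by
the characters `e_j - e_i` for which every member of `S` that contains `i` contains `j`
(`mem_closure_charDiff`). In a connected flat `F` there is an `i` such that the quotients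
`t_j / t_i`, `j ∈ F`, are regular on the chart (`IsPivot`), and they are homogeneous coordinates
for the factor `ℙ(V / X_F)`. This defines a correspondence (`Corresponds`) between the points of the
toric variety and of the product of projective spaces. A point of the toric variety that satisfies
the linear relations between the forms corresponds to exactly one point of the product. Conversely,
let `y` be a point of the product that satisfies the equations `Admissible`, which hold on the
complement and hence on its closure. The connected flats `F ≠ E` for which the components of `y` at
all larger connected flats `G` lie in the centre of the projection `ℙ(V / X_G) ⇢ ℙ(V / X_F)` form a
nested set, the smallest one whose chart contains a point corresponding to `y`. This gives a unique
point of the toric variety (`Corresponds.chart_eq`). Both maps are given locally by quotients of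
polynomials, as homogeneous polynomials can be pulled back to charts (`exists_pullback`) and
regular functions on charts are homogeneous up to clearing denominators
(`exists_isMultihomogeneous_chartDenom`).

**The arrangement `G₃₂`.** The forty forms, viewed as vectors, do not lie on a pair of hyperplanes
(`eq_zero_or_eq_zero_of_forall_mul`); this shows that the matroid is connected and that `E` is not
a union of two proper flats. Suppose that a connected flat `F` is the union of the proper flats `P`
and `G`. Two forms that are not orthogonal for the invariant Hermitian product span a line with a
third form, so the forms in `P \ G` are orthogonal to those in `G \ P`. As `F` is connected, there
are at least two forms of each kind. Any two distinct forms have a Gram matrix that is invertible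
in characteristic different from `2` and `3`, so these four forms span the space, and `F = E`
(`g32_eq_of_union`).
-/

namespace Arr

open Set

/-! ### Circuits and connected flats -/

section Circuits

variable {ι : Type} {M : Matroid ι}

theorem mem_of_isCircuit_of_isFlat {F C : Set ι} (hF : M.IsFlat F) (hC : M.IsCircuit C) {e : ι}
    (he : e ∈ C) (h : C \ {e} ⊆ F) : e ∈ F := by
  have := M.closure_subset_closure h (hC.mem_closure_sdiff_singleton_of_mem he)
  rwa [hF.closure] at this

theorem isFlat_of_forall_isCircuit {F : Set ι} (hFE : F ⊆ M.E)
    (h : ∀ C, M.IsCircuit C → ∀ e ∈ C, C \ {e} ⊆ F → e ∈ F) : M.IsFlat F := by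
  rw [Matroid.isFlat_iff_closure_eq]
  refine subset_antisymm (fun e he => ?_) (M.subset_closure F hFE)
  by_contra heF
  obtain ⟨C, hCF, hC, heC⟩ := Matroid.exists_isCircuit_of_mem_closure he heF
  exact heF (h C hC e heC (by simpa using hCF))

/-- Two elements of a union of two intersecting circuits lie on a common circuit in the union. -/
theorem exists_isCircuit_of_inter_nonempty [Finite ι] {C₁ C₂ : Set ι} (h₁ : M.IsCircuit C₁)
    (h₂ : M.IsCircuit C₂) (hne : (C₁ ∩ C₂).Nonempty) {e g : ι} (he : e ∈ C₁) (hg : g ∈ C₂) :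
    ∃ C, M.IsCircuit C ∧ C ⊆ C₁ ∪ C₂ ∧ e ∈ C ∧ g ∈ C := by
  induction hn : (C₁ ∪ C₂).ncard using Nat.strong_induction_on generalizing C₁ C₂ with
  | _ n ih =>
  subst hn
  by_cases heC : e ∈ C₂
  · exact ⟨C₂, h₂, subset_union_right, heC, hg⟩
  by_cases hgC : g ∈ C₁
  · exact ⟨C₁, h₁, subset_union_left, he, hgC⟩
  obtain ⟨f, hf₁, hf₂⟩ := hne
  obtain ⟨C₃, hC₃s, hC₃, he₃⟩ := h₁.strong_elimination h₂ hf₁ hf₂ he heC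
  obtain ⟨C₄, hC₄s, hC₄, hg₄⟩ := h₂.strong_elimination h₁ hf₂ hf₁ hg hgC
  have hf₃ : f ∉ C₃ := fun h => (hC₃s h).2 rfl
  have hf₄ : f ∉ C₄ := fun h => (hC₄s h).2 rfl
  have hs₃ : C₃ ⊆ C₁ ∪ C₂ := hC₃s.trans sdiff_subset
  have hs₄ : C₄ ⊆ C₁ ∪ C₂ := by
    have := hC₄s.trans sdiff_subset
    rwa [union_comm] at this
  have h₃₂ : (C₃ ∩ C₂).Nonempty := by
    by_contra hcon
    rw [not_nonempty_iff_eq_empty] at hcon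
    have : C₃ ⊆ C₁ := fun x hx => (hs₃ hx).elim id fun h => absurd (mem_inter hx h)
      (by rw [hcon]; exact notMem_empty x)
    exact hf₃ (hC₃.eq_of_subset_isCircuit h₁ this ▸ hf₁)
  have h₄₁ : (C₄ ∩ (C₁ \ C₂)).Nonempty := by
    by_contra hcon
    rw [not_nonempty_iff_eq_empty] at hcon
    have : C₄ ⊆ C₂ := fun x hx => by
      by_contra hx2
      have : x ∈ C₄ ∩ (C₁ \ C₂) := ⟨hx, (hs₄ hx).resolve_right hx2, hx2⟩
      rw [hcon] at this
      exact this
    exact hf₄ (hC₄.eq_of_subset_isCircuit h₂ this ▸ hf₂)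
  by_cases hlt : C₃ ∪ C₂ = C₁ ∪ C₂
  · have hsub : C₁ \ C₂ ⊆ C₃ := fun x hx => by
      have : x ∈ C₃ ∪ C₂ := hlt ▸ Or.inl hx.1
      exact this.resolve_right hx.2
    obtain ⟨x, hx₄, hx⟩ := h₄₁
    have hss : C₃ ∪ C₄ ⊂ C₁ ∪ C₂ :=
      (ssubset_iff_of_subset (union_subset hs₃ hs₄)).2 ⟨f, Or.inl hf₁, by simp [hf₃, hf₄]⟩
    obtain ⟨C, hC, hCs, h⟩ := ih _ (ncard_lt_ncard hss (toFinite _)) hC₃ hC₄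
      ⟨x, hsub hx, hx₄⟩ he₃ hg₄ rfl
    exact ⟨C, hC, hCs.trans hss.subset, h⟩
  · have hss : C₃ ∪ C₂ ⊂ C₁ ∪ C₂ :=
      lt_of_le_of_ne (union_subset hs₃ subset_union_right) hlt
    obtain ⟨C, hC, hCs, h⟩ := ih _ (ncard_lt_ncard hss (toFinite _)) hC₃ h₂ h₃₂ he₃ hg rfl
    exact ⟨C, hC, hCs.trans hss.subset, h⟩

/-- `e` and `f` lie in the same connected component of the restriction of `M` to `A`. -/
def SameComponent (M : Matroid ι) (A : Set ι) (e f : ι) : Prop :=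
  e = f ∨ ∃ C, M.IsCircuit C ∧ C ⊆ A ∧ e ∈ C ∧ f ∈ C

namespace SameComponent

variable {A B : Set ι} {e f g : ι}

theorem symm (h : SameComponent M A e f) : SameComponent M A f e := by
  rcases h with rfl | ⟨C, hC, hCA, he, hf⟩
  · exact Or.inl rfl
  · exact Or.inr ⟨C, hC, hCA, hf, he⟩

theorem mono (h : SameComponent M A e f) (hAB : A ⊆ B) : SameComponent M B e f := by
  rcases h with rfl | ⟨C, hC, hCA, he, hf⟩
  · exact Or.inl rfl
  · exact Or.inr ⟨C, hC, hCA.trans hAB, he, hf⟩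

theorem trans [Finite ι] (h : SameComponent M A e f) (h' : SameComponent M A f g) :
    SameComponent M A e g := by
  rcases h with rfl | ⟨C, hC, hCA, he, hf⟩
  · exact h'
  rcases h' with rfl | ⟨D, hD, hDA, hf', hg⟩
  · exact Or.inr ⟨C, hC, hCA, he, hf⟩
  obtain ⟨B, hB, hBs, heB, hgB⟩ := exists_isCircuit_of_inter_nonempty hC hD ⟨f, hf, hf'⟩ he hg
  exact Or.inr ⟨B, hB, hBs.trans (union_subset hCA hDA), heB, hgB⟩

theorem mem (h : SameComponent M A e f) (he : e ∈ A) : f ∈ A := by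
  rcases h with rfl | ⟨C, hC, hCA, -, hf⟩
  · exact he
  · exact hCA hf

theorem of_isCircuit {C : Set ι} (hC : M.IsCircuit C) (hCA : C ⊆ A) (he : e ∈ C) (hf : f ∈ C) :
    SameComponent M A e f :=
  Or.inr ⟨C, hC, hCA, he, hf⟩

end SameComponent

theorem IsConnectedFlat.sameComponent {F : Set ι} (hF : IsConnectedFlat M F) {e f : ι}
    (he : e ∈ F) (hf : f ∈ F) : SameComponent M F e f := by
  by_cases h : e = f
  · exact Or.inl h
  · obtain ⟨C, hC, hCF, heC, hfC⟩ := hF.2.2 e he f hf h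
    exact Or.inr ⟨C, hC, hCF, heC, hfC⟩

theorem isConnectedFlat_iff {F : Set ι} : IsConnectedFlat M F ↔
    M.IsFlat F ∧ F.Nonempty ∧ ∀ e ∈ F, ∀ f ∈ F, SameComponent M F e f := by
  refine ⟨fun h => ⟨h.1, h.2.1, fun e he f hf => h.sameComponent he hf⟩, fun h => ⟨h.1, h.2.1, ?_⟩⟩
  intro e he f hf hne
  obtain ⟨C, hC, hCF, heC, hfC⟩ := (h.2.2 e he f hf).resolve_left hne
  exact ⟨C, hC, hCF, heC, hfC⟩

end Circuits

section Connected

variable {ι : Type} {M : Matroid ι}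

theorem subset_ground (hM : IsConnectedFlat M univ) (X : Set ι) : X ⊆ M.E :=
  (subset_univ X).trans hM.1.subset_ground

/-- A connected matroid with at least two elements has no loops. -/
theorem exists_ne_mem_of_isCircuit [Nontrivial ι] (hM : IsConnectedFlat M univ) {C : Set ι}
    (hC : M.IsCircuit C)
    (e : ι) : ∃ f ∈ C, f ≠ e := by
  by_contra! h
  obtain ⟨f, hf⟩ := exists_ne e
  obtain ⟨D, hD, -, heD, hfD⟩ := hM.2.2 e (mem_univ _) f (mem_univ _) hf.symm
  have hCD : C ⊆ D := fun x hx => h x hx ▸ heD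
  exact hf (h f (hC.eq_of_subset_isCircuit hD hCD ▸ hfD))

/-- The closure of a set is connected if the elements of the set are in one component of the
closure. -/
theorem isConnectedFlat_closure [Finite ι] [Nontrivial ι] (hM : IsConnectedFlat M univ) {X : Set ι}
    (hX : X.Nonempty)
    (h : ∀ e ∈ X, ∀ f ∈ X, SameComponent M (M.closure X) e f) :
    IsConnectedFlat M (M.closure X) := by
  have hXc : X ⊆ M.closure X := M.subset_closure X (subset_ground hM X)
  have key : ∀ e ∈ M.closure X, ∃ x ∈ X, SameComponent M (M.closure X) e x := by
    intro e he
    by_cases heX : e ∈ X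
    · exact ⟨e, heX, Or.inl rfl⟩
    obtain ⟨C, hCX, hC, heC⟩ := Matroid.exists_isCircuit_of_mem_closure he heX
    obtain ⟨f, hf, hfe⟩ := exists_ne_mem_of_isCircuit hM hC e
    exact ⟨f, (hCX hf).resolve_left hfe,
      .of_isCircuit hC (hCX.trans (insert_subset he hXc)) heC hf⟩
  refine isConnectedFlat_iff.2 ⟨Matroid.isFlat_closure _, hX.mono hXc, fun e he f hf => ?_⟩
  obtain ⟨x, hx, hex⟩ := key e he
  obtain ⟨y, hy, hfy⟩ := key f hf
  exact hex.trans ((h x hx y hy).trans hfy.symm)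

theorem isConnectedFlat_closure_union [Finite ι] [Nontrivial ι] (hM : IsConnectedFlat M univ)
    {F G : Set ι}
    (hF : IsConnectedFlat M F) (hG : IsConnectedFlat M G) (h : (F ∩ G).Nonempty) :
    IsConnectedFlat M (M.closure (F ∪ G)) := by
  have hFc : F ⊆ M.closure (F ∪ G) :=
    subset_union_left.trans (M.subset_closure _ (subset_ground hM _))
  have hGc : G ⊆ M.closure (F ∪ G) :=
    subset_union_right.trans (M.subset_closure _ (subset_ground hM _))
  obtain ⟨x, hxF, hxG⟩ := h
  have key : ∀ e ∈ F ∪ G, SameComponent M (M.closure (F ∪ G)) e x := by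
    rintro e (he | he)
    · exact (hF.sameComponent he hxF).mono hFc
    · exact (hG.sameComponent he hxG).mono hGc
  exact isConnectedFlat_closure hM ⟨x, Or.inl hxF⟩ fun e he f hf =>
    (key e he).trans (key f hf).symm

/-- The component of `e` in the restriction of `M` to a flat is a connected flat. -/
theorem isConnectedFlat_setOf_sameComponent [Finite ι] [Nontrivial ι] (hM : IsConnectedFlat M univ)
    {A : Set ι}
    (hA : M.IsFlat A) {e : ι} (he : e ∈ A) :
    IsConnectedFlat M {f | SameComponent M A e f} := by
  have hsub : {f | SameComponent M A e f} ⊆ A := fun f hf => hf.mem he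
  refine isConnectedFlat_iff.2 ⟨?_, ⟨e, Or.inl rfl⟩, ?_⟩
  · refine isFlat_of_forall_isCircuit (subset_ground hM _) fun C hC f hf h => ?_
    obtain ⟨g, hg, hgf⟩ := exists_ne_mem_of_isCircuit hM hC f
    have hfA : f ∈ A := mem_of_isCircuit_of_isFlat hA hC hf (h.trans hsub)
    have hCA : C ⊆ A := fun x hx => by
      by_cases hxf : x = f
      · exact hxf ▸ hfA
      · exact hsub (h ⟨hx, hxf⟩)
    exact SameComponent.trans (h ⟨hg, hgf⟩) (.of_isCircuit hC hCA hg hf)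
  · intro f hf g hg
    -- circuits through `f` that lie in `A` lie in the component
    rcases hf.symm.trans hg with rfl | ⟨C, hC, hCA, hfC, hgC⟩
    · exact Or.inl rfl
    · exact .of_isCircuit hC
        (fun x hx => SameComponent.trans hf (.of_isCircuit hC hCA hfC hx)) hfC hgC

end Connected

/-! ### Nested sets -/

section Nested

variable {ι : Type} {M : Matroid ι} {S : Set (Set ι)}

theorem nestedSetComplex_mono {T : Set (Set ι)} (hS : S ∈ nestedSetComplex M) (h : T ⊆ S) :
    T ∈ nestedSetComplex M :=
  ⟨fun F hF => hS.1 F (h hF), fun U hU => hS.2 U (hU.trans h)⟩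

theorem ne_univ_of_mem (hM : IsConnectedFlat M univ) (hS : S ∈ nestedSetComplex M) {F : Set ι}
    (hF : F ∈ S) : F ≠ univ := by
  have : M.E = univ := subset_antisymm (subset_univ _) hM.1.subset_ground
  exact this ▸ (hS.1 F hF).2

/-- The members of a nested set form a laminar family. -/
theorem subset_or_subset_of_nested [Finite ι] [Nontrivial ι] (hM : IsConnectedFlat M univ)
    (hS : S ∈ nestedSetComplex M)
    {F G : Set ι} (hF : F ∈ S) (hG : G ∈ S) (h : (F ∩ G).Nonempty) : F ⊆ G ∨ G ⊆ F := by
  by_contra! hcon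
  have hne : F ≠ G := fun h => hcon.1 h.subset
  refine hS.2 {F, G} (by simp [insert_subset_iff, hF, hG])
    ⟨F, by simp, G, by simp, hne⟩ ?_ ?_
  · rw [isAntichain_insert]
    refine ⟨IsAntichain.singleton, fun B hB _ => ?_⟩
    rw [mem_singleton_iff] at hB
    subst hB
    exact hcon
  · rw [sUnion_pair]
    exact isConnectedFlat_closure_union hM (hS.1 F hF).1 (hS.1 G hG).1 h

/-- The join of an antichain in a nested set is the direct sum of its members: a circuit that is
contained, up to one element, in a union of members of a nested set is contained in one of them. -/
theorem exists_subset_of_isCircuit [Finite ι] [Nontrivial ι] (hM : IsConnectedFlat M univ)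
    (hS : S ∈ nestedSetComplex M)
    {U : Set (Set ι)} (hU : U ⊆ S) {C : Set ι} (hC : M.IsCircuit C) {e : ι} (he : e ∈ C)
    (h : C \ {e} ⊆ ⋃₀ U) : ∃ F ∈ U, C ⊆ F := by
  let T : Set (Set ι) := {F | Maximal (· ∈ U) F ∧ (F ∩ C).Nonempty}
  have hTU : T ⊆ U := fun F hF => hF.1.prop
  have hTC : C \ {e} ⊆ ⋃₀ T := by
    intro x hx
    obtain ⟨G, hG, hxG⟩ := h hx
    obtain ⟨F, hGF, hF⟩ := (toFinite U).exists_le_maximal hG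
    exact ⟨F, ⟨hF, x, hGF hxG, hx.1⟩, hGF hxG⟩
  obtain ⟨f, hfC, hfe⟩ := exists_ne_mem_of_isCircuit hM hC e
  obtain ⟨F, hFT, hfF⟩ := hTC ⟨hfC, hfe⟩
  by_cases hsub : T.Subsingleton
  · have hCF : C \ {e} ⊆ F := fun x hx => by
      obtain ⟨G, hG, hxG⟩ := hTC hx
      exact hsub hG hFT ▸ hxG
    have heF := mem_of_isCircuit_of_isFlat (hS.1 F (hU (hTU hFT))).1.1 hC he hCF
    refine ⟨F, hTU hFT, fun x hx => ?_⟩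
    by_cases hxe : x = e
    · exact hxe ▸ heF
    · exact hCF ⟨hx, hxe⟩
  · exfalso
    have hcl : ⋃₀ T ⊆ M.closure (⋃₀ T) := M.subset_closure _ (subset_ground hM _)
    refine hS.2 T (hTU.trans hU) (not_subsingleton_iff.1 hsub) ?_ ?_
    · intro A hA B hB hAB hle
      exact hAB (subset_antisymm hle (hA.1.2 hB.1.1 hle))
    · have heJ : e ∈ M.closure (⋃₀ T) :=
        M.closure_subset_closure hTC (hC.mem_closure_sdiff_singleton_of_mem he)
      have hCJ : C ⊆ M.closure (⋃₀ T) := fun x hx => by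
        by_cases hxe : x = e
        · exact hxe ▸ heJ
        · exact hcl (hTC ⟨hx, hxe⟩)
      have key : ∀ x ∈ ⋃₀ T, SameComponent M (M.closure (⋃₀ T)) x f := by
        rintro x ⟨G, hG, hxG⟩
        obtain ⟨y, hyG, hyC⟩ := hG.2
        exact (((hS.1 G (hU (hTU hG))).1.sameComponent hxG hyG).mono
          ((subset_sUnion_of_mem hG).trans hcl)).trans (.of_isCircuit hC hCJ hyC hfC)
      exact isConnectedFlat_closure hM ⟨f, F, hFT, hfF⟩ fun x hx y hy =>
        (key x hx).trans (key y hy).symm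

/-- A connected flat that is covered by members of a nested set is contained in one of them. -/
theorem exists_subset_of_subset_sUnion [Finite ι] [Nontrivial ι] (hM : IsConnectedFlat M univ)
    (hS : S ∈ nestedSetComplex M) {U : Set (Set ι)} (hU : U ⊆ S) {F : Set ι}
    (hF : IsConnectedFlat M F) (h : F ⊆ ⋃₀ U) : ∃ G ∈ U, F ⊆ G := by
  obtain ⟨e, he⟩ := hF.2.1
  obtain ⟨G₀, hG₀, heG₀⟩ := h he
  obtain ⟨G, hle, hG⟩ := (toFinite {G | G ∈ U}).exists_le_maximal hG₀
  have heG : e ∈ G := hle heG₀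
  refine ⟨G, hG.prop, fun f hf => ?_⟩
  by_cases hef : e = f
  · exact hef ▸ heG
  obtain ⟨C, hC, hCF, heC, hfC⟩ := hF.2.2 e he f hf hef
  obtain ⟨G', hG', hCG'⟩ := exists_subset_of_isCircuit hM hS hU hC heC
    (sdiff_subset.trans (hCF.trans h))
  rcases subset_or_subset_of_nested hM hS (hU hG.prop) (hU hG') ⟨e, heG, hCG' heC⟩ with h' | h'
  · exact hG.2 hG' h' (hCG' hfC)
  · exact h' (hCG' hfC)

/-- The smallest member of `S ∪ {E}` that contains `i`. -/
def minMember (S : Set (Set ι)) (i : ι) : Set ι := ⋂₀ {F | F ∈ insert univ S ∧ i ∈ F}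

/-- The smallest member of `S ∪ {E}` that strictly contains `F`. -/
def parent (S : Set (Set ι)) (F : Set ι) : Set ι := ⋂₀ {G | G ∈ insert univ S ∧ F ⊂ G}

theorem mem_minMember (S : Set (Set ι)) (i : ι) : i ∈ minMember S i := fun _ hF => hF.2

theorem minMember_subset {F : Set ι} {i : ι} (hF : F ∈ insert univ S) (hi : i ∈ F) :
    minMember S i ⊆ F := sInter_subset_of_mem ⟨hF, hi⟩

theorem laminar_insert [Finite ι] [Nontrivial ι] (hM : IsConnectedFlat M univ)
    (hS : S ∈ nestedSetComplex M)
    {F G : Set ι} (hF : F ∈ insert univ S) (hG : G ∈ insert univ S) (h : (F ∩ G).Nonempty) :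
    F ⊆ G ∨ G ⊆ F := by
  rcases hF with rfl | hF
  · exact Or.inr (subset_univ _)
  rcases hG with rfl | hG
  · exact Or.inl (subset_univ _)
  exact subset_or_subset_of_nested hM hS hF hG h

/-- In a finite chain the intersection is attained. -/
theorem sInter_mem_of_chain [Finite ι] {U : Set (Set ι)} (hne : U.Nonempty)
    (h : ∀ F ∈ U, ∀ G ∈ U, F ⊆ G ∨ G ⊆ F) : ⋂₀ U ∈ U := by
  obtain ⟨F, hF⟩ := (toFinite U).exists_minimal hne
  have : ⋂₀ U = F := subset_antisymm (sInter_subset_of_mem hF.prop) fun x hx G hG =>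
    (h F hF.prop G hG).elim (fun h => h hx) fun h => hF.2 hG h hx
  exact this ▸ hF.prop

theorem minMember_mem [Finite ι] [Nontrivial ι] (hM : IsConnectedFlat M univ)
    (hS : S ∈ nestedSetComplex M) (i : ι) :
    minMember S i ∈ insert univ S :=
  (sInter_mem_of_chain (U := {F | F ∈ insert univ S ∧ i ∈ F}) ⟨univ, by simp, mem_univ i⟩
    fun _ hF _ hG => laminar_insert hM hS hF.1 hG.1 ⟨i, hF.2, hG.2⟩).1

theorem isConnectedFlat_of_mem_insert (hM : IsConnectedFlat M univ)
    (hS : S ∈ nestedSetComplex M) {F : Set ι} (hF : F ∈ insert univ S) : IsConnectedFlat M F := by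
  rcases hF with rfl | hF
  · exact hM
  · exact (hS.1 F hF).1

theorem parent_mem [Finite ι] [Nontrivial ι] (hM : IsConnectedFlat M univ)
    (hS : S ∈ nestedSetComplex M) {F : Set ι}
    (hF : F ∈ S) : parent S F ∈ insert univ S ∧ F ⊂ parent S F := by
  obtain ⟨i, hi⟩ := (hS.1 F hF).1.2.1
  exact sInter_mem_of_chain (U := {G | G ∈ insert univ S ∧ F ⊂ G})
    ⟨univ, by simp, ssubset_univ_iff.2 (ne_univ_of_mem hM hS hF)⟩
    fun _ hF _ hG => laminar_insert hM hS hF.1 hG.1 ⟨i, hF.2.1 hi, hG.2.1 hi⟩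

theorem parent_subset {F G : Set ι} (hG : G ∈ insert univ S) (h : F ⊂ G) : parent S F ⊆ G :=
  sInter_subset_of_mem ⟨hG, h⟩

/-- A connected flat has an element that avoids the members of a nested set which do not
contain the flat. -/
theorem exists_mem_forall_subset [Finite ι] [Nontrivial ι] (hM : IsConnectedFlat M univ)
    (hS : S ∈ nestedSetComplex M)
    {F : Set ι} (hF : IsConnectedFlat M F) : ∃ i ∈ F, ∀ G ∈ S, i ∈ G → F ⊆ G := by
  by_contra! hcon
  have : F ⊆ ⋃₀ {G | G ∈ S ∧ ¬ F ⊆ G} := fun i hi => by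
    obtain ⟨G, hG, hiG, hFG⟩ := hcon i hi
    exact ⟨G, ⟨hG, hFG⟩, hiG⟩
  obtain ⟨G, hG, hFG⟩ := exists_subset_of_subset_sUnion hM hS (fun G hG => hG.1) hF this
  exact hG.2 hFG

theorem exists_minMember_eq [Finite ι] [Nontrivial ι] (hM : IsConnectedFlat M univ)
    (hS : S ∈ nestedSetComplex M)
    {F : Set ι} (hF : F ∈ insert univ S) : ∃ i, minMember S i = F := by
  obtain ⟨i, hi, h⟩ := exists_mem_forall_subset hM hS (isConnectedFlat_of_mem_insert hM hS hF)
  refine ⟨i, subset_antisymm (minMember_subset hF hi) (subset_sInter ?_)⟩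
  rintro G ⟨rfl | hG, hiG⟩
  · exact subset_univ _
  · exact h G hG hiG

theorem mem_iff_minMember_subset {F : Set ι} {i : ι} (hF : F ∈ insert univ S) :
    i ∈ F ↔ minMember S i ⊆ F :=
  ⟨minMember_subset hF, fun h => h (mem_minMember S i)⟩

end Nested

/-! ### The tropical linear space and nested sets -/

section Tropical

variable {ι : Type} {M : Matroid ι} {S : Set (Set ι)}

/-- The minimum of `w` over every circuit is attained at least twice. -/
def IsTropical (M : Matroid ι) (w : ι → ℝ) : Prop :=
  ∀ C, M.IsCircuit C → ∃ i ∈ C, ∃ j ∈ C, i ≠ j ∧ w i = w j ∧ ∀ k ∈ C, w i ≤ w k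

theorem mk_eq_mk_iff {w w' : ι → ℝ} :
    TropTorus.mk w = TropTorus.mk w' ↔ ∃ c, ∀ i, w i = w' i + c := by
  unfold TropTorus.mk
  rw [Submodule.Quotient.eq, Submodule.mem_span_singleton]
  refine exists_congr fun c => ?_
  rw [funext_iff]
  refine forall_congr' fun i => ?_
  simp only [Pi.smul_apply, Pi.one_apply, smul_eq_mul, mul_one, Pi.sub_apply]
  constructor <;> intro h <;> linarith

theorem mk_surjective (x : TropTorus ι) : ∃ w, TropTorus.mk w = x :=
  Submodule.Quotient.mk_surjective _ x

theorem mk_add (w w' : ι → ℝ) : TropTorus.mk (w + w') = TropTorus.mk w + TropTorus.mk w' := rfl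

theorem mk_smul (c : ℝ) (w : ι → ℝ) : TropTorus.mk (c • w) = c • TropTorus.mk w := rfl

theorem mk_mem_tropicalLinearSpace {w : ι → ℝ} :
    TropTorus.mk w ∈ tropicalLinearSpace M ↔ IsTropical M w := by
  refine ⟨fun ⟨w', hw', h⟩ => ?_, fun h => ⟨w, h, rfl⟩⟩
  obtain ⟨c, hc⟩ := mk_eq_mk_iff.1 h
  intro C hC
  obtain ⟨i, hi, j, hj, hne, hij, hk⟩ := hw' C hC
  refine ⟨i, hi, j, hj, hne, by linarith [hc i, hc j], fun k hkC => ?_⟩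
  linarith [hc i, hc k, hk k hkC]

/-- No circuit has a unique minimum. -/
theorem IsTropical.exists_le {w : ι → ℝ} (hw : IsTropical M w) {C : Set ι} (hC : M.IsCircuit C)
    (i : ι) : ∃ j ∈ C, j ≠ i ∧ ∀ k ∈ C, w j ≤ w k := by
  obtain ⟨a, ha, b, hb, hne, hab, hk⟩ := hw C hC
  by_cases h : a = i
  · exact ⟨b, hb, fun h' => hne (h.trans h'.symm), fun k hkC => hab ▸ hk k hkC⟩
  · exact ⟨a, ha, h, hk⟩

theorem isTropical_of_forall [Finite ι] {w : ι → ℝ}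
    (h : ∀ C, M.IsCircuit C → ∀ i ∈ C, ∃ j ∈ C, j ≠ i ∧ w j ≤ w i) : IsTropical M w := by
  intro C hC
  obtain ⟨i, hi, hmin⟩ := (toFinite C).exists_minimalFor w C hC.nonempty
  obtain ⟨j, hj, hne, hle⟩ := h C hC i hi
  have hmin' : ∀ k ∈ C, w i ≤ w k := fun k hk => by
    by_contra hcon
    exact hcon (hmin hk (not_le.1 hcon).le)
  exact ⟨i, hi, j, hj, hne.symm, le_antisymm (hmin' j hj) hle, hmin'⟩

theorem IsTropical.isFlat_superlevel (hM : IsConnectedFlat M univ) {w : ι → ℝ}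
    (hw : IsTropical M w) (t : ℝ) : M.IsFlat {k | t ≤ w k} := by
  refine isFlat_of_forall_isCircuit (subset_ground hM _) fun C hC e he h => ?_
  obtain ⟨j, hj, hne, hmin⟩ := hw.exists_le hC e
  have : t ≤ w j := h ⟨hj, hne⟩
  exact this.trans (hmin e he)

/-- The component of `i` in the set where `w` is at least `w i`. -/
def component (M : Matroid ι) (w : ι → ℝ) (i : ι) : Set ι :=
  {j | SameComponent M {k | w i ≤ w k} i j}

/-- The components of the superlevel sets of `w`, without the ground set. -/
def nestedSupport (M : Matroid ι) (w : ι → ℝ) : Set (Set ι) :=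
  range (component M w) \ {univ}

theorem mem_component (w : ι → ℝ) (i : ι) : i ∈ component M w i := Or.inl rfl

theorem le_of_mem_component {w : ι → ℝ} {i j : ι} (h : j ∈ component M w i) : w i ≤ w j :=
  SameComponent.mem (A := {k | w i ≤ w k}) h (le_refl (w i))

theorem component_subset [Finite ι] {w : ι → ℝ} {i j : ι} (h : j ∈ component M w i) :
    component M w j ⊆ component M w i := fun _ hk =>
  SameComponent.trans h (SameComponent.mono hk fun _ hl => (le_of_mem_component h).trans hl)

theorem mem_component_of_sameComponent {w : ι → ℝ} {i j : ι} {t : ℝ}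
    (h : SameComponent M {k | t ≤ w k} i j) (hi : w i ≤ t) : j ∈ component M w i :=
  h.mono fun _ hk => hi.trans hk

theorem component_eq [Finite ι] {w : ι → ℝ} {i j : ι} (h : j ∈ component M w i)
    (hw : w j ≤ w i) : component M w j = component M w i := by
  refine subset_antisymm (component_subset h) (component_subset ?_)
  exact mem_component_of_sameComponent (SameComponent.symm h) hw

theorem isConnectedFlat_component [Finite ι] [Nontrivial ι] (hM : IsConnectedFlat M univ)
    {w : ι → ℝ} (hw : IsTropical M w) (i : ι) : IsConnectedFlat M (component M w i) :=
  isConnectedFlat_setOf_sameComponent hM (hw.isFlat_superlevel hM _) (le_refl (w i))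

theorem ground_eq (hM : IsConnectedFlat M univ) : M.E = univ :=
  subset_antisymm (subset_univ _) hM.1.subset_ground

theorem nestedSupport_mem [Finite ι] [Nontrivial ι] (hM : IsConnectedFlat M univ)
    {w : ι → ℝ} (hw : IsTropical M w) : nestedSupport M w ∈ nestedSetComplex M := by
  refine ⟨?_, ?_⟩
  · rintro _ ⟨⟨i, rfl⟩, hne⟩
    exact ⟨isConnectedFlat_component hM hw i, ground_eq hM ▸ hne⟩
  · intro T hT hTn hTa hcon
    -- a member of `T` whose minimum is the smallest contains all other members
    let I : Set ι := {i | component M w i ∈ T}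
    have hI : I.Nonempty := by
      obtain ⟨F, hF⟩ := hTn.nonempty
      obtain ⟨⟨i, rfl⟩, -⟩ := hT hF
      exact ⟨i, hF⟩
    obtain ⟨i, hi, hmin⟩ := (toFinite I).exists_minimalFor w I hI
    have hmin' : ∀ k ∈ I, w i ≤ w k := fun k hk => by
      by_contra hcon
      exact hcon (hmin hk (not_le.1 hcon).le)
    obtain ⟨F, hF, hne⟩ := hTn.exists_ne (component M w i)
    obtain ⟨⟨j, rfl⟩, -⟩ := hT hF
    have hsub : ⋃₀ T ⊆ {k | w i ≤ w k} := by
      rintro x ⟨G, hG, hx⟩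
      obtain ⟨⟨k, rfl⟩, -⟩ := hT hG
      exact (hmin' k hG).trans (le_of_mem_component hx)
    have hcl : M.closure (⋃₀ T) ⊆ {k | w i ≤ w k} := by
      have := M.closure_subset_closure hsub
      rwa [(hw.isFlat_superlevel hM _).closure] at this
    have hcl' : ⋃₀ T ⊆ M.closure (⋃₀ T) := M.subset_closure _ (subset_ground hM _)
    have hij : j ∈ component M w i :=
      (hcon.sameComponent (hcl' ⟨_, hi, mem_component w i⟩)
        (hcl' ⟨_, hF, mem_component w j⟩)).mono hcl
    exact hTa hF hi hne (component_subset hij)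

theorem minMember_nestedSupport [Finite ι] {w : ι → ℝ} (i : ι) :
    minMember (nestedSupport M w) i = component M w i := by
  have hmem : ∀ j, component M w j ∈ insert univ (nestedSupport M w) := fun j => by
    by_cases h : component M w j = univ
    · exact Or.inl h
    · exact Or.inr ⟨⟨j, rfl⟩, h⟩
  refine subset_antisymm (minMember_subset (hmem i) (mem_component w i)) (subset_sInter ?_)
  rintro F ⟨rfl | ⟨⟨j, rfl⟩, -⟩, hi⟩
  · exact subset_univ _
  · exact component_subset hi

theorem univ_notMem (hM : IsConnectedFlat M univ) (hS : S ∈ nestedSetComplex M) : univ ∉ S :=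
  fun h => ne_univ_of_mem hM hS h rfl

theorem nestedSupport_congr {w w' : ι → ℝ} {r : ℝ} (h : ∀ i, w i = w' i + r) :
    nestedSupport M w = nestedSupport M w' := by
  have : component M w = component M w' := by
    funext i
    have : {k | w i ≤ w k} = {k | w' i ≤ w' k} := by
      ext k
      simp [h]
    simp only [component, this]
  rw [nestedSupport, nestedSupport, this]

end Tropical

section Combination

variable {ι : Type} [Fintype ι] {M : Matroid ι} {S : Set (Set ι)}

open Classical in
/-- The vector `∑_{F ∈ S} c_F e_F`. -/
noncomputable def combination (S : Set (Set ι)) (c : Set ι → ℝ) (i : ι) : ℝ :=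
  ∑ F with F ∈ S ∧ i ∈ F, c F

open Classical in
theorem mk_combination (S : Set (Set ι)) (c : Set ι → ℝ) :
    TropTorus.mk (combination S c) = ∑ F with F ∈ S, c F • incidenceVector F := by
  have : combination S c = ∑ F with F ∈ S, c F • (fun i => if i ∈ F then (1 : ℝ) else 0) := by
    funext i
    simp only [combination, Finset.sum_apply, Pi.smul_apply, smul_eq_mul, mul_ite, mul_one,
      mul_zero]
    rw [← Finset.sum_filter, Finset.filter_filter]
  rw [this]
  exact map_sum (Submodule.mkQ _) _ _

theorem combination_congr {c c' : Set ι → ℝ} (h : ∀ F ∈ S, c F = c' F) :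
    combination S c = combination S c' := by
  classical
  funext i
  exact Finset.sum_congr rfl fun F hF => h F (Finset.mem_filter.1 hF).2.1

theorem combination_add (S : Set (Set ι)) (c c' : Set ι → ℝ) :
    combination S (c + c') = combination S c + combination S c' := by
  funext i
  exact Finset.sum_add_distrib

theorem combination_smul (S : Set (Set ι)) (r : ℝ) (c : Set ι → ℝ) :
    combination S (r • c) = r • combination S c := by
  funext i
  simp [combination, Finset.mul_sum]

theorem combination_subset {T : Set (Set ι)} (h : T ⊆ S) {c : Set ι → ℝ}
    (hc : ∀ F ∈ S, F ∉ T → c F = 0) : combination T c = combination S c := by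
  classical
  funext i
  refine Finset.sum_subset (fun F hF => ?_) fun F hF hF' => ?_
  · simp only [Finset.mem_filter, Finset.mem_univ, true_and] at hF ⊢
    exact ⟨h hF.1, hF.2⟩
  · simp only [Finset.mem_filter, Finset.mem_univ, true_and, not_and] at hF hF'
    exact hc F hF.1 fun h => hF' h hF.2

theorem combination_eq_zero {c : Set ι → ℝ} {i : ι} (h : minMember S i = univ)
    (hS : univ ∉ S) : combination S c i = 0 := by
  classical
  refine Finset.sum_eq_zero fun F hF => ?_
  obtain ⟨hFS, hiF⟩ := (Finset.mem_filter.1 hF).2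
  have := minMember_subset (Or.inr hFS) hiF
  rw [h, univ_subset_iff] at this
  exact absurd (this ▸ hFS) hS

/-- The coefficient at `F` is the difference of the values on `F` and on its parent. -/
theorem combination_eq_add [Nontrivial ι] (hM : IsConnectedFlat M univ)
    (hS : S ∈ nestedSetComplex M) {c : Set ι → ℝ} {F : Set ι} (hF : F ∈ S) {i j : ι}
    (hi : minMember S i = F) (hj : minMember S j = parent S F) :
    combination S c i = combination S c j + c F := by
  classical
  have hp := parent_mem hM hS hF
  have : (Finset.univ.filter fun G => G ∈ S ∧ i ∈ G) =
      insert F (Finset.univ.filter fun G => G ∈ S ∧ j ∈ G) := by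
    ext G
    simp only [Finset.mem_filter, Finset.mem_univ, true_and, Finset.mem_insert]
    constructor
    · rintro ⟨hG, hiG⟩
      rw [mem_iff_minMember_subset (Or.inr hG), hi] at hiG
      by_cases h : G = F
      · exact Or.inl h
      · refine Or.inr ⟨hG, ?_⟩
        rw [mem_iff_minMember_subset (Or.inr hG), hj]
        exact parent_subset (Or.inr hG) (lt_of_le_of_ne hiG (Ne.symm h))
    · rintro (rfl | ⟨hG, hjG⟩)
      · exact ⟨hF, hi ▸ mem_minMember S i⟩
      · refine ⟨hG, ?_⟩
        rw [mem_iff_minMember_subset (Or.inr hG), hj] at hjG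
        rw [mem_iff_minMember_subset (Or.inr hG), hi]
        exact hp.2.subset.trans hjG
  unfold combination
  rw [this, Finset.sum_insert, add_comm]
  simp only [Finset.mem_filter, Finset.mem_univ, true_and, not_and]
  intro _ hjF
  rw [mem_iff_minMember_subset (Or.inr hF), hj] at hjF
  exact hp.2.2 hjF

/-- A function of the smallest member of `S ∪ {E}` is a combination of the `e_F`, `F ∈ S`, and of
a constant: the coefficients are the jumps from the parents. -/
theorem combination_jump [Nontrivial ι] (hM : IsConnectedFlat M univ)
    (hS : S ∈ nestedSetComplex M) (h : Set ι → ℝ) (i : ι) :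
    h (minMember S i) = combination S (fun F => h F - h (parent S F)) i + h univ := by
  generalize hF : minMember S i = F
  have hFS : F ∈ insert univ S := hF ▸ minMember_mem hM hS i
  induction F using WellFounded.induction
    (r := ((· > ·) : Set ι → Set ι → Prop)) (wellFounded_gt) generalizing i with
  | _ F ih =>
  rcases hFS with rfl | hFS
  · rw [combination_eq_zero hF (univ_notMem hM hS), zero_add]
  · obtain ⟨hp, hlt⟩ := parent_mem hM hS hFS
    obtain ⟨j, hj⟩ := exists_minMember_eq hM hS hp
    have := ih _ hlt j hj hp
    rw [combination_eq_add hM hS hFS hF hj]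
    linarith

/-- The vectors `e_F`, `F ∈ S`, are linearly independent modulo constants. -/
theorem eq_of_combination_eq [Nontrivial ι] (hM : IsConnectedFlat M univ)
    (hS : S ∈ nestedSetComplex M) {c c' : Set ι → ℝ} {r : ℝ}
    (h : ∀ i, combination S c i = combination S c' i + r) {F : Set ι} (hF : F ∈ S) :
    c F = c' F := by
  obtain ⟨hp, hlt⟩ := parent_mem hM hS hF
  obtain ⟨i, hi⟩ := exists_minMember_eq hM hS (Or.inr hF)
  obtain ⟨j, hj⟩ := exists_minMember_eq hM hS hp
  have h₁ := combination_eq_add (c := c) hM hS hF hi hj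
  have h₂ := combination_eq_add (c := c') hM hS hF hi hj
  linarith [h i, h j]

theorem le_combination {c : Set ι → ℝ} (hc : ∀ F ∈ S, 0 ≤ c F) {i j : ι}
    (h : ∀ F ∈ S, i ∈ F → j ∈ F) : combination S c i ≤ combination S c j := by
  classical
  refine Finset.sum_le_sum_of_subset_of_nonneg (fun F hF => ?_) fun F hF _ => ?_
  · simp only [Finset.mem_filter, Finset.mem_univ, true_and] at hF ⊢
    exact ⟨hF.1, h F hF.1 hF.2⟩
  · exact hc F (Finset.mem_filter.1 hF).2.1

theorem lt_combination {c : Set ι → ℝ} (hc : ∀ F ∈ S, 0 ≤ c F) {i j : ι}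
    (h : ∀ F ∈ S, i ∈ F → j ∈ F) {F : Set ι} (hF : F ∈ S) (hcF : 0 < c F) (hj : j ∈ F)
    (hi : i ∉ F) : combination S c i < combination S c j := by
  classical
  refine Finset.sum_lt_sum_of_subset (i := F) (fun G hG => ?_) ?_ ?_ hcF fun G hG _ => ?_
  · simp only [Finset.mem_filter, Finset.mem_univ, true_and] at hG ⊢
    exact ⟨hG.1, h G hG.1 hG.2⟩
  · simp [hF, hj]
  · simp [hi]
  · exact hc G (Finset.mem_filter.1 hG).2.1

/-- The cone over a nested set lies in the tropical linear space. -/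
theorem isTropical_combination [Nontrivial ι] (hM : IsConnectedFlat M univ)
    (hS : S ∈ nestedSetComplex M) {c : Set ι → ℝ} (hc : ∀ F ∈ S, 0 ≤ c F) :
    IsTropical M (combination S c) := by
  refine isTropical_of_forall fun C hC i hi => ?_
  by_contra! hcon
  have : C \ {i} ⊆ ⋃₀ {F | F ∈ S ∧ i ∉ F} := by
    rintro j ⟨hj, hji⟩
    by_contra hj'
    refine not_le.2 (hcon j hj hji) (le_combination hc fun F hF hjF => ?_)
    by_contra hiF
    exact hj' ⟨F, ⟨hF, hiF⟩, hjF⟩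
  obtain ⟨F, hF, hCF⟩ := exists_subset_of_isCircuit hM hS (fun F hF => hF.1) hC hi this
  exact hF.2 (hCF hi)

theorem component_combination [Nontrivial ι] (hM : IsConnectedFlat M univ)
    (hS : S ∈ nestedSetComplex M) {c : Set ι → ℝ} (hc : ∀ F ∈ S, 0 < c F) (i : ι) :
    component M (combination S c) i = minMember S i := by
  have hc' : ∀ F ∈ S, 0 ≤ c F := fun F hF => (hc F hF).le
  have hmem := minMember_mem hM hS i
  refine subset_antisymm ?_ ?_
  · rintro j (rfl | ⟨C, hC, hCi, hiC, hjC⟩)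
    · exact mem_minMember S i
    rcases hmem with hmem | hmem
    · rw [hmem]; exact mem_univ j
    -- the circuit is covered by the members that contain `i` minimally or do not contain `i`
    let U : Set (Set ι) := {F | F ∈ S ∧ (F = minMember S i ∨ i ∉ F)}
    have hCU : C \ {i} ⊆ ⋃₀ U := by
      rintro k ⟨hk, -⟩
      by_contra hkU
      have hki : k ∉ minMember S i := fun h => hkU ⟨_, ⟨hmem, Or.inl rfl⟩, h⟩
      refine not_lt.2 (hCi hk) (lt_combination hc' (fun F hF hkF => ?_) hmem (hc _ hmem)
        (mem_minMember S i) hki)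
      by_contra hiF
      exact hkU ⟨F, ⟨hF, Or.inr hiF⟩, hkF⟩
    obtain ⟨F, hF, hCF⟩ := exists_subset_of_isCircuit hM hS (fun F hF => hF.1) hC hiC hCU
    rcases hF.2 with rfl | hiF
    · exact hCF hjC
    · exact absurd (hCF hiC) hiF
  · intro j hj
    exact ((isConnectedFlat_of_mem_insert hM hS hmem).sameComponent (mem_minMember S i) hj).mono
      fun k hk => le_combination hc' fun F hF hiF => minMember_subset (Or.inr hF) hiF hk

theorem nestedSupport_combination [Nontrivial ι] (hM : IsConnectedFlat M univ)
    (hS : S ∈ nestedSetComplex M) {c : Set ι → ℝ} (hc : ∀ F ∈ S, 0 < c F) :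
    nestedSupport M (combination S c) = S := by
  ext F
  constructor
  · rintro ⟨⟨i, rfl⟩, hne⟩
    rw [component_combination hM hS hc] at hne ⊢
    exact (minMember_mem hM hS i).resolve_left hne
  · intro hF
    obtain ⟨i, hi⟩ := exists_minMember_eq hM hS (Or.inr hF)
    exact ⟨⟨i, by rw [component_combination hM hS hc, hi]⟩, ne_univ_of_mem hM hS hF⟩

/-- Every point of the tropical linear space is a positive combination of the `e_F` of its nested
set. -/
theorem exists_combination_of_isTropical [Nontrivial ι] (hM : IsConnectedFlat M univ)
    {w : ι → ℝ} (hw : IsTropical M w) : ∃ c : Set ι → ℝ, ∃ r : ℝ,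
      (∀ F ∈ nestedSupport M w, 0 < c F) ∧
      ∀ i, w i = combination (nestedSupport M w) c i + r := by
  have hS := nestedSupport_mem hM hw
  let h : Set ι → ℝ := fun F => sInf (w '' F)
  have hh : ∀ i, h (component M w i) = w i := fun i => by
    refine IsLeast.csInf_eq ⟨⟨i, mem_component w i, rfl⟩, ?_⟩
    rintro _ ⟨j, hj, rfl⟩
    exact le_of_mem_component hj
  refine ⟨fun F => h F - h (parent (nestedSupport M w) F), h univ, fun F hF => ?_, fun i => ?_⟩
  · obtain ⟨hp, hlt⟩ := parent_mem hM hS hF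
    obtain ⟨j, hj⟩ := exists_minMember_eq hM hS hp
    obtain ⟨⟨i, rfl⟩, -⟩ := hF
    rw [minMember_nestedSupport] at hj
    rw [← hj] at hlt
    change 0 < h _ - h (parent _ _)
    rw [← hj, hh, hh, sub_pos]
    have hij : i ∈ component M w j := hlt.1 (mem_component w i)
    refine lt_of_le_of_ne (le_of_mem_component hij) fun heq => ?_
    exact hlt.ne (component_eq hij heq.ge)
  · rw [← combination_jump hM hS h i, minMember_nestedSupport, hh]

end Combination

/-! ### The fan over the nested set complex -/

section NestedFan

theorem incidenceCone_mono {ι : Type} {S T : Set (Set ι)} (h : T ⊆ S) : incidenceCone T ≤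
    incidenceCone S :=
  Submodule.span_mono (image_mono h)

variable {ι : Type} [Fintype ι] {M : Matroid ι} {S T : Set (Set ι)}

theorem mk_combination_mem {c : Set ι → ℝ} (hc : ∀ F ∈ S, 0 ≤ c F) :
    TropTorus.mk (combination S c) ∈ incidenceCone S := by
  classical
  rw [mk_combination]
  refine Submodule.sum_mem _ fun F hF => ?_
  have hFS : F ∈ S := (Finset.mem_filter.1 hF).2
  exact Submodule.smul_mem (incidenceCone S) ⟨c F, hc F hFS⟩
    (Submodule.subset_span ⟨F, hFS, rfl⟩)

theorem mem_incidenceCone {x : TropTorus ι} : x ∈ incidenceCone S ↔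
    ∃ c : Set ι → ℝ, (∀ F ∈ S, 0 ≤ c F) ∧ TropTorus.mk (combination S c) = x := by
  classical
  refine ⟨fun hx => ?_, fun ⟨c, hc, h⟩ => h ▸ mk_combination_mem hc⟩
  induction hx using Submodule.span_induction with
  | mem x hx =>
    obtain ⟨F, hF, rfl⟩ := hx
    refine ⟨Pi.single F 1, fun G _ => ?_, ?_⟩
    · by_cases h : G = F
      · subst h; simp
      · simp [h]
    · rw [mk_combination, Finset.sum_eq_single F]
      · simp
      · intro G _ hne; simp [hne]
      · intro h; exact absurd (by simpa using hF) h
  | zero =>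
    refine ⟨0, fun _ _ => le_rfl, ?_⟩
    rw [mk_combination]; simp
  | add x y _ _ hx hy =>
    obtain ⟨c, hc, rfl⟩ := hx
    obtain ⟨d, hd, rfl⟩ := hy
    exact ⟨c + d, fun F hF => add_nonneg (hc F hF) (hd F hF), by rw [combination_add, mk_add]⟩
  | smul a x _ hx =>
    obtain ⟨c, hc, rfl⟩ := hx
    exact ⟨(a : ℝ) • c, fun F hF => mul_nonneg a.2 (hc F hF), by
      rw [combination_smul, mk_smul]; rfl⟩

theorem eq_incidenceCone_of_isFaceOf {τ : PointedCone ℝ (TropTorus ι)}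
    (hτ : τ.IsFaceOf (incidenceCone S)) :
    τ = incidenceCone {F | F ∈ S ∧ incidenceVector F ∈ τ} := by
  classical
  refine le_antisymm (fun x hx => ?_) ?_
  · obtain ⟨c, hc, rfl⟩ := mem_incidenceCone.1 (hτ.le hx)
    rw [← combination_subset (T := {F | F ∈ S ∧ incidenceVector F ∈ τ}) (fun F hF => hF.1)
      fun F hF hF' => ?_]
    · exact mk_combination_mem fun F hF => hc F hF.1
    · by_contra hne
      refine hF' ⟨hF, ?_⟩
      rw [mk_combination, ← Finset.add_sum_erase _ _ (a := F) (by simpa using hF)] at hx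
      refine hτ.mem_of_smul_add_mem (Submodule.subset_span ⟨F, hF, rfl⟩) ?_
        (lt_of_le_of_ne (hc F hF) (Ne.symm hne)) hx
      refine Submodule.sum_mem _ fun G hG => ?_
      have hGS : G ∈ S := (Finset.mem_filter.1 (Finset.mem_of_mem_erase hG)).2
      exact Submodule.smul_mem (incidenceCone S) ⟨c G, hc G hGS⟩
        (Submodule.subset_span ⟨G, hGS, rfl⟩)
  · refine Submodule.span_le.2 ?_
    rintro _ ⟨F, hF, rfl⟩
    exact hF.2

variable [Nontrivial ι]

theorem nestedSupport_subset (hM : IsConnectedFlat M univ) (hS : S ∈ nestedSetComplex M)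
    {w : ι → ℝ} (hw : TropTorus.mk w ∈ incidenceCone S) : nestedSupport M w ⊆ S := by
  obtain ⟨c, hc, h⟩ := mem_incidenceCone.1 hw
  obtain ⟨r, hr⟩ := mk_eq_mk_iff.1 h.symm
  have hsub : {F | F ∈ S ∧ 0 < c F} ⊆ S := fun F hF => hF.1
  rw [nestedSupport_congr hr, ← combination_subset hsub
    (fun F hF hF' => le_antisymm (not_lt.1 fun h => hF' ⟨hF, h⟩) (hc F hF)),
    nestedSupport_combination hM (nestedSetComplex_mono hS hsub) fun F hF => hF.2]
  exact hsub

theorem mk_mem_incidenceCone_nestedSupport (hM : IsConnectedFlat M univ) {w : ι → ℝ}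
    (hw : IsTropical M w) : TropTorus.mk w ∈ incidenceCone (nestedSupport M w) := by
  obtain ⟨c, r, hc, h⟩ := exists_combination_of_isTropical hM hw
  rw [mk_eq_mk_iff.2 ⟨r, h⟩]
  exact mk_combination_mem fun F hF => (hc F hF).le

theorem incidenceCone_inf (hM : IsConnectedFlat M univ) (hS : S ∈ nestedSetComplex M)
    (hT : T ∈ nestedSetComplex M) :
    incidenceCone S ⊓ incidenceCone T = incidenceCone (S ∩ T) := by
  refine le_antisymm ?_ (le_inf (incidenceCone_mono inter_subset_left)
    (incidenceCone_mono inter_subset_right))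
  rintro x ⟨hxS, hxT⟩
  obtain ⟨w, rfl⟩ := mk_surjective x
  obtain ⟨c, hc, h⟩ := mem_incidenceCone.1 hxS
  have hw : IsTropical M w := by
    rw [← mk_mem_tropicalLinearSpace, ← h, mk_mem_tropicalLinearSpace]
    exact isTropical_combination hM hS hc
  exact incidenceCone_mono (subset_inter (nestedSupport_subset hM hS hxS)
    (nestedSupport_subset hM hT hxT)) (mk_mem_incidenceCone_nestedSupport hM hw)

theorem isFaceOf_incidenceCone (hM : IsConnectedFlat M univ) (hS : S ∈ nestedSetComplex M)
    (h : T ⊆ S) : (incidenceCone T).IsFaceOf (incidenceCone S) where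
  le := incidenceCone_mono h
  mem_of_smul_add_mem := by
    classical
    intro x y a hx hy ha hxy
    obtain ⟨c, hc, rfl⟩ := mem_incidenceCone.1 hx
    obtain ⟨d, hd, rfl⟩ := mem_incidenceCone.1 hy
    obtain ⟨b, hb, hbx⟩ := mem_incidenceCone.1 hxy
    rw [← mk_smul, ← mk_add, ← combination_smul, ← combination_add] at hbx
    have hbT : combination T b = combination S (fun F => if F ∈ T then b F else 0) := by
      rw [← combination_subset h fun F _ hF => by simp [hF]]
      exact combination_congr fun F hF => by simp [hF]
    rw [hbT] at hbx
    obtain ⟨r, hr⟩ := mk_eq_mk_iff.1 hbx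
    rw [← combination_subset h (c := c) fun F hF hFT => ?_]
    · exact mk_combination_mem fun F hF => hc F (h hF)
    · have := eq_of_combination_eq hM hS hr hF
      simp only [hFT, if_false, Pi.add_apply, Pi.smul_apply, smul_eq_mul] at this
      have h₁ := mul_nonneg ha.le (hc F hF)
      have h₂ : a * c F = 0 := by linarith [hd F hF]
      exact (mul_eq_zero.1 h₂).resolve_left ha.ne'

theorem isFanStructure_nestedFan (hM : IsConnectedFlat M univ) :
    IsFanStructure (incidenceCone '' nestedSetComplex M) (tropicalLinearSpace M) where
  finite := (toFinite _).image _
  polyhedral := by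
    rintro _ ⟨S, -, rfl⟩
    exact Submodule.fg_span ((toFinite S).image _)
  face_mem := by
    rintro _ ⟨S, hS, rfl⟩ τ hτ
    exact ⟨_, nestedSetComplex_mono hS fun F hF => hF.1, (eq_incidenceCone_of_isFaceOf hτ).symm⟩
  inter_face := by
    rintro _ ⟨S, hS, rfl⟩ _ ⟨T, hT, rfl⟩
    rw [incidenceCone_inf hM hS hT]
    exact isFaceOf_incidenceCone hM hS inter_subset_left
  support := by
    ext x
    obtain ⟨w, rfl⟩ := mk_surjective x
    simp only [mem_iUnion, exists_prop, SetLike.mem_coe]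
    rw [mk_mem_tropicalLinearSpace]
    constructor
    · rintro ⟨_, ⟨S, hS, rfl⟩, hw⟩
      obtain ⟨c, hc, h⟩ := mem_incidenceCone.1 hw
      rw [← mk_mem_tropicalLinearSpace, ← h, mk_mem_tropicalLinearSpace]
      exact isTropical_combination hM hS hc
    · intro hw
      exact ⟨_, ⟨_, nestedSupport_mem hM hw, rfl⟩, mk_mem_incidenceCone_nestedSupport hM hw⟩

theorem incidenceCone_le_iff (hM : IsConnectedFlat M univ) (hS : S ∈ nestedSetComplex M)
    (hT : T ∈ nestedSetComplex M) : incidenceCone S ≤ incidenceCone T ↔ S ⊆ T := by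
  refine ⟨fun h => ?_, incidenceCone_mono⟩
  have h1 : nestedSupport M (combination S 1) = S :=
    nestedSupport_combination hM hS fun _ _ => zero_lt_one
  rw [← h1]
  exact nestedSupport_subset hM hT (h (mk_combination_mem fun _ _ => zero_le_one))

theorem isFanOver_nestedFan (hM : IsConnectedFlat M univ) :
    IsFanOver (incidenceCone '' nestedSetComplex M) (nestedSetComplex M) where
  linearIndep := by
    classical
    intro S hS
    rw [linearIndepOn_iff]
    intro l hl h
    have hl' : ∀ F ∉ S, l F = 0 := fun F hF => by
      by_contra hne
      exact hF (hl (Finsupp.mem_support_iff.2 hne))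
    rw [Finsupp.linearCombination_apply, Finsupp.sum_fintype _ _ (by simp)] at h
    have h' : TropTorus.mk (combination S l) = TropTorus.mk (combination S 0) := by
      rw [mk_combination, mk_combination]
      simp only [Pi.zero_apply, zero_smul, Finset.sum_const_zero]
      rw [← h]
      refine Finset.sum_subset (Finset.subset_univ _) fun F _ hF => ?_
      rw [hl' F (by simpa using hF), zero_smul]
    obtain ⟨r, hr⟩ := mk_eq_mk_iff.1 h'
    ext F
    by_cases hF : F ∈ S
    · exact eq_of_combination_eq hM hS hr hF
    · exact hl' F hF
  bijOn := by
    refine ⟨mapsTo_image _ _, fun S hS T hT h => ?_, surjOn_image _ _⟩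
    exact subset_antisymm ((incidenceCone_le_iff hM hS hT).1 h.le)
      ((incidenceCone_le_iff hM hT hS).1 h.ge)

end NestedFan

/-! ### Polyhedral cones and coarsest fan structures -/

section Fans

variable {V : Type*} [AddCommGroup V] [Module ℝ V]

theorem mem_hull_finset {s : Finset V} {x : V} : x ∈ PointedCone.hull ℝ (s : Set V) ↔
    ∃ c : V → ℝ, (∀ g ∈ s, 0 ≤ c g) ∧ ∑ g ∈ s, c g • g = x := by
  constructor
  · intro h
    obtain ⟨c, hcs, hc, rfl⟩ := PointedCone.mem_hull_set.1 h
    refine ⟨c, fun g _ => hc g, ?_⟩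
    exact (Finsupp.sum_of_support_subset c (by exact_mod_cast hcs)
      (fun g r => r • g) (by simp)).symm
  · rintro ⟨c, hc, rfl⟩
    exact Submodule.sum_mem _ fun g hg => Submodule.smul_mem (PointedCone.hull ℝ (s : Set V))
      ⟨c g, hc g hg⟩ (Submodule.subset_span hg)

/-- Carathéodory's theorem for cones. -/
theorem exists_linearIndepOn_of_mem_hull {s : Finset V} {x : V}
    (hx : x ∈ PointedCone.hull ℝ (s : Set V)) :
    ∃ t ⊆ s, LinearIndepOn ℝ id (t : Set V) ∧ x ∈ PointedCone.hull ℝ (t : Set V) := by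
  classical
  induction s using Finset.strongInduction with
  | _ s ih =>
  by_cases hli : LinearIndepOn ℝ id (s : Set V)
  · exact ⟨s, subset_rfl, hli, hx⟩
  suffices h : ∃ g ∈ s, x ∈ PointedCone.hull ℝ ((s.erase g : Finset V) : Set V) by
    obtain ⟨g, hg, hxg⟩ := h
    obtain ⟨t, ht, h⟩ := ih _ (Finset.erase_ssubset hg) hxg
    exact ⟨t, ht.trans (Finset.erase_subset _ _), h⟩
  obtain ⟨c, hc, rfl⟩ := mem_hull_finset.1 hx
  obtain ⟨d, hd, g₁, hg₁, hdg₁⟩ : ∃ d : V → ℝ, ∑ g ∈ s, d g • g = 0 ∧ ∃ g ∈ s, 0 < d g := by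
    rw [linearIndepOn_finset_iff] at hli
    push Not at hli
    obtain ⟨d, hd, g, hg, hne⟩ := hli
    rcases lt_or_gt_of_ne hne with h | h
    · exact ⟨-d, by simpa using hd, g, hg, by simpa using h⟩
    · exact ⟨d, hd, g, hg, h⟩
  -- subtract the largest multiple of the relation that keeps the coefficients nonnegative
  obtain ⟨g₀, hg₀, hmin⟩ := Finset.exists_min_image (s.filter fun g => 0 < d g)
    (fun g => c g / d g) ⟨g₁, by simp [hg₁, hdg₁]⟩
  rw [Finset.mem_filter] at hg₀
  refine ⟨g₀, hg₀.1, mem_hull_finset.2 ⟨fun g => c g - c g₀ / d g₀ * d g, fun g hg => ?_, ?_⟩⟩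
  · have hgs := Finset.mem_of_mem_erase hg
    rcases le_or_gt (d g) 0 with h | h
    · have := mul_nonneg (div_nonneg (hc g₀ hg₀.1) hg₀.2.le) (neg_nonneg.2 h)
      linarith [hc g hgs]
    · have := hmin g (by simp [hgs, h])
      rw [le_div_iff₀ h] at this
      linarith
  · have h0 : (c g₀ - c g₀ / d g₀ * d g₀) • g₀ = 0 := by
      rw [div_mul_cancel₀ _ hg₀.2.ne', sub_self, zero_smul]
    rw [Finset.sum_erase s (f := fun g => (c g - c g₀ / d g₀ * d g) • g) h0]
    simp only [sub_smul, Finset.sum_sub_distrib, mul_smul, ← Finset.smul_sum, hd, smul_zero,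
      sub_zero]

open Filter Topology

/-- A finitely generated cone is closed along half-lines. -/
theorem mem_of_frequently_mem {σ : PointedCone ℝ V} (hσ : σ.FG) {x v : V}
    (h : ∃ᶠ ε in 𝓝[>] (0 : ℝ), x + ε • v ∈ σ) : x ∈ σ := by
  classical
  obtain ⟨s, rfl⟩ := hσ
  obtain ⟨t, hts, hli, ht⟩ : ∃ t ∈ s.powerset, LinearIndepOn ℝ id (t : Set V) ∧
      ∃ᶠ ε in 𝓝[>] (0 : ℝ), x + ε • v ∈ PointedCone.hull ℝ (t : Set V) := by
    by_contra! hcon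
    have hcon' : ∀ᶠ ε in 𝓝[>] (0 : ℝ), ∀ t ∈ s.powerset, LinearIndepOn ℝ id (t : Set V) →
        x + ε • v ∉ PointedCone.hull ℝ (t : Set V) := by
      rw [Filter.eventually_all_finset]
      intro t ht
      by_cases hli : LinearIndepOn ℝ id (t : Set V)
      · filter_upwards [hcon t ht hli] with ε hε _ using hε
      · exact Eventually.of_forall fun _ h => absurd h hli
    obtain ⟨ε, hε, hε'⟩ := (h.and_eventually hcon').exists
    obtain ⟨t, hts, hli, ht⟩ := exists_linearIndepOn_of_mem_hull hε
    exact hε' t (Finset.mem_powerset.2 hts) hli ht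
  obtain ⟨ε₁, h₁, hε₁⟩ := (ht.and_eventually self_mem_nhdsWithin).exists
  obtain ⟨ε₂, h₂, hε₂⟩ := (ht.and_eventually (Ioo_mem_nhdsGT hε₁)).exists
  have hspan := PointedCone.hull_le_span ℝ (t : Set V)
  have hv : v ∈ Submodule.span ℝ (t : Set V) := by
    have := Submodule.sub_mem _ (hspan h₁) (hspan h₂)
    rw [add_sub_add_left_eq_sub, ← sub_smul] at this
    exact (Submodule.smul_mem_iff _ (sub_ne_zero.2 hε₂.2.ne')).1 this
  have hx : x ∈ Submodule.span ℝ (t : Set V) := by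
    have := Submodule.sub_mem _ (hspan h₁) (Submodule.smul_mem _ ε₁ hv)
    rwa [add_sub_cancel_right] at this
  obtain ⟨a, -, rfl⟩ := Submodule.mem_span_finset.1 hx
  obtain ⟨b, -, rfl⟩ := Submodule.mem_span_finset.1 hv
  refine Submodule.span_mono (Finset.coe_subset.2 (Finset.mem_powerset.1 hts))
    (mem_hull_finset.2 ⟨a, fun g hg => ?_, rfl⟩)
  by_contra! hneg
  have hev : ∀ᶠ ε in 𝓝[>] (0 : ℝ), a g + ε * b g < 0 := by
    refine nhdsWithin_le_nhds ?_
    have : ContinuousAt (fun ε : ℝ => a g + ε * b g) 0 := by fun_prop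
    exact this.eventually_lt_const (by simpa using hneg)
  obtain ⟨ε, hε, hε'⟩ := (ht.and_eventually hev).exists
  obtain ⟨c, hc, hcs⟩ := mem_hull_finset.1 hε
  rw [linearIndepOn_finset_iff] at hli
  have := hli (fun g => c g - (a g + ε * b g)) ?_ g hg
  · linarith [hc g hg]
  · simp only [id, sub_smul, Finset.sum_sub_distrib, hcs, add_smul, Finset.sum_add_distrib,
      mul_smul, Finset.smul_sum, sub_self]

/-- The point `x` is in the relative interior of the cone `τ`. -/
def IsCore (τ : PointedCone ℝ V) (x : V) : Prop :=
  x ∈ τ ∧ ∀ y ∈ τ, ∃ ε : ℝ, 0 < ε ∧ x - ε • y ∈ τ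

theorem smul_mem_cone {τ : PointedCone ℝ V} {a : ℝ} (ha : 0 ≤ a) {x : V} (hx : x ∈ τ) :
    a • x ∈ τ := Submodule.smul_mem τ ⟨a, ha⟩ hx

theorem IsCore.add {τ : PointedCone ℝ V} {x y : V} (hx : IsCore τ x) (hy : y ∈ τ) :
    IsCore τ (x + y) := by
  refine ⟨add_mem hx.1 hy, fun z hz => ?_⟩
  obtain ⟨ε, hε, h⟩ := hx.2 z hz
  refine ⟨ε, hε, ?_⟩
  rw [add_sub_right_comm]
  exact add_mem h hy

theorem exists_isCore {τ : PointedCone ℝ V} (hτ : τ.FG) : ∃ x, IsCore τ x := by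
  obtain ⟨s, rfl⟩ := hτ
  refine ⟨∑ g ∈ s, g, Submodule.sum_mem _ fun g hg => Submodule.subset_span hg, fun y hy => ?_⟩
  obtain ⟨c, hc, rfl⟩ := mem_hull_finset.1 hy
  have hpos : 0 < 1 + ∑ g ∈ s, c g := by linarith [Finset.sum_nonneg hc]
  refine ⟨(1 + ∑ g ∈ s, c g)⁻¹, inv_pos.2 hpos,
    mem_hull_finset.2 ⟨fun g => 1 - (1 + ∑ g ∈ s, c g)⁻¹ * c g, fun g hg => ?_, ?_⟩⟩
  · rw [sub_nonneg, inv_mul_le_iff₀ hpos, mul_one]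
    linarith [Finset.single_le_sum hc hg]
  · simp only [sub_smul, one_smul, mul_smul, Finset.sum_sub_distrib, Finset.smul_sum]

variable {𝓖 : Set (PointedCone ℝ V)} {X : Set V}

theorem IsFanStructure.mem (h : IsFanStructure 𝓖 X) {τ : PointedCone ℝ V} (hτ : τ ∈ 𝓖) {x : V}
    (hx : x ∈ τ) : x ∈ X := h.support ▸ mem_biUnion hτ hx

/-- Near a point in the relative interior of a maximal cone, the support of a fan is contained in
that cone. -/
theorem IsFanStructure.exists_add_smul_mem (h : IsFanStructure 𝓖 X) {τ : PointedCone ℝ V}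
    (hτ : Maximal (· ∈ 𝓖) τ) {x : V} (hx : IsCore τ x) {v : V}
    (hv : ∀ᶠ ε in 𝓝[>] (0 : ℝ), x + ε • v ∈ X) : ∃ ε : ℝ, 0 < ε ∧ x + ε • v ∈ τ := by
  obtain ⟨σ, hσ, hfr⟩ : ∃ σ ∈ 𝓖, ∃ᶠ ε in 𝓝[>] (0 : ℝ), x + ε • v ∈ σ := by
    by_contra! hcon
    have hcon' : ∀ᶠ ε in 𝓝[>] (0 : ℝ), ∀ σ ∈ 𝓖, x + ε • v ∉ σ := by
      rw [Filter.eventually_all_finite h.finite]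
      exact hcon
    obtain ⟨ε, hε, hε'⟩ := (hv.and hcon').exists
    rw [← h.support, mem_iUnion₂] at hε
    obtain ⟨σ, hσ, hσ'⟩ := hε
    exact hε' σ hσ hσ'
  have hxσ := mem_of_frequently_mem (h.polyhedral σ hσ) hfr
  have hle : τ ≤ σ := fun y hy => by
    obtain ⟨ε, hε, hy'⟩ := hx.2 y hy
    refine ((h.inter_face τ hτ.prop σ hσ).mem_of_smul_add_mem hy hy' hε ?_).2
    rw [add_sub_cancel]
    exact ⟨hx.1, hxσ⟩
  obtain ⟨ε, hε, hε'⟩ := (hfr.and_eventually self_mem_nhdsWithin).exists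
  exact ⟨ε, hε', hτ.2 hσ hle hε⟩

theorem IsCoarsestFanStructure.subset {𝓕 : Set (PointedCone ℝ V)}
    (h : IsCoarsestFanStructure 𝓖 X) (h' : IsCoarsestFanStructure 𝓕 X) : 𝓖 ⊆ 𝓕 := by
  intro τ hτ
  obtain ⟨ρ, hτρ, hρ⟩ := h.isFan.finite.exists_le_maximal hτ
  obtain ⟨σ, hσ, hρσ⟩ := h'.coarsest 𝓖 h.isFan ρ hρ.prop
  obtain ⟨ρ', hρ', hσρ⟩ := h.coarsest 𝓕 h'.isFan σ hσ
  have : ρ = σ := le_antisymm hρσ (hσρ.trans (hρ.2 hρ' (hρσ.trans hσρ)))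
  subst this
  have hf := h.isFan.inter_face ρ hρ.prop τ hτ
  rw [inf_eq_right.2 hτρ] at hf
  exact h'.isFan.face_mem ρ hσ τ hf

theorem IsCoarsestFanStructure.eq {𝓕 : Set (PointedCone ℝ V)}
    (h : IsCoarsestFanStructure 𝓖 X) (h' : IsCoarsestFanStructure 𝓕 X) : 𝓖 = 𝓕 :=
  subset_antisymm (h.subset h') (h'.subset h)

end Fans

/-! ### The nested set fan is the coarsest fan structure -/

section Coarsest

open Filter Topology

variable {ι : Type} [Fintype ι] {M : Matroid ι}

/-- Along the ray from `x` in a direction `u` strict inequalities between coordinates persist. -/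
theorem eventually_lt_of_lt (w u : ι → ℝ) :
    ∀ᶠ ε in 𝓝[>] (0 : ℝ), ∀ k l, w k < w l → w k + ε * u k < w l + ε * u l := by
  rw [eventually_all]
  intro k
  rw [eventually_all]
  intro l
  by_cases h : w k < w l
  · refine nhdsWithin_le_nhds ?_
    have h₁ : ContinuousAt (fun ε : ℝ => w k + ε * u k) 0 := by fun_prop
    have h₂ : ContinuousAt (fun ε : ℝ => w l + ε * u l) 0 := by fun_prop
    filter_upwards [h₁.eventually_lt h₂ (by simpa using h)] with ε hε _ using hε
  · exact Eventually.of_forall fun _ h' => absurd h' h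

/-- Raising `w` on a flat of the part of a component where `w` is minimal stays in the tropical
linear space. -/
theorem eventually_isTropical_add {w : ι → ℝ} (hw : IsTropical M w)
    (i : ι) {P Q : Set ι} (hP : M.IsFlat P)
    (hH : ∀ k ∈ component M w i, w i < w k → k ∈ P)
    (hQ : ∀ k, k ∈ Q ↔ k ∈ component M w i ∧ w k = w i ∧ k ∈ P) :
    ∀ᶠ ε in 𝓝[>] (0 : ℝ), IsTropical M (w + ε • Q.indicator 1) := by
  filter_upwards [eventually_lt_of_lt w (Q.indicator 1),
    self_mem_nhdsWithin] with ε hlt hε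
  refine isTropical_of_forall fun C hC a ha => ?_
  by_contra! hcon
  have hmin : ∀ b ∈ C, w a ≤ w b := fun b hb => by
    by_contra! h
    exact absurd (hcon b hb fun hba => by simp [hba] at h) (not_lt.2 (hlt b a h).le)
  have htie : ∀ b ∈ C, b ≠ a → w b = w a → a ∉ Q ∧ b ∈ Q := fun b hb hba hab => by
    have := hcon b hb hba
    have hε' : 0 < ε := hε
    by_cases haQ : a ∈ Q <;> by_cases hbQ : b ∈ Q <;> simp [haQ, hbQ, hab] at this ⊢
    linarith
  obtain ⟨b, hb, hba, hbmin⟩ := hw.exists_le hC a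
  have hab : w b = w a := le_antisymm (hbmin a ha) (hmin b hb)
  obtain ⟨haQ, hbQ⟩ := htie b hb hba hab
  obtain ⟨hbc, hbi, -⟩ := (hQ b).1 hbQ
  have hai : w a = w i := hab ▸ hbi
  have hCF : ∀ c ∈ C, c ∈ component M w i := fun c hc =>
    component_subset hbc (.of_isCircuit hC (fun k hk => hbmin k hk) hb hc)
  refine haQ ((hQ a).2 ⟨hCF a ha, hai, mem_of_isCircuit_of_isFlat hP hC ha ?_⟩)
  rintro c ⟨hc, hca⟩
  rcases (hmin c hc).eq_or_lt with h | h
  · exact ((hQ c).1 (htie c hc hca h.symm).2).2.2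
  · exact hH c (hCF c hc) (hai ▸ h)

variable [Nontrivial ι] {𝓖 : Set (PointedCone ℝ (TropTorus ι))}

/-- At a point in the relative interior of a maximal cone of a fan structure, the quotient of
every component by the elements with larger coordinates has rank one: otherwise the tropical
linear space contains a line segment around the point in the direction of a proper flat of this
quotient, which makes the component a union of two proper flats. -/
theorem mem_closure_of_component_eq (hM : IsConnectedFlat M univ)
    (hstar : ∀ F P G, IsConnectedFlat M F → M.IsFlat P → M.IsFlat G → F = P ∪ G → P = F ∨ G = F)
    (h𝓖 : IsFanStructure 𝓖 (tropicalLinearSpace M)) {τ : PointedCone ℝ (TropTorus ι)}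
    (hτ : Maximal (· ∈ 𝓖) τ) {w : ι → ℝ} (hx : IsCore τ (TropTorus.mk w)) {i j : ι}
    (hij : component M w i = component M w j) :
    j ∈ M.closure (insert i {k | k ∈ component M w i ∧ w i < w k}) := by
  classical
  have hw : IsTropical M w := mk_mem_tropicalLinearSpace.1 (h𝓖.mem hτ.prop hx.1)
  set F := component M w i with hF
  have hFc : IsConnectedFlat M F := isConnectedFlat_component hM hw i
  set P := M.closure (insert i {k | k ∈ F ∧ w i < w k}) with hP
  have hPf : M.IsFlat P := M.isFlat_closure _
  have hcl : insert i {k | k ∈ F ∧ w i < w k} ⊆ P := M.subset_closure _ (subset_ground hM _)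
  have hPF : P ⊆ F := by
    have := M.closure_subset_closure
      (insert_subset (mem_component w i) fun k hk => hk.1 :
        insert i {k | k ∈ F ∧ w i < w k} ⊆ F)
    rwa [hFc.1.closure] at this
  by_contra hj
  let Q : Set ι := {k | k ∈ F ∧ w k = w i ∧ k ∈ P}
  let v : ι → ℝ := Q.indicator 1
  have hev : ∀ᶠ ε in 𝓝[>] (0 : ℝ),
      TropTorus.mk w + ε • TropTorus.mk v ∈ tropicalLinearSpace M := by
    filter_upwards [eventually_isTropical_add hw i hPf
      (fun k hk h => hcl (Or.inr ⟨hk, h⟩)) (Q := Q) (fun k => Iff.rfl)] with ε hε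
    rw [← mk_smul, ← mk_add, mk_mem_tropicalLinearSpace]
    exact hε
  obtain ⟨ε, hε, hmem⟩ := h𝓖.exists_add_smul_mem hτ hx hev
  obtain ⟨δ, hδ, hmem'⟩ := hx.2 _ hmem
  have hneg : IsTropical M (w + (-(δ * ε)) • v) := by
    rw [← mk_mem_tropicalLinearSpace, mk_add, mk_smul]
    refine h𝓖.mem hτ.prop ?_
    convert add_mem hmem' (smul_mem_cone hδ.le hx.1) using 1
    module
  have hpos : 0 < δ * ε := mul_pos hδ hε
  have hiQ : i ∈ Q := ⟨mem_component w i, rfl, hcl (Or.inl rfl)⟩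
  have hflat : M.IsFlat (F \ Q) := by
    refine isFlat_of_forall_isCircuit (subset_ground hM _) fun C hC e he h => ?_
    have heF : e ∈ F := mem_of_isCircuit_of_isFlat hFc.1 hC he (h.trans sdiff_subset)
    refine ⟨heF, fun heQ => ?_⟩
    obtain ⟨a, ha, hae, hmin⟩ := hneg.exists_le hC e
    have h₁ := hmin e he
    have haF := h ⟨ha, hae⟩
    have h₂ : w i ≤ w a := le_of_mem_component haF.1
    simp only [Pi.add_apply, Pi.smul_apply, smul_eq_mul, v,
      indicator_of_mem heQ, indicator_of_notMem haF.2, heQ.2.1, Pi.one_apply] at h₁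
    linarith
  have hcover : F = P ∪ (F \ Q) := by
    refine subset_antisymm (fun k hk => ?_) (union_subset hPF sdiff_subset)
    by_cases hkQ : k ∈ Q
    · exact Or.inl hkQ.2.2
    · exact Or.inr ⟨hk, hkQ⟩
  rcases hstar F P _ hFc hPf hflat hcover with h | h
  · exact hj (h ▸ hij ▸ mem_component w j)
  · have hi : i ∈ F \ Q := by
      rw [h]
      exact mem_component w i
    exact hi.2 hiQ

/-- The points of a maximal cone are constant on the blocks of a point in its relative
interior. -/
theorem eq_of_component_eq (hM : IsConnectedFlat M univ)
    (hstar : ∀ F P G, IsConnectedFlat M F → M.IsFlat P → M.IsFlat G → F = P ∪ G → P = F ∨ G = F)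
    (h𝓖 : IsFanStructure 𝓖 (tropicalLinearSpace M)) {τ : PointedCone ℝ (TropTorus ι)}
    (hτ : Maximal (· ∈ 𝓖) τ) {w u : ι → ℝ} (hx : IsCore τ (TropTorus.mk w))
    (hu : TropTorus.mk u ∈ τ) {i j : ι} (hij : component M w i = component M w j) :
    u i = u j := by
  have key : ∀ i j, component M w i = component M w j → ¬ u i < u j := by
    intro i j hij hlt
    have hwij : w i = w j := le_antisymm
      (le_of_mem_component (hij ▸ mem_component w j))
      (le_of_mem_component (hij ▸ mem_component w i))
    have hcl := mem_closure_of_component_eq hM hstar h𝓖 hτ hx hij.symm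
    obtain ⟨C, hCs, hC, hiC⟩ := Matroid.exists_isCircuit_of_mem_closure hcl (by
      rintro (rfl | ⟨-, h⟩)
      · exact lt_irrefl _ hlt
      · exact h.ne hwij.symm)
    obtain ⟨ε, hε, hε'⟩ := ((eventually_lt_of_lt w u).and self_mem_nhdsWithin).exists
    have hε₀ : 0 < ε := hε'
    have htrop : IsTropical M (w + ε • u) := by
      rw [← mk_mem_tropicalLinearSpace, mk_add, mk_smul]
      exact h𝓖.mem hτ.prop (add_mem hx.1 (smul_mem_cone hε₀.le hu))
    obtain ⟨a, ha, hai, hmin⟩ := htrop.exists_le hC i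
    have h₁ := hmin i hiC
    simp only [Pi.add_apply, Pi.smul_apply, smul_eq_mul] at h₁
    rcases (hCs ha).resolve_left hai with rfl | ⟨-, h⟩
    · have := mul_lt_mul_of_pos_left hlt hε₀
      linarith
    · exact not_lt.2 h₁ (hε i a (hwij ▸ h))
  exact le_antisymm (not_lt.1 (key j i hij.symm)) (not_lt.1 (key i j hij))

/-- A function that is constant on the blocks of `w` is a combination of the `e_F` for the nested
set of `w`. -/
theorem exists_combination_of_component (hM : IsConnectedFlat M univ) {w u : ι → ℝ}
    (hw : IsTropical M w) (h : ∀ i j, component M w i = component M w j → u i = u j) :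
    ∃ c : Set ι → ℝ, ∃ r : ℝ, ∀ i, u i = combination (nestedSupport M w) c i + r := by
  have key := combination_jump hM (nestedSupport_mem hM hw) (Function.extend (component M w) u 0)
  refine ⟨_, _, fun i => Eq.trans ?_ (key i)⟩
  rw [minMember_nestedSupport]
  exact (Function.FactorsThrough.extend_apply (fun i j => h i j) _ i).symm

/-- A maximal cone of any fan structure is contained in the cone over the nested set of a point in
its relative interior. -/
theorem le_incidenceCone_of_isCore (hM : IsConnectedFlat M univ)
    (hstar : ∀ F P G, IsConnectedFlat M F → M.IsFlat P → M.IsFlat G → F = P ∪ G → P = F ∨ G = F)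
    (h𝓖 : IsFanStructure 𝓖 (tropicalLinearSpace M)) {τ : PointedCone ℝ (TropTorus ι)}
    (hτ : Maximal (· ∈ 𝓖) τ) {w : ι → ℝ} (hx : IsCore τ (TropTorus.mk w)) :
    τ ≤ incidenceCone (nestedSupport M w) := by
  classical
  intro y hy
  obtain ⟨u, rfl⟩ := mk_surjective y
  have hw : IsTropical M w := mk_mem_tropicalLinearSpace.1 (h𝓖.mem hτ.prop hx.1)
  have hS := nestedSupport_mem hM hw
  obtain ⟨c, r, hc, hwc⟩ := exists_combination_of_isTropical hM hw
  obtain ⟨d, r', hud⟩ := exists_combination_of_component hM hw (u := u)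
    fun i j hij => eq_of_component_eq hM hstar h𝓖 hτ hx hy hij
  rw [mk_eq_mk_iff.2 ⟨r', hud⟩]
  refine mk_combination_mem fun F hF => ?_
  by_contra! hneg
  -- move from `w` towards `u` until the first coefficient vanishes
  obtain ⟨F₀, hF₀, hmin⟩ := Finset.exists_min_image
    (Finset.univ.filter fun F => F ∈ nestedSupport M w ∧ d F < 0) (fun F => c F / (-d F))
    ⟨F, by simp [hF, hneg]⟩
  simp only [Finset.mem_filter, Finset.mem_univ, true_and] at hF₀ hmin
  set S := nestedSupport M w with hSdef
  set s := c F₀ / (-d F₀) with hs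
  have hs0 : 0 ≤ s := div_nonneg (hc _ hF₀.1).le (neg_nonneg.2 hF₀.2.le)
  have hcd : ∀ F ∈ S, 0 ≤ (c + s • d) F := fun F hF => by
    simp only [Pi.add_apply, Pi.smul_apply, smul_eq_mul]
    rcases le_or_gt 0 (d F) with h | h
    · exact add_nonneg (hc F hF).le (mul_nonneg hs0 h)
    · have := hmin F ⟨hF, h⟩
      rw [le_div_iff₀ (neg_pos.2 h)] at this
      linarith
  have hzero : (c + s • d) F₀ = 0 := by
    simp only [Pi.add_apply, Pi.smul_apply, smul_eq_mul]
    have : s * (-d F₀) = c F₀ := div_mul_cancel₀ _ (neg_pos.2 hF₀.2).ne'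
    linarith
  have hz : IsCore τ (TropTorus.mk (w + s • u)) := by
    rw [mk_add, mk_smul]
    exact hx.add (smul_mem_cone hs0 hy)
  have hzt : IsTropical M (w + s • u) := mk_mem_tropicalLinearSpace.1 (h𝓖.mem hτ.prop hz.1)
  set T : Set (Set ι) := {F | F ∈ S ∧ 0 < (c + s • d) F} with hT
  have hTS : T ⊆ S := fun F hF => hF.1
  have hsupp : nestedSupport M (w + s • u) = T := by
    have : ∀ i, (w + s • u) i = combination T (c + s • d) i + (r + s * r') := fun i => by
      rw [combination_subset hTS fun F hF hF' =>
        le_antisymm (not_lt.1 fun h => hF' ⟨hF, h⟩) (hcd F hF), combination_add,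
        combination_smul]
      simp only [Pi.add_apply, Pi.smul_apply, smul_eq_mul, hwc i, hud i]
      ring
    rw [nestedSupport_congr this,
      nestedSupport_combination hM (nestedSetComplex_mono hS hTS) fun F hF => hF.2]
  obtain ⟨b, r'', hb⟩ := exists_combination_of_component hM hzt (u := w)
    fun i j hij => eq_of_component_eq hM hstar h𝓖 hτ hz hx.1 hij
  rw [hsupp] at hb
  have hbT : combination T b = combination S (fun F => if F ∈ T then b F else 0) := by
    rw [← combination_subset hTS fun F _ hF => by simp [hF]]
    exact combination_congr fun F hF => by simp [hF]
  have := eq_of_combination_eq hM hS (c := c) (c' := fun F => if F ∈ T then b F else 0)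
    (r := r'' - r) (fun i => by rw [← hbT]; linarith [hwc i, hb i]) hF₀.1
  have hF₀T : F₀ ∉ T := fun h => h.2.ne' hzero
  simp only [hF₀T, if_false] at this
  exact (hc F₀ hF₀.1).ne' this

/-- If no connected flat is a union of two proper flats, then the fan over the nested set complex
is the coarsest fan structure on the tropical linear space. -/
theorem isBergmanFan_nestedFan (hM : IsConnectedFlat M univ)
    (hstar : ∀ F P G, IsConnectedFlat M F → M.IsFlat P → M.IsFlat G →
      F = P ∪ G → P = F ∨ G = F) :
    IsBergmanFan M (incidenceCone '' nestedSetComplex M) where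
  isFan := isFanStructure_nestedFan hM
  coarsest := by
    intro 𝓖 h𝓖 τ hτ
    obtain ⟨ρ, hτρ, hρ⟩ := h𝓖.finite.exists_le_maximal hτ
    obtain ⟨x, hx⟩ := exists_isCore (h𝓖.polyhedral ρ hρ.prop)
    obtain ⟨w, rfl⟩ := mk_surjective x
    have hw : IsTropical M w := mk_mem_tropicalLinearSpace.1 (h𝓖.mem hρ.prop hx.1)
    exact ⟨_, ⟨_, nestedSupport_mem hM hw, rfl⟩,
      hτρ.trans (le_incidenceCone_of_isCore hM hstar h𝓖 hρ hx)⟩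

end Coarsest

/-! ### Linear matroids -/

section LinearMatroid

variable {ι : Type} [Finite ι] {K V : Type*} [Field K] [AddCommGroup V] [Module K V] {a : ι → V}

theorem linearMatroid_ground : (linearMatroid (K := K) a).E = univ := rfl

theorem linearMatroid_indep {I : Set ι} :
    (linearMatroid (K := K) a).Indep I ↔ LinearIndepOn K a I := by
  unfold linearMatroid
  rw [IndepMatroid.matroid_Indep]
  rfl

theorem mem_closure_linearMatroid_iff {X : Set ι} {e : ι} :
    e ∈ (linearMatroid (K := K) a).closure X ↔ a e ∈ Submodule.span K (a '' X) := by
  obtain ⟨I, hI⟩ := (linearMatroid (K := K) a).exists_isBasis X (subset_univ X)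
  have hIi := linearMatroid_indep.1 hI.indep
  have key : ∀ f, f ∈ (linearMatroid (K := K) a).closure I ↔
      a f ∈ Submodule.span K (a '' I) := by
    intro f
    by_cases hf : f ∈ I
    · exact ⟨fun _ => Submodule.subset_span ⟨f, hf, rfl⟩,
        fun _ => (linearMatroid (K := K) a).subset_closure I (subset_univ I) hf⟩
    · rw [hI.indep.mem_closure_iff_of_notMem hf, Matroid.dep_iff, linearMatroid_indep,
        linearIndepOn_insert hf]
      simp [hIi, linearMatroid_ground]
  rw [← hI.closure_eq_closure, key]
  have : Submodule.span K (a '' X) = Submodule.span K (a '' I) := by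
    refine le_antisymm (Submodule.span_le.2 ?_) (Submodule.span_mono (image_mono hI.subset))
    rintro _ ⟨x, hx, rfl⟩
    exact (key x).1 (hI.subset_closure hx)
  rw [this]

theorem mem_of_mem_span {F X : Set ι} (hF : (linearMatroid (K := K) a).IsFlat F) (hX : X ⊆ F)
    {e : ι} (he : a e ∈ Submodule.span K (a '' X)) : e ∈ F := by
  rw [← hF.closure]
  exact mem_closure_linearMatroid_iff.2 (Submodule.span_mono (image_mono hX) he)

end LinearMatroid

/-! ### The arrangement `G₃₂` -/

section Eisenstein

/-- The product of the Eisenstein integers `x.1 + x.2 ω` and `y.1 + y.2 ω`. -/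
def eisMul (x y : ℤ × ℤ) : ℤ × ℤ := (x.1 * y.1 - x.2 * y.2, x.1 * y.2 + x.2 * y.1 - x.2 * y.2)

/-- Complex conjugation of Eisenstein integers. -/
def eisConj (x : ℤ × ℤ) : ℤ × ℤ := (x.1 - x.2, -x.2)

/-- The powers of `ω`. -/
def eisPow : Fin 3 → ℤ × ℤ := ![(1, 0), (0, 1), (-1, -1)]

/-- The coefficients of the forms of the arrangement as Eisenstein integers. -/
def eisRoot : G32Index → Fin 4 → ℤ × ℤ
  | .inl i => fun j => if j = i then (1, 2) else (0, 0)
  | .inr (0, k, l) => ![(0, 0), (1, 0), eisPow k, eisPow l]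
  | .inr (1, k, l) => ![eisPow l, (0, 0), (1, 0), -eisPow k]
  | .inr (2, k, l) => ![eisPow k, -eisPow l, (0, 0), (1, 0)]
  | .inr (3, k, l) => ![(1, 0), eisPow k, -eisPow l, (0, 0)]

/-- The Hermitian product of two roots. -/
def eisGram (i j : G32Index) : ℤ × ℤ :=
  eisMul (eisRoot i 0) (eisConj (eisRoot j 0)) + eisMul (eisRoot i 1) (eisConj (eisRoot j 1)) +
  eisMul (eisRoot i 2) (eisConj (eisRoot j 2)) + eisMul (eisRoot i 3) (eisConj (eisRoot j 3))

/-- The exponent of a power of `ω` up to sign. -/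
def eisLog (x : ℤ × ℤ) : Fin 3 := if x.2 = 0 then 0 else if x.1 = 0 then 1 else 2

/-- For a unit multiple `w` of a root, the index of the root and the unit. -/
def eisIndex (w : Fin 4 → ℤ × ℤ) : G32Index × (ℤ × ℤ) :=
  if w 0 = 0 then
    if w 1 = 0 then (if w 2 = 0 then (.inl 3, divTheta (w 3)) else (.inl 2, divTheta (w 2)))
    else if w 2 = 0 then (.inl 1, divTheta (w 1))
    else (.inr (0, eisLog (eisMul (w 2) (eisConj (w 1))), eisLog (eisMul (w 3) (eisConj (w 1)))),
      w 1)
  else if w 1 = 0 then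
    if w 2 = 0 then (.inl 0, divTheta (w 0))
    else (.inr (1, eisLog (eisMul (w 3) (eisConj (w 2))), eisLog (eisMul (w 0) (eisConj (w 2)))),
      w 2)
  else if w 2 = 0 then
    (.inr (2, eisLog (eisMul (w 0) (eisConj (w 3))), eisLog (eisMul (w 1) (eisConj (w 3)))), w 3)
  else (.inr (3, eisLog (eisMul (w 1) (eisConj (w 0))), eisLog (eisMul (w 2) (eisConj (w 0)))),
    w 0)
where
  /-- Division by `ω - ω²`. -/
  divTheta (x : ℤ × ℤ) : ℤ × ℤ := ((2 * x.2 - x.1) / 3, (x.2 - 2 * x.1) / 3)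

/-- The units `±ωⁿ` of the Eisenstein integers. -/
def eisUnits : List (ℤ × ℤ) := [(1, 0), (0, 1), (-1, -1), (-1, 0), (0, -1), (1, 1)]

/-- If `w` is a unit multiple of a root. -/
def eisIsRoot (w : Fin 4 → ℤ × ℤ) : Bool :=
  eisUnits.contains (eisIndex w).2 &&
  decide (∀ x, w x = eisMul (eisIndex w).2 (eisRoot (eisIndex w).1 x))

theorem eisGram_self : ∀ i, eisGram i i = (3, 0) := by decide +kernel

theorem eisGram_mul : ∀ i j, i ≠ j →
    eisMul (eisGram i j) (eisGram j i) = (0, 0) ∨ eisMul (eisGram i j) (eisGram j i) = (3, 0) := by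
  decide +kernel

/-- Roots that are not orthogonal span a line with a third root. -/
theorem exists_eisIsRoot : ∀ i j, i ≠ j → eisGram i j ≠ (0, 0) → ∃ s ∈ eisUnits,
    eisIsRoot fun x => eisRoot i x + eisMul s (eisRoot j x) := by
  decide +kernel

end Eisenstein

section G32

variable {K : Type*} [Field K] {ω : K}

/-- The value of an Eisenstein integer in a field with a third root of unity. -/
def eisVal (ω : K) (x : ℤ × ℤ) : K := x.1 + x.2 * ω

theorem eisVal_add (x y : ℤ × ℤ) : eisVal ω (x + y) = eisVal ω x + eisVal ω y := by
  simp only [eisVal, Prod.fst_add, Prod.snd_add, Int.cast_add]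
  ring

theorem eisVal_mul (hω : ω ^ 2 + ω + 1 = 0) (x y : ℤ × ℤ) :
    eisVal ω (eisMul x y) = eisVal ω x * eisVal ω y := by
  simp only [eisVal, eisMul, Int.cast_add, Int.cast_sub, Int.cast_mul]
  linear_combination (-(x.2 : K) * y.2) * hω

theorem eisVal_eisRoot (hω : ω ^ 2 + ω + 1 = 0) (i : G32Index) (x : Fin 4) :
    eisVal ω (eisRoot i x) = g32Form ω i x := by
  have hω' : ω ^ 2 = -1 - ω := by linear_combination hω
  have hp : ∀ k : Fin 3, eisVal ω (eisPow k) = ω ^ (k : ℕ) := by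
    intro k
    fin_cases k
    · simp [eisVal, eisPow]
    · simp [eisVal, eisPow]
    · simp only [eisVal, eisPow]
      simp [hω']
      ring
  have hn : ∀ y, eisVal ω (-y) = -eisVal ω y := fun y => by
    simp only [eisVal, Prod.fst_neg, Prod.snd_neg, Int.cast_neg]
    ring
  have h0 : eisVal ω (0, 0) = 0 := by simp [eisVal]
  have h1 : eisVal ω (1, 0) = 1 := by simp [eisVal]
  match i with
  | .inl i =>
    by_cases h : x = i
    · subst h
      simp only [eisRoot, g32Form, if_true, Pi.single_eq_same, eisVal]
      push_cast
      linear_combination hω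
    · simp [eisRoot, g32Form, h, h0]
  | .inr (0, k, l) => fin_cases x <;> simp [eisRoot, g32Form, h0, h1, hp]
  | .inr (1, k, l) => fin_cases x <;> simp [eisRoot, g32Form, h0, h1, hp, hn]
  | .inr (2, k, l) => fin_cases x <;> simp [eisRoot, g32Form, h0, h1, hp, hn]
  | .inr (3, k, l) => fin_cases x <;> simp [eisRoot, g32Form, h0, h1, hp, hn]

theorem eisVal_ne_zero_of_unit (hω : ω ^ 2 + ω + 1 = 0) {s : ℤ × ℤ} (hs : s ∈ eisUnits) :
    eisVal ω s ≠ 0 := by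
  have : ∃ t, eisMul s t = (1, 0) := by
    simp only [eisUnits, List.mem_cons, List.not_mem_nil, or_false] at hs
    rcases hs with rfl | rfl | rfl | rfl | rfl | rfl
    exacts [⟨(1, 0), rfl⟩, ⟨(-1, -1), rfl⟩, ⟨(0, 1), rfl⟩, ⟨(-1, 0), rfl⟩, ⟨(1, 1), rfl⟩,
      ⟨(0, -1), rfl⟩]
  obtain ⟨t, ht⟩ := this
  intro h
  have := eisVal_mul hω s t
  rw [ht, h, zero_mul] at this
  simp [eisVal] at this

/-- The pairing of a vector with the complex conjugate of a root. -/
def rootPairing (ω : K) (j : G32Index) : (Fin 4 → K) →ₗ[K] K :=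
  ∑ x, eisVal ω (eisConj (eisRoot j x)) • LinearMap.proj x

theorem rootPairing_apply (hω : ω ^ 2 + ω + 1 = 0) (i j : G32Index) :
    rootPairing ω j (g32Form ω i) = eisVal ω (eisGram i j) := by
  rw [rootPairing, LinearMap.sum_apply]
  simp only [LinearMap.smul_apply, LinearMap.proj_apply,
    smul_eq_mul, Fin.sum_univ_four, eisGram, eisVal_add, eisVal_mul hω, eisVal_eisRoot hω]
  ring

theorem rootPairing_self (hω : ω ^ 2 + ω + 1 = 0) (i : G32Index) :
    rootPairing ω i (g32Form ω i) = 3 := by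
  rw [rootPairing_apply hω, eisGram_self]
  simp [eisVal]

/-- Two different roots have an invertible Gram matrix, with determinant `9` or `6`. -/
theorem gram_det_ne_zero (h2 : (2 : K) ≠ 0) (h3 : (3 : K) ≠ 0) (hω : ω ^ 2 + ω + 1 = 0)
    {i j : G32Index} (hij : i ≠ j) :
    9 - rootPairing ω j (g32Form ω i) * rootPairing ω i (g32Form ω j) ≠ 0 := by
  rw [rootPairing_apply hω, rootPairing_apply hω, ← eisVal_mul hω]
  rcases eisGram_mul i j hij with h | h <;> rw [h] <;> simp only [eisVal] <;> push_cast
  · have : (9 : K) - (0 + 0 * ω) = 3 * 3 := by ring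
    rw [this]
    exact mul_ne_zero h3 h3
  · have : (9 : K) - (3 + 0 * ω) = 2 * 3 := by ring
    rw [this]
    exact mul_ne_zero h2 h3

/-- Roots that are not orthogonal span a line with a third root. -/
theorem exists_third_root (hω : ω ^ 2 + ω + 1 = 0) {i j : G32Index} (hij : i ≠ j)
    (h : rootPairing ω j (g32Form ω i) ≠ 0) : ∃ k, ∃ s t : K, s ≠ 0 ∧ t ≠ 0 ∧
      t • g32Form ω k = g32Form ω i + s • g32Form ω j := by
  have hg : eisGram i j ≠ (0, 0) := fun h0 => h (by
    rw [rootPairing_apply hω, h0]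
    simp [eisVal])
  obtain ⟨s, hs, hw⟩ := exists_eisIsRoot i j hij hg
  simp only [eisIsRoot, Bool.and_eq_true, List.contains_iff_mem, decide_eq_true_eq] at hw
  generalize eisIndex (fun x => eisRoot i x + eisMul s (eisRoot j x)) = e at hw
  refine ⟨e.1, eisVal ω s, eisVal ω e.2, eisVal_ne_zero_of_unit hω hs,
    eisVal_ne_zero_of_unit hω hw.1, funext fun x => ?_⟩
  have := congrArg (eisVal ω) (hw.2 x)
  rw [eisVal_add, eisVal_mul hω, eisVal_mul hω, eisVal_eisRoot hω, eisVal_eisRoot hω,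
    eisVal_eisRoot hω] at this
  simpa using this.symm

/-- A product of two ternary linear forms that vanishes at the points `(1, ωᵏ, ωˡ)` has no mixed
terms, if it has no pure squares. -/
theorem mixed_eq_zero (hω : ω ^ 2 + ω + 1 = 0) (h3 : (3 : K) ≠ 0) {x y z x' y' z' : K}
    (hx : x * x' = 0) (hy : y * y' = 0) (hz : z * z' = 0)
    (h : ∀ k l : Fin 3, (x + ω ^ (k : ℕ) * y + ω ^ (l : ℕ) * z) *
      (x' + ω ^ (k : ℕ) * y' + ω ^ (l : ℕ) * z') = 0) :
    x * y' + y * x' = 0 ∧ x * z' + z * x' = 0 ∧ y * z' + z * y' = 0 := by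
  have h1 : 1 - ω ≠ 0 := fun h => h3 (by
    have : ω = 1 := by linear_combination -h
    rw [this] at hω
    linear_combination hω)
  have e₀ := h 0 0
  have e₁ := h 1 0
  have e₂ := h 0 1
  simp only [Fin.val_zero, Fin.val_one, pow_zero, pow_one, one_mul] at e₀ e₁ e₂
  have hB : x * z' + z * x' = 0 := by
    refine (mul_eq_zero.1 (?_ : (1 - ω) * _ = 0)).resolve_left h1
    linear_combination e₁ - ω * e₀ - (1 - ω) * hx - (ω ^ 2 - ω) * hy - (1 - ω) * hz
  have hA : x * y' + y * x' = 0 := by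
    refine (mul_eq_zero.1 (?_ : (1 - ω) * _ = 0)).resolve_left h1
    linear_combination e₂ - ω * e₀ - (1 - ω) * hx - (1 - ω) * hy - (ω ^ 2 - ω) * hz
  refine ⟨hA, hB, ?_⟩
  linear_combination e₀ - hA - hB - hx - hy - hz

/-- The forty points of the arrangement lie on no pair of planes. -/
theorem eq_zero_or_eq_zero_of_forall_mul (h3 : (3 : K) ≠ 0) (hω : ω ^ 2 + ω + 1 = 0)
    {p q : (Fin 4 → K) →ₗ[K] K} (h : ∀ i, p (g32Form ω i) * q (g32Form ω i) = 0) :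
    p = 0 ∨ q = 0 := by
  have happly : ∀ f : (Fin 4 → K) →ₗ[K] K, ∃ P : Fin 4 → K, ∀ v,
      f v = v 0 * P 0 + v 1 * P 1 + v 2 * P 2 + v 3 * P 3 := fun f => by
    refine ⟨fun x => f (Pi.single x 1), fun v => ?_⟩
    conv_lhs => rw [← LinearMap.sum_single_apply (fun _ => K) v, map_sum]
    rw [Fin.sum_univ_four]
    have : ∀ x, f (Pi.single x (v x)) = v x * f (Pi.single x 1) := fun x => by
      rw [← smul_eq_mul, ← map_smul, ← Pi.single_smul, smul_eq_mul, mul_one]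
    simp only [this]
  obtain ⟨P, hP⟩ := happly p
  obtain ⟨Q, hQ⟩ := happly q
  have hθ : ω - ω ^ 2 ≠ 0 := fun h => h3 (by
    have h' : (ω - ω ^ 2) ^ 2 = -3 := by linear_combination (ω ^ 2 - 3 * ω + 3) * hω
    rw [h] at h'
    linear_combination h')
  have hdiag : ∀ x, P x * Q x = 0 := fun x => by
    have := h (.inl x)
    rw [hP, hQ] at this
    have h' : (ω - ω ^ 2) ^ 2 * (P x * Q x) = 0 := by
      fin_cases x <;> simp [g32Form] at this ⊢ <;> simpa [hθ] using this
    exact (mul_eq_zero.1 h').resolve_left (pow_ne_zero 2 hθ)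
  have hm : ∀ m k l, p (g32Form ω (.inr (m, k, l))) * q (g32Form ω (.inr (m, k, l))) = 0 :=
    fun m k l => h _
  have hneg : ∀ x y : K, x * y = 0 → -x * -y = 0 := fun x y h => by rw [neg_mul_neg, h]
  obtain ⟨h12, h13, h23⟩ := mixed_eq_zero hω h3 (hdiag 1) (hdiag 2) (hdiag 3) fun k l => by
    have := hm 0 k l
    rw [hP, hQ] at this
    simpa [g32Form] using this
  obtain ⟨-, h20, h30⟩ := mixed_eq_zero hω h3 (hdiag 2) (hneg _ _ (hdiag 3)) (hdiag 0)
    fun k l => by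
      have := hm 1 k l
      rw [hP, hQ] at this
      rw [← this]
      simp [g32Form]
      ring
  obtain ⟨h01, -, -⟩ := mixed_eq_zero hω h3 (hdiag 0) (hdiag 1) (hneg _ _ (hdiag 2))
    fun k l => by
      have := hm 3 k l
      rw [hP, hQ] at this
      rw [← this]
      simp [g32Form]
  -- two linear forms whose symmetric product vanishes are not both nonzero
  have hsym : ∀ x y, P x * Q y + P y * Q x = 0 := by
    intro x y
    fin_cases x <;> fin_cases y <;> simp only [Fin.zero_eta, Fin.mk_one, Fin.reduceFinMk] <;>
      first
      | linear_combination 2 * hdiag 0 | linear_combination 2 * hdiag 1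
      | linear_combination 2 * hdiag 2 | linear_combination 2 * hdiag 3
      | linear_combination h12 | linear_combination h13 | linear_combination h23
      | linear_combination h20 | linear_combination -h30 | linear_combination h01
  by_cases hp : P = 0
  · exact Or.inl (LinearMap.ext fun v => by rw [hP, hp]; simp)
  · obtain ⟨x, hx⟩ := Function.ne_iff.1 hp
    have hx' : P x ≠ 0 := hx
    have hQx := (mul_eq_zero.1 (hdiag x)).resolve_left hx'
    have hQ0 : Q = 0 := funext fun y => by
      have := hsym x y
      rw [hQx, mul_zero, add_zero] at this
      exact (mul_eq_zero.1 this).resolve_left hx'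
    exact Or.inr (LinearMap.ext fun v => by rw [hQ, hQ0]; simp)

/-- Two pairs of roots such that the members of one are orthogonal to those of the other span the
space. -/
theorem span_eq_top_of_orthogonal (h2 : (2 : K) ≠ 0) (h3 : (3 : K) ≠ 0) (hω : ω ^ 2 + ω + 1 = 0)
    {p₁ p₂ q₁ q₂ : G32Index} (hp : p₁ ≠ p₂) (hq : q₁ ≠ q₂)
    (h : ∀ p q, (p = p₁ ∨ p = p₂) → (q = q₁ ∨ q = q₂) →
      rootPairing ω p (g32Form ω q) = 0 ∧ rootPairing ω q (g32Form ω p) = 0) :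
    Submodule.span K (range ![g32Form ω p₁, g32Form ω p₂, g32Form ω q₁, g32Form ω q₂]) = ⊤ := by
  -- a vanishing combination is paired with both members of one of the pairs
  have key : ∀ {a b : G32Index}, a ≠ b → ∀ {x y : K} {v : Fin 4 → K},
      rootPairing ω a v = 0 → rootPairing ω b v = 0 →
      x • g32Form ω a + y • g32Form ω b + v = 0 → x = 0 ∧ y = 0 := by
    intro a b hab x y v hav hbv hv
    have ha := congrArg (rootPairing ω a) hv
    have hb := congrArg (rootPairing ω b) hv
    simp only [map_add, map_smul, smul_eq_mul, map_zero, hav, hbv, rootPairing_self hω] at ha hb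
    have hdet := gram_det_ne_zero h2 h3 hω hab
    constructor
    · refine (mul_eq_zero.1 (?_ : _ * x = 0)).resolve_left hdet
      linear_combination 3 * ha - rootPairing ω a (g32Form ω b) * hb
    · refine (mul_eq_zero.1 (?_ : _ * y = 0)).resolve_left hdet
      linear_combination 3 * hb - rootPairing ω b (g32Form ω a) * ha
  have hli : LinearIndependent K
      ![g32Form ω p₁, g32Form ω p₂, g32Form ω q₁, g32Form ω q₂] := by
    rw [Fintype.linearIndependent_iff]
    intro c hc
    rw [Fin.sum_univ_four] at hc
    simp only [Matrix.cons_val] at hc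
    have h₁ := key (x := c 0) (y := c 1) (v := c 2 • g32Form ω q₁ + c 3 • g32Form ω q₂) hp
      (by simp [(h p₁ q₁ (.inl rfl) (.inl rfl)).1, (h p₁ q₂ (.inl rfl) (.inr rfl)).1])
      (by simp [(h p₂ q₁ (.inr rfl) (.inl rfl)).1, (h p₂ q₂ (.inr rfl) (.inr rfl)).1])
      (by rw [← hc]; abel)
    have h₂ := key (x := c 2) (y := c 3) (v := c 0 • g32Form ω p₁ + c 1 • g32Form ω p₂) hq
      (by simp [(h p₁ q₁ (.inl rfl) (.inl rfl)).2, (h p₂ q₁ (.inr rfl) (.inl rfl)).2])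
      (by simp [(h p₁ q₂ (.inl rfl) (.inr rfl)).2, (h p₂ q₂ (.inr rfl) (.inr rfl)).2])
      (by rw [← hc]; abel)
    intro i
    fin_cases i
    exacts [h₁.1, h₁.2, h₂.1, h₂.2]
  exact hli.span_eq_top_of_card_eq_finrank (by simp)

theorem g32_union_eq_univ (h3 : (3 : K) ≠ 0) (hω : ω ^ 2 + ω + 1 = 0) {P G : Set G32Index}
    (hP : (g32Matroid ω).IsFlat P) (hG : (g32Matroid ω).IsFlat G) (h : P ∪ G = univ) :
    P = univ ∨ G = univ := by
  have key : ∀ P : Set G32Index, (g32Matroid ω).IsFlat P → P ≠ univ →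
      ∃ f : (Fin 4 → K) →ₗ[K] K, f ≠ 0 ∧ ∀ i ∈ P, f (g32Form ω i) = 0 := by
    intro P hP hne
    have hlt : Submodule.span K (g32Form ω '' P) < ⊤ := by
      refine lt_top_iff_ne_top.2 fun htop => hne (eq_univ_of_forall fun i => ?_)
      exact mem_of_mem_span hP subset_rfl (by rw [htop]; trivial)
    obtain ⟨f, hf, hle⟩ := Submodule.exists_le_ker_of_lt_top _ hlt
    exact ⟨f, hf, fun i hi => hle (Submodule.subset_span ⟨i, hi, rfl⟩)⟩
  by_contra! hcon
  obtain ⟨f, hf, hfP⟩ := key P hP hcon.1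
  obtain ⟨g, hg, hgG⟩ := key G hG hcon.2
  rcases eq_zero_or_eq_zero_of_forall_mul (ω := ω) (p := f) (q := g) h3 hω fun i => by
    rcases (h ▸ mem_univ i : i ∈ P ∪ G) with hi | hi
    · rw [hfP i hi, zero_mul]
    · rw [hgG i hi, mul_zero] with h | h
  · exact hf h
  · exact hg h

/-- The matroid of the arrangement is connected: a component and its complement would be two
proper flats with union the ground set. -/
theorem isConnectedFlat_g32 (h3 : (3 : K) ≠ 0) (hω : ω ^ 2 + ω + 1 = 0) :
    IsConnectedFlat (g32Matroid ω) univ := by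
  have hloop : ∀ C, (g32Matroid ω).IsCircuit C → ∀ e ∈ C, ∃ f ∈ C, f ≠ e := by
    intro C hC e he
    by_contra! hcon
    have hCe : C = {e} := subset_antisymm hcon (singleton_subset_iff.2 he)
    refine hC.not_indep (linearMatroid_indep.2 ?_)
    rw [hCe, linearIndepOn_singleton_iff]
    intro h0
    have := rootPairing_self hω e
    rw [h0, map_zero] at this
    exact h3 this.symm
  refine isConnectedFlat_iff.2 ⟨(g32Matroid ω).ground_isFlat, ⟨.inl 0, mem_univ _⟩,
    fun e _ f _ => ?_⟩
  let D : Set G32Index := {x | SameComponent (g32Matroid ω) univ e x}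
  have hD : (g32Matroid ω).IsFlat D := by
    refine isFlat_of_forall_isCircuit (subset_univ _) fun C hC x hx h => ?_
    obtain ⟨y, hy, hyx⟩ := hloop C hC x hx
    exact SameComponent.trans (h ⟨hy, hyx⟩) (.of_isCircuit hC (subset_univ _) hy hx)
  have hD' : (g32Matroid ω).IsFlat Dᶜ := by
    refine isFlat_of_forall_isCircuit (subset_univ _) fun C hC x hx h hxD => ?_
    obtain ⟨y, hy, hyx⟩ := hloop C hC x hx
    exact h ⟨hy, hyx⟩ (SameComponent.trans hxD (.of_isCircuit hC (subset_univ _) hx hy))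
  rcases g32_union_eq_univ h3 hω hD hD' (union_compl_self D) with h | h
  · exact (h ▸ mem_univ f : f ∈ D)
  · exact absurd (Or.inl rfl : e ∈ D) (h ▸ mem_univ e : e ∈ Dᶜ)

/-- No connected flat of the arrangement is a union of two proper flats `P` and `G`. Roots in
`P \ G` and in `G \ P` are orthogonal, since otherwise the line through them contains a third root,
which is in neither `P` nor `G`. As there are two of each, they span the space. -/
theorem g32_eq_of_union (h2 : (2 : K) ≠ 0) (h3 : (3 : K) ≠ 0) (hω : ω ^ 2 + ω + 1 = 0)
    (F P G : Set G32Index) (hF : IsConnectedFlat (g32Matroid ω) F)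
    (hP : (g32Matroid ω).IsFlat P) (hG : (g32Matroid ω).IsFlat G) (hFPG : F = P ∪ G) :
    P = F ∨ G = F := by
  by_contra! hcon
  have hPF : P ⊆ F := hFPG ▸ subset_union_left
  have hGF : G ⊆ F := hFPG ▸ subset_union_right
  have horth : ∀ {P G : Set G32Index}, (g32Matroid ω).IsFlat P → (g32Matroid ω).IsFlat G →
      F = P ∪ G → ∀ p ∈ P, p ∉ G → ∀ q ∈ G, q ∉ P → rootPairing ω q (g32Form ω p) = 0 := by
    intro P G hP hG hFPG p hp hpG q hq hqP
    by_contra hne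
    have hpF : p ∈ F := hFPG ▸ Or.inl hp
    have hqF : q ∈ F := hFPG ▸ Or.inr hq
    obtain ⟨k, s, t, hs, ht, hk⟩ :=
      exists_third_root hω (fun h => hqP (h ▸ hp) : p ≠ q) hne
    have hmem : ∀ {a b c : G32Index} {x y z : K}, z ≠ 0 →
        z • g32Form ω c = x • g32Form ω a + y • g32Form ω b → ∀ {A : Set G32Index},
        (g32Matroid ω).IsFlat A → a ∈ A → b ∈ A → c ∈ A := by
      intro a b c x y z hz h A hA ha hb
      refine mem_of_mem_span hA subset_rfl ?_
      rw [← Submodule.smul_mem_iff _ hz, h]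
      exact add_mem (Submodule.smul_mem _ _ (Submodule.subset_span ⟨a, ha, rfl⟩))
        (Submodule.smul_mem _ _ (Submodule.subset_span ⟨b, hb, rfl⟩))
    have hkF : k ∈ F := hmem (x := 1) ht (by rw [hk, one_smul]) hF.1 hpF hqF
    rcases (hFPG ▸ hkF : k ∈ P ∪ G) with hkP | hkG
    · exact hqP (hmem (x := t) (y := -1) hs (by rw [hk]; module) hP hkP hp)
    · exact hpG (hmem (x := t) (y := -s) one_ne_zero (by rw [hk]; module) hG hkG hq)
  have hsub : ∀ {P G : Set G32Index}, F = P ∪ G → G ⊆ F → G ≠ F → ∃ p ∈ P, p ∉ G := by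
    intro P G hFPG hGF hne
    obtain ⟨p, hp, hpG⟩ := exists_of_ssubset (lt_of_le_of_ne hGF hne)
    rw [hFPG] at hp
    exact ⟨p, hp.resolve_right hpG, hpG⟩
  obtain ⟨p₁, hp₁, hp₁G⟩ := hsub hFPG hGF hcon.2
  obtain ⟨q₁, hq₁, hq₁P⟩ := hsub (hFPG.trans (union_comm _ _)) hPF hcon.1
  obtain ⟨C, hC, hCF, hpC, hqC⟩ := hF.2.2 p₁ (hPF hp₁) q₁ (hGF hq₁) fun h => hp₁G (h ▸ hq₁)
  have hsecond : ∀ {P G : Set G32Index}, F = P ∪ G → (g32Matroid ω).IsFlat G → ∀ p ∈ C, p ∉ G →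
      ∃ p' ∈ P, p' ∉ G ∧ p ≠ p' := by
    intro P G hFPG hG p hp hpG
    by_contra! h
    refine hpG (mem_of_isCircuit_of_isFlat hG hC hp fun x hx => ?_)
    by_contra hxG
    exact hx.2 (h x ((hFPG ▸ hCF hx.1 : x ∈ P ∪ G).resolve_right hxG) hxG).symm
  obtain ⟨p₂, hp₂, hp₂G, hp⟩ := hsecond hFPG hG p₁ hpC hp₁G
  obtain ⟨q₂, hq₂, hq₂P, hq⟩ := hsecond (hFPG.trans (union_comm _ _)) hP q₁ hqC hq₁P
  have hspan := span_eq_top_of_orthogonal h2 h3 hω hp hq fun p q hp hq => by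
    have hpP : p ∈ P ∧ p ∉ G := by rcases hp with rfl | rfl <;> constructor <;> assumption
    have hqG : q ∈ G ∧ q ∉ P := by rcases hq with rfl | rfl <;> constructor <;> assumption
    exact ⟨horth hG hP (hFPG.trans (union_comm _ _)) q hqG.1 hqG.2 p hpP.1 hpP.2,
      horth hP hG hFPG p hpP.1 hpP.2 q hqG.1 hqG.2⟩
  have huniv : F = univ := by
    refine eq_univ_of_forall fun i => mem_of_mem_span hF.1 subset_rfl ?_
    refine Submodule.span_mono ?_ (hspan ▸ Submodule.mem_top : g32Form ω i ∈ _)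
    rintro _ ⟨x, rfl⟩
    fin_cases x
    exacts [⟨p₁, hPF hp₁, rfl⟩, ⟨p₂, hPF hp₂, rfl⟩, ⟨q₁, hGF hq₁, rfl⟩, ⟨q₂, hGF hq₂, rfl⟩]
  rcases g32_union_eq_univ h3 hω hP hG (hFPG.symm.trans huniv) with h | h
  · exact hcon.1 (h.trans huniv.symm)
  · exact hcon.2 (h.trans huniv.symm)

end G32

/-! ### Charts of the toric variety -/

section DualMonoid

variable {ι : Type}

open Classical in
/-- The character `e_j - e_i` of the torus. -/
noncomputable def charDiff (j i : ι) : ι → ℤ := Pi.single j 1 - Pi.single i 1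

theorem charDiff_add (j k i : ι) : charDiff j k + charDiff k i = charDiff j i := by
  simp [charDiff]

theorem charDiff_self (i : ι) : charDiff i i = 0 := by simp [charDiff]

variable [Fintype ι] {M : Matroid ι} {S : Set (Set ι)}

open Classical in
/-- The sum of the entries of `m` over `F`. -/
noncomputable def flatSum (m : ι → ℤ) (F : Set ι) : ℤ := ∑ i with i ∈ F, m i

theorem flatSum_add (m m' : ι → ℤ) (F : Set ι) :
    flatSum (m + m') F = flatSum m F + flatSum m' F := Finset.sum_add_distrib

theorem flatSum_univ (m : ι → ℤ) : flatSum m univ = ∑ i, m i := by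
  simp [flatSum]

theorem sum_mul_combination (m : ι → ℤ) (S : Set (Set ι)) (c : Set ι → ℝ) :
    ∑ i, (m i : ℝ) * combination S c i =
      ∑ F, (open Classical in if F ∈ S then c F * (flatSum m F : ℝ) else 0) := by
  classical
  have h1 : ∀ i, (m i : ℝ) * combination S c i =
      ∑ F, if F ∈ S then (if i ∈ F then c F * (m i : ℝ) else 0) else 0 := fun i => by
    rw [combination, Finset.mul_sum, Finset.sum_filter]
    refine Finset.sum_congr rfl fun F _ => ?_
    by_cases hF : F ∈ S <;> by_cases hi : i ∈ F <;> simp [hF, hi, mul_comm]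
  rw [Finset.sum_congr rfl fun i _ => h1 i, Finset.sum_comm]
  refine Finset.sum_congr rfl fun F _ => ?_
  by_cases hF : F ∈ S
  · simp only [hF, if_true]
    rw [← Finset.sum_filter, ← Finset.mul_sum, flatSum, Int.cast_sum]
  · simp [hF]

/-- An integer vector with sum zero is nonnegative on the cone over `S` iff its sums over the
members of `S` are nonnegative. -/
theorem mem_dualMonoid_incidenceCone {m : ι → ℤ} : m ∈ dualMonoid (incidenceCone S) ↔
    ∑ i, m i = 0 ∧ ∀ F ∈ S, 0 ≤ flatSum m F := by
  classical
  refine and_congr_right fun hm => ⟨fun h F hF => ?_, fun h w hw => ?_⟩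
  · have := h (fun i => if i ∈ F then 1 else 0) (Submodule.subset_span ⟨F, hF, rfl⟩)
    simp only [mul_ite, mul_one, mul_zero] at this
    rw [← Finset.sum_filter, ← Int.cast_sum] at this
    exact_mod_cast this
  · obtain ⟨c, hc, hcw⟩ := mem_incidenceCone.1 hw
    obtain ⟨r, hr⟩ := mk_eq_mk_iff.1 hcw.symm
    have : ∑ i, (m i : ℝ) * w i = ∑ i, (m i : ℝ) * combination S c i := by
      have hm' : ∑ i, (m i : ℝ) = 0 := by exact_mod_cast hm
      simp only [hr, mul_add, Finset.sum_add_distrib, ← Finset.sum_mul, hm', zero_mul, add_zero]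
    rw [this, sum_mul_combination]
    refine Finset.sum_nonneg fun F _ => ?_
    split_ifs with hF
    · exact mul_nonneg (hc F hF) (by exact_mod_cast h F hF)
    · exact le_rfl

open Classical in
theorem flatSum_charDiff (j i : ι) (F : Set ι) :
    flatSum (charDiff j i) F = (if j ∈ F then 1 else 0) - (if i ∈ F then 1 else 0) := by
  simp [flatSum, charDiff, Finset.sum_sub_distrib, Pi.single_apply, Finset.sum_ite_eq']

theorem sum_charDiff (j i : ι) : ∑ k, charDiff j i k = 0 := by
  rw [← flatSum_univ, flatSum_charDiff]
  simp

theorem charDiff_mem_iff {j i : ι} : charDiff j i ∈ dualMonoid (incidenceCone S) ↔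
    ∀ F ∈ S, i ∈ F → j ∈ F := by
  classical
  rw [mem_dualMonoid_incidenceCone]
  simp only [sum_charDiff, true_and, flatSum_charDiff]
  refine forall₂_congr fun F _ => ?_
  by_cases hi : i ∈ F <;> by_cases hj : j ∈ F <;> simp [hi, hj]

theorem prod_zpow_charDiff {G : Type*} [CommGroup G] (t : ι → G) (j i : ι) :
    ∏ k, t k ^ charDiff j i k = t j / t i := by
  classical
  have h : ∀ l, ∏ k, t k ^ (Pi.single l 1 : ι → ℤ) k = t l := fun l => by
    rw [Finset.prod_eq_single l]
    · simp
    · intro k _ hk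
      simp [hk]
    · intro h
      exact absurd (Finset.mem_univ l) h
  have hd : charDiff j i = Pi.single j 1 - Pi.single i 1 := by
    unfold charDiff
    congr!
  rw [hd]
  simp only [Pi.sub_apply, zpow_sub, Finset.prod_mul_distrib, Finset.prod_inv_distrib, h,
    div_eq_mul_inv]

/-- The monoid `σ^∨ ∩ ℤ^E_0` of the cone over a nested set is generated by the characters
`e_j - e_i`, where `j` is in the smallest member that contains `i`. -/
theorem mem_closure_charDiff [Nontrivial ι] (hM : IsConnectedFlat M univ)
    (hS : S ∈ nestedSetComplex M) {m : ι → ℤ} (hm : m ∈ dualMonoid (incidenceCone S)) :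
    m ∈ AddSubmonoid.closure {d | ∃ i j, j ∈ minMember S i ∧ d = charDiff j i} := by
  classical
  induction hn : ∑ i, (m i).natAbs using Nat.strong_induction_on generalizing m with
  | _ n ih =>
  obtain ⟨hm0, hmS⟩ := mem_dualMonoid_incidenceCone.1 hm
  have hmS' : ∀ F ∈ insert univ S, 0 ≤ flatSum m F := by
    rintro F (rfl | hF)
    · rw [flatSum_univ, hm0]
    · exact hmS F hF
  by_cases hneg : ∃ i, m i < 0
  swap
  · push Not at hneg
    have : m = 0 := funext fun i =>
      (Finset.sum_eq_zero_iff_of_nonneg fun i _ => hneg i).1 hm0 i (Finset.mem_univ i)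
    rw [this]
    exact zero_mem _
  -- take a negative entry in a smallest possible member and move it to a positive entry there
  obtain ⟨i, hi, hmin⟩ := (toFinite {i | m i < 0}).exists_minimalFor (minMember S) _ hneg
  have hi' : m i < 0 := hi
  have hiF := minMember_mem hM hS i
  obtain ⟨j, hj, hjpos⟩ : ∃ j ∈ minMember S i, 0 < m j := by
    by_contra! hcon
    exact absurd (hmS' _ hiF) (not_le.2 (Finset.sum_neg' (fun l hl => hcon l (by simpa using hl))
      ⟨i, by simpa using mem_minMember S i, hi'⟩))
  have hij : i ≠ j := fun h => by rw [h] at hi'; omega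
  have hsplit : m = (m - charDiff j i) + charDiff j i := by simp
  have hmem : ∀ F ∈ insert univ S, 0 ≤ flatSum (m - charDiff j i) F := by
    intro F hF
    have hadd := flatSum_add (m - charDiff j i) (charDiff j i) F
    rw [← hsplit, flatSum_charDiff] at hadd
    have hF0 := hmS' F hF
    by_cases hjF : j ∈ F
    swap
    · simp only [hjF, if_false] at hadd
      split_ifs at hadd <;> omega
    by_cases hiF' : i ∈ F
    · simp only [hjF, hiF', if_true] at hadd
      omega
    simp only [hjF, hiF', if_true, if_false] at hadd
    suffices h : flatSum m F ≠ 0 by omega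
    intro h0
    obtain ⟨l, hl, hlneg⟩ : ∃ l ∈ F, m l < 0 := by
      by_contra! hcon
      have : 0 < flatSum m F :=
        Finset.sum_pos' (fun l hl => hcon l (by simpa using hl)) ⟨j, by simpa using hjF, hjpos⟩
      omega
    rcases laminar_insert hM hS hF hiF ⟨j, hjF, hj⟩ with h | h
    · have := hmin hlneg ((minMember_subset hF hl).trans h)
      exact hiF' ((minMember_subset hF hl) (this (mem_minMember S i)))
    · exact hiF' (h (mem_minMember S i))
  have hlt : ∑ k, ((m - charDiff j i) k).natAbs < n := by
    rw [← hn]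
    refine Finset.sum_lt_sum (fun k _ => ?_) ⟨i, Finset.mem_univ i, ?_⟩
    · simp only [charDiff, Pi.sub_apply, Pi.single_apply]
      by_cases hk : k = j
      · subst hk
        simp only [if_true, hij.symm, if_false]
        omega
      · by_cases hk' : k = i
        · subst hk'
          simp only [if_true, hij, if_false]
          omega
        · simp [hk, hk']
    · simp only [charDiff, Pi.sub_apply, Pi.single_apply, if_true, hij, if_false]
      omega
  have hsum : ∑ k, (m - charDiff j i) k = 0 := by
    simp only [Pi.sub_apply, Finset.sum_sub_distrib, hm0, sum_charDiff, sub_zero]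
  rw [hsplit]
  exact add_mem (ih _ hlt (mem_dualMonoid_incidenceCone.2 ⟨hsum, fun F hF => hmem F (.inr hF)⟩) rfl)
    (AddSubmonoid.subset_closure ⟨i, j, hj, rfl⟩)

end DualMonoid

section Charts

variable {ι : Type} [Fintype ι] {K L : Type*} [Field K] [Field L] [Algebra K L]
  {ρ σ : PointedCone ℝ (TropTorus ι)}

open Classical in
/-- The value of a character at a point of a chart, extended by zero to the characters that are
not regular on the chart. -/
noncomputable def ToricChart.val (φ : ToricChart K L σ) (m : ι → ℤ) : L :=
  if h : m ∈ dualMonoid σ then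
    (show Multiplicative (dualMonoid σ) →* L from φ) (Multiplicative.ofAdd ⟨m, h⟩)
  else 0

namespace ToricChart

theorem val_zero (φ : ToricChart K L σ) : φ.val 0 = 1 := by
  rw [val, dif_pos (zero_mem _)]
  exact map_one (show Multiplicative (dualMonoid σ) →* L from φ)

theorem val_add (φ : ToricChart K L σ) {m m' : ι → ℤ} (hm : m ∈ dualMonoid σ)
    (hm' : m' ∈ dualMonoid σ) : φ.val (m + m') = φ.val m * φ.val m' := by
  rw [val, val, val, dif_pos hm, dif_pos hm', dif_pos (add_mem hm hm')]
  exact map_mul (show Multiplicative (dualMonoid σ) →* L from φ)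
    (Multiplicative.ofAdd ⟨m, hm⟩) (Multiplicative.ofAdd ⟨m', hm'⟩)

theorem val_incl (h : ρ ≤ σ) (χ : ToricChart K L ρ) {m : ι → ℤ} (hm : m ∈ dualMonoid σ) :
    (χ.incl h).val m = χ.val m := by
  rw [val, val, dif_pos hm, dif_pos (dualMonoid_anti h hm)]
  rfl

theorem ext_val {φ ψ : ToricChart K L σ} (h : ∀ m ∈ dualMonoid σ, φ.val m = ψ.val m) :
    φ = ψ := by
  refine MonoidHom.ext fun m => ?_
  have := h m.toAdd.1 m.toAdd.2
  rw [val, val, dif_pos m.toAdd.2, dif_pos m.toAdd.2] at this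
  exact this

theorem eval_add (φ : ToricChart K L σ) (p q : AddMonoidAlgebra K (dualMonoid σ)) :
    φ.eval (p + q) = φ.eval p + φ.eval q := map_add _ _ _

theorem eval_mul (φ : ToricChart K L σ) (p q : AddMonoidAlgebra K (dualMonoid σ)) :
    φ.eval (p * q) = φ.eval p * φ.eval q := map_mul _ _ _

theorem eval_smul (φ : ToricChart K L σ) (c : K) (p : AddMonoidAlgebra K (dualMonoid σ)) :
    φ.eval (c • p) = algebraMap K L c * φ.eval p :=
  (map_smul (AddMonoidAlgebra.lift K L (dualMonoid σ) φ) c p).trans (Algebra.smul_def _ _)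

theorem eval_of (φ : ToricChart K L σ) {m : ι → ℤ} (hm : m ∈ dualMonoid σ) :
    φ.eval (AddMonoidAlgebra.of K (dualMonoid σ) (Multiplicative.ofAdd ⟨m, hm⟩)) = φ.val m := by
  rw [val, dif_pos hm]
  exact AddMonoidAlgebra.lift_of _ _

theorem eval_aeval {s : Type*} (φ : ToricChart K L σ)
    (f : s → AddMonoidAlgebra K (dualMonoid σ)) (p : MvPolynomial s K) :
    φ.eval (MvPolynomial.aeval f p) = MvPolynomial.aeval (fun i => φ.eval (f i)) p := by
  exact DFunLike.congr_fun
    (MvPolynomial.comp_aeval f (AddMonoidAlgebra.lift K L (dualMonoid σ) φ)) p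

theorem isClosed_setOf_eval_eq_zero (p : AddMonoidAlgebra K (dualMonoid σ)) :
    IsClosed {φ : ToricChart K L σ | φ.eval p = 0} := by
  rw [← isOpen_compl_iff]
  exact TopologicalSpace.isOpen_generateFrom_of_mem ⟨p, rfl⟩

theorem val_torusPoint (t : ι → Lˣ) {j i : ι} (h : charDiff j i ∈ dualMonoid σ) :
    (torusPoint (K := K) σ t).val (charDiff j i) = t j / t i := by
  rw [val, dif_pos h]
  change ((∏ k, t k ^ (charDiff j i k) : Lˣ) : L) = _
  rw [prod_zpow_charDiff, Units.val_div_eq_div_val]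

end ToricChart

variable {𝓕 : Set (PointedCone ℝ (TropTorus ι))}

theorem isClosed_toricVariety_iff {C : Set (ToricVariety K L 𝓕)} :
    IsClosed C ↔ ∀ σ : 𝓕, IsClosed {φ : ToricChart K L σ.1 | ToricVariety.chart σ φ ∈ C} := by
  rw [← isOpen_compl_iff, isOpen_iSup_iff]
  refine forall_congr' fun σ => ?_
  rw [isOpen_coinduced, ← isOpen_compl_iff]
  rfl

theorem continuous_chart (σ : 𝓕) :
    Continuous (ToricVariety.chart σ : ToricChart K L σ.1 → ToricVariety K L 𝓕) :=
  continuous_iff_coinduced_le.2 (le_iSup (fun σ : 𝓕 =>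
    TopologicalSpace.coinduced (ToricVariety.chart σ) inferInstance) σ)

theorem chart_incl {ρ σ : 𝓕} (h : ρ.1 ≤ σ.1) (χ : ToricChart K L ρ.1) :
    ToricVariety.chart (𝓕 := 𝓕) σ (χ.incl h) = ToricVariety.chart ρ χ := by
  refine Quot.sound ⟨ρ.1, ρ.2, h, le_rfl, χ, rfl, ?_⟩
  exact ToricChart.ext_val fun m hm => ToricChart.val_incl le_rfl χ hm

theorem exists_chart (z : ToricVariety K L 𝓕) :
    ∃ (σ : 𝓕) (φ : ToricChart K L σ.1), ToricVariety.chart σ φ = z := by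
  obtain ⟨⟨σ, φ⟩, rfl⟩ := Quot.exists_rep z
  exact ⟨σ, φ, rfl⟩

end Charts

open scoped LinearAlgebra.Projectivization

/-! ### Corresponding points of the toric variety and of the product of projective spaces -/

section Pivots

variable {ι : Type} [Fintype ι] {K L : Type*} [Field K] [Field L] [Algebra K L]
  {ρ σ : PointedCone ℝ (TropTorus ι)} {F : Set ι} {i j : ι}

/-- On the chart of `σ` all quotients `t_j / t_i`, `j ∈ F`, are regular. -/
def IsPivot (σ : PointedCone ℝ (TropTorus ι)) (F : Set ι) (i : ι) : Prop :=
  i ∈ F ∧ ∀ j ∈ F, charDiff j i ∈ dualMonoid σ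

theorem IsPivot.anti (h : ρ ≤ σ) (hi : IsPivot σ F i) : IsPivot ρ F i :=
  ⟨hi.1, fun j hj => dualMonoid_anti h (hi.2 j hj)⟩

/-- The coordinates for two pivots are proportional. -/
theorem IsPivot.exists_mul (hi : IsPivot σ F i) (hj : IsPivot σ F j) (φ : ToricChart K L σ) :
    ∃ c : L, c ≠ 0 ∧ ∀ k ∈ F, φ.val (charDiff k i) = c * φ.val (charDiff k j) := by
  refine ⟨φ.val (charDiff j i), fun h => ?_, fun k hk => ?_⟩
  · have := φ.val_add (hi.2 j hj.1) (hj.2 i hi.1)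
    rw [charDiff_add, charDiff_self, φ.val_zero, h, zero_mul] at this
    exact one_ne_zero this
  · rw [mul_comm, ← φ.val_add (hj.2 k hk) (hi.2 j hj.1), charDiff_add]

theorem isPivot_minMember {S : Set (Set ι)} (i : ι) :
    IsPivot (incidenceCone S) (minMember S i) i :=
  ⟨mem_minMember S i, fun _ hj => charDiff_mem_iff.2 fun _ hF hiF =>
    minMember_subset (.inr hF) hiF hj⟩

/-- Every connected flat has a pivot: an element that avoids the members of `S` which do not
contain the flat. -/
theorem exists_isPivot [Nontrivial ι] {M : Matroid ι} {S : Set (Set ι)}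
    (hM : IsConnectedFlat M univ) (hS : S ∈ nestedSetComplex M) (hF : IsConnectedFlat M F) :
    ∃ i, IsPivot (incidenceCone S) F i := by
  obtain ⟨i, hi, h⟩ := exists_mem_forall_subset hM hS hF
  exact ⟨i, hi, fun j hj => charDiff_mem_iff.2 fun G hG hiG => h G hG hiG hj⟩

end Pivots

section Correspondence

variable {ι : Type} [Fintype ι] {n : ℕ} {K L : Type*} [Field K] [Field L] [Algebra K L]
  {a : ι → Fin n → K}

open Classical in
/-- The homogeneous coordinate with index `j` of the component in `ℙ(V / X_F)`, extended by zero. -/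
noncomputable def coord (y : MultiProjective K L (wonderfulCoords a)) (F : Set ι) (j : ι) : L :=
  if h : IsConnectedFlat (linearMatroid (K := K) a) F ∧ j ∈ F then
    (y (some ⟨F, h.1⟩)).rep (⟨j, h.2⟩ : F) else 0

theorem coord_eq (y : MultiProjective K L (wonderfulCoords a)) {F : Set ι} {j : ι}
    (hF : IsConnectedFlat (linearMatroid (K := K) a) F) (hj : j ∈ F) :
    coord y F j = (y (some ⟨F, hF⟩)).rep (⟨j, hj⟩ : F) := dif_pos ⟨hF, hj⟩

theorem exists_coord_ne_zero (y : MultiProjective K L (wonderfulCoords a)) {F : Set ι}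
    (hF : IsConnectedFlat (linearMatroid (K := K) a) F) : ∃ j ∈ F, coord y F j ≠ 0 := by
  by_contra! h
  refine (y (some ⟨F, hF⟩)).rep_nonzero (funext fun j : F => ?_)
  rw [← coord_eq y hF j.2, h j j.2]
  rfl

/-- The point `φ` of the chart of `σ` and the point `y` of the product of projective spaces have
the same homogeneous coordinates. The matrix `B` expresses the coordinates on `V` in terms of the
linear forms. -/
structure Corresponds (B : Fin n → ι → K) {σ : PointedCone ℝ (TropTorus ι)}
    (φ : ToricChart K L σ) (y : MultiProjective K L (wonderfulCoords a)) : Prop where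
  flat : ∀ F, IsConnectedFlat (linearMatroid (K := K) a) F → ∃ i, IsPivot σ F i ∧
    ∃ c : L, c ≠ 0 ∧ ∀ j ∈ F, coord y F j = c * φ.val (charDiff j i)
  point : ∃ i, IsPivot σ univ i ∧ ∃ c : L, c ≠ 0 ∧
    ∀ x, (y none).rep x = c * ∑ l, algebraMap K L (B x l) * φ.val (charDiff l i)

namespace Corresponds

variable {B : Fin n → ι → K} {ρ σ : PointedCone ℝ (TropTorus ι)} {φ : ToricChart K L σ}
  {y y' : MultiProjective K L (wonderfulCoords a)}

theorem flat_of_isPivot (h : Corresponds B φ y) {F : Set ι}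
    (hF : IsConnectedFlat (linearMatroid (K := K) a) F) {i : ι} (hi : IsPivot σ F i) :
    ∃ c : L, c ≠ 0 ∧ ∀ j ∈ F, coord y F j = c * φ.val (charDiff j i) := by
  obtain ⟨k, hk, c, hc, hy⟩ := h.flat F hF
  obtain ⟨d, hd, hdk⟩ := hk.exists_mul hi φ
  exact ⟨c * d, mul_ne_zero hc hd, fun j hj => by rw [hy j hj, hdk j hj, mul_assoc]⟩

theorem point_of_isPivot (h : Corresponds B φ y) {i : ι} (hi : IsPivot σ univ i) :
    ∃ c : L, c ≠ 0 ∧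
      ∀ x, (y none).rep x = c * ∑ l, algebraMap K L (B x l) * φ.val (charDiff l i) := by
  obtain ⟨k, hk, c, hc, hy⟩ := h.point
  obtain ⟨d, hd, hdk⟩ := hk.exists_mul hi φ
  refine ⟨c * d, mul_ne_zero hc hd, fun x => ?_⟩
  rw [hy x, mul_assoc, Finset.mul_sum _ _ d]
  congr 1
  refine Finset.sum_congr rfl fun l _ => ?_
  rw [hdk l (mem_univ l)]
  ring

theorem of_incl {h : ρ ≤ σ} {χ : ToricChart K L ρ} (hc : Corresponds B (χ.incl h) y) :
    Corresponds B χ y where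
  flat F hF := by
    obtain ⟨i, hi, c, hc, hy⟩ := hc.flat F hF
    exact ⟨i, hi.anti h, c, hc, fun j hj => by rw [hy j hj, χ.val_incl h (hi.2 j hj)]⟩
  point := by
    obtain ⟨i, hi, c, hc, hy⟩ := hc.point
    refine ⟨i, hi.anti h, c, hc, fun x => ?_⟩
    rw [hy x]
    simp only [χ.val_incl h (hi.2 _ (mem_univ _))]

theorem incl (h : ρ ≤ σ)
    (hσ : ∀ F, IsConnectedFlat (linearMatroid (K := K) a) F → ∃ i, IsPivot σ F i)
    (hM : IsConnectedFlat (linearMatroid (K := K) a) univ) {χ : ToricChart K L ρ}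
    (hc : Corresponds B χ y) : Corresponds B (χ.incl h) y where
  flat F hF := by
    obtain ⟨i, hi⟩ := hσ F hF
    obtain ⟨c, hc, hy⟩ := hc.flat_of_isPivot hF (hi.anti h)
    exact ⟨i, hi, c, hc, fun j hj => by rw [hy j hj, χ.val_incl h (hi.2 j hj)]⟩
  point := by
    obtain ⟨i, hi⟩ := hσ univ hM
    obtain ⟨c, hc, hy⟩ := hc.point_of_isPivot (hi.anti h)
    refine ⟨i, hi, c, hc, fun x => ?_⟩
    rw [hy x]
    simp only [χ.val_incl h (hi.2 _ (mem_univ _))]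

theorem _root_.Projectivization.eq_of_rep {I : Type*} {P Q : ℙ L (I → L)} {w : I → L} {c d : L}
    (hc : c ≠ 0) (hd : d ≠ 0) (hP : ∀ s, P.rep s = c * w s) (hQ : ∀ s, Q.rep s = d * w s) :
    P = Q := by
  rw [← P.mk_rep, ← Q.mk_rep, Projectivization.mk_eq_mk_iff']
  refine ⟨c / d, funext fun s => ?_⟩
  rw [Pi.smul_apply, smul_eq_mul, hP, hQ]
  field_simp

/-- A point of a chart corresponds to at most one point of the product. -/
theorem unique (h : Corresponds B φ y) (h' : Corresponds B φ y') : y = y' := by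
  funext k
  rcases k with _ | ⟨F, hF⟩
  · obtain ⟨i, hi, c, hc, hy⟩ := h.point
    obtain ⟨d, hd, hy'⟩ := h'.point_of_isPivot hi
    exact Projectivization.eq_of_rep hc hd hy hy'
  · obtain ⟨i, hi, c, hc, hy⟩ := h.flat F hF
    obtain ⟨d, hd, hy'⟩ := h'.flat_of_isPivot hF hi
    refine Projectivization.eq_of_rep (I := F) (w := fun j => φ.val (charDiff j i)) hc hd
      (fun j => ?_) fun j => ?_
    · rw [← hy j j.2, coord_eq y hF j.2]
      rfl
    · rw [← hy' j j.2, coord_eq y' hF j.2]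
      rfl

end Corresponds

/-- The homogeneous coordinates for the factor `ℙ(V / X_E)` satisfy the linear relations between
the forms. -/
def IsLinear (a : ι → Fin n → K) {σ : PointedCone ℝ (TropTorus ι)} (φ : ToricChart K L σ) : Prop :=
  ∀ i, IsPivot σ univ i → ∀ c : ι → K, ∑ l, c l • a l = 0 →
    ∑ l, algebraMap K L (c l) * φ.val (charDiff l i) = 0

theorem isLinear_incl_iff {ρ σ : PointedCone ℝ (TropTorus ι)} (h : ρ ≤ σ)
    (hσ : ∃ i, IsPivot σ univ i) {χ : ToricChart K L ρ} :
    IsLinear a (χ.incl h) ↔ IsLinear a χ := by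
  have key : ∀ i, IsPivot σ univ i → ∀ c : ι → K,
      ∑ l, algebraMap K L (c l) * (χ.incl h).val (charDiff l i) =
        ∑ l, algebraMap K L (c l) * χ.val (charDiff l i) := fun i hi c =>
    Finset.sum_congr rfl fun l _ => by rw [χ.val_incl h (hi.2 l (mem_univ l))]
  refine ⟨fun hl j hj c hc => ?_, fun hl i hi c hc => ?_⟩
  · obtain ⟨i, hi⟩ := hσ
    have := hl i hi c hc
    rw [key i hi] at this
    obtain ⟨d, -, hd⟩ := hj.exists_mul (hi.anti h) χ
    rw [← mul_zero d, ← this, Finset.mul_sum]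
    refine Finset.sum_congr rfl fun l _ => ?_
    rw [hd l (mem_univ l)]
    ring
  · rw [key i hi]
    exact hl i (hi.anti h) c hc

/-- The relation between the linear forms that comes from expressing the form `a j` in terms of
coordinates and the coordinates in terms of forms. -/
theorem sum_mul_eq {B : Fin n → ι → K} (hB : ∀ x, ∑ l, B x l • a l = Pi.single x 1) {w : ι → L}
    (hw : ∀ c : ι → K, ∑ l, c l • a l = 0 → ∑ l, algebraMap K L (c l) * w l = 0) (j : ι) :
    formValue (a j) (fun x => ∑ l, algebraMap K L (B x l) * w l) = w j := by
  classical
  have h := hw (fun l => (∑ x, a j x * B x l) - if l = j then 1 else 0) ?_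
  · simp only [map_sub, map_sum, map_mul, sub_mul, Finset.sum_sub_distrib, apply_ite
    (algebraMap K L),
      map_one, map_zero, ite_mul, one_mul, zero_mul, Finset.sum_ite_eq', Finset.mem_univ,
      if_true, sub_eq_zero] at h
    rw [← h]
    simp only [formValue, Finset.mul_sum, Finset.sum_mul]
    rw [Finset.sum_comm]
    exact Finset.sum_congr rfl fun l _ => Finset.sum_congr rfl fun x _ => by ring
  · simp only [sub_smul, Finset.sum_sub_distrib, ite_smul, one_smul, zero_smul,
      Finset.sum_ite_eq', Finset.mem_univ, if_true, sub_eq_zero, Finset.sum_smul, mul_smul]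
    rw [Finset.sum_comm]
    simp only [← Finset.smul_sum, hB]
    funext y
    simp [Finset.sum_apply, Pi.single_apply]

/-- A point of the toric variety that satisfies the linear relations corresponds to a point of the
product. The relations are needed for the factor `ℙ(V)`, whose coordinates could otherwise all
vanish. -/
theorem exists_corresponds {B : Fin n → ι → K} (hB : ∀ x, ∑ l, B x l • a l = Pi.single x 1)
    (hM : IsConnectedFlat (linearMatroid (K := K) a) univ) {σ : PointedCone ℝ (TropTorus ι)}
    (hσ : ∀ F, IsConnectedFlat (linearMatroid (K := K) a) F → ∃ i, IsPivot σ F i)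
    {φ : ToricChart K L σ} (hφ : IsLinear a φ) :
    ∃ y : MultiProjective K L (wonderfulCoords a), Corresponds B φ y := by
  choose p hp using hσ
  have hF : ∀ F : {F : Set ι // IsConnectedFlat (linearMatroid (K := K) a) F},
      (fun j : F.1 => φ.val (charDiff j.1 (p F.1 F.2))) ≠ 0 := fun F h => by
    have := congrFun h ⟨_, (hp F.1 F.2).1⟩
    simp [charDiff_self, φ.val_zero] at this
  have h0 : (fun x => ∑ l, algebraMap K L (B x l) * φ.val (charDiff l (p univ hM))) ≠ 0 :=
    fun h => by
      have := sum_mul_eq hB (hφ _ (hp univ hM)) (p univ hM)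
      rw [h, charDiff_self, φ.val_zero] at this
      simp [formValue] at this
  let y : MultiProjective K L (wonderfulCoords a) := fun k => match k with
    | none => Projectivization.mk L _ h0
    | some F => Projectivization.mk L _ (hF F)
  refine ⟨y, fun F hFc => ⟨p F hFc, hp F hFc, ?_⟩, ⟨p univ hM, hp univ hM, ?_⟩⟩
  · obtain ⟨c, hc⟩ := Projectivization.exists_smul_eq_mk_rep L _ (hF ⟨F, hFc⟩)
    refine ⟨c, c.ne_zero, fun j hj => ?_⟩
    rw [coord_eq y hFc hj]
    exact (congrFun hc ⟨j, hj⟩).symm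
  · obtain ⟨c, hc⟩ := Projectivization.exists_smul_eq_mk_rep L _ h0
    exact ⟨c, c.ne_zero, fun x => (congrFun hc x).symm⟩

end Correspondence

/-! ### The nested set of a point of the wonderful compactification -/

section Admissible

variable {ι : Type} [Fintype ι] {n : ℕ} {K L : Type*} [Field K] [Field L] [Algebra K L]
  {a : ι → Fin n → K}

/-- Closed conditions that hold on the wonderful compactification: the component in `ℙ(V / X_F)`
satisfies the linear relations between the forms `a i`, `i ∈ F`, and where the projections
`V / X_F → V / X_G` and `V → V / X_E` are defined, they relate the components. -/
structure Admissible (y : MultiProjective K L (wonderfulCoords a)) : Prop where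
  linear : ∀ F, IsConnectedFlat (linearMatroid (K := K) a) F → ∀ c : ι → K, (∀ i ∉ F, c i = 0) →
    ∑ i, c i • a i = 0 → ∑ i, algebraMap K L (c i) * coord y F i = 0
  flat : ∀ F G, IsConnectedFlat (linearMatroid (K := K) a) F →
    IsConnectedFlat (linearMatroid (K := K) a) G → G ⊆ F → ∀ i ∈ G, ∀ j ∈ G,
    coord y F i * coord y G j = coord y F j * coord y G i
  point : ∀ i j, formValue (a i) (y none).rep * coord y univ j =
    formValue (a j) (y none).rep * coord y univ i

/-- For all `j` and the smallest member `F` of `S ∪ {E}` that contains `j`, the coordinate with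
index `j` of the component in `ℙ(V / X_F)` does not vanish. This defines the open subset that corresponds
to the chart of the cone over `S`. -/
def InChart (S : Set (Set ι)) (y : MultiProjective K L (wonderfulCoords a)) : Prop :=
  ∀ j, coord y (minMember S j) j ≠ 0

/-- The connected flats `F ≠ E` such that for all larger connected flats `G` the component in
`ℙ(V / X_G)` lies in the centre of the projection to `ℙ(V / X_F)`. -/
def nestedOf (y : MultiProjective K L (wonderfulCoords a)) : Set (Set ι) :=
  {F | (IsConnectedFlat (linearMatroid (K := K) a) F ∧ F ≠ univ) ∧
    ∀ G, IsConnectedFlat (linearMatroid (K := K) a) G → F ⊂ G → ∀ j ∈ F, coord y G j = 0}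

namespace Admissible

variable {y : MultiProjective K L (wonderfulCoords a)} {F G : Set ι} {S : Set (Set ι)}

/-- The coordinates that vanish at an admissible point form a flat. -/
theorem isFlat_setOf_coord_eq_zero (hy : Admissible y)
    (hF : IsConnectedFlat (linearMatroid (K := K) a) F) :
    (linearMatroid (K := K) a).IsFlat {j | j ∈ F ∧ coord y F j = 0} := by
  classical
  rw [Matroid.isFlat_iff_closure_eq]
  refine subset_antisymm (fun e he => ?_)
    ((linearMatroid (K := K) a).subset_closure _ (subset_univ _))
  have heF : e ∈ F := by
    rw [← hF.1.closure]
    exact (linearMatroid (K := K) a).closure_subset_closure (fun _ h => h.1) he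
  refine ⟨heF, ?_⟩
  by_cases hez : coord y F e = 0
  · exact hez
  rw [mem_closure_linearMatroid_iff, Finsupp.mem_span_image_iff_linearCombination] at he
  obtain ⟨l, hl, hle⟩ := he
  have hle' : ∑ i, l i • a i = a e := by
    rw [← hle, Finsupp.linearCombination_apply, Finsupp.sum_fintype _ _ (by simp)]
  have hl0 : ∀ i, l i ≠ 0 → i ∈ F ∧ coord y F i = 0 := fun i hi =>
    hl (Finset.mem_coe.2 (Finsupp.mem_support_iff.2 hi))
  have := hy.linear F hF (fun i => l i - if i = e then 1 else 0) (fun i hi => ?_) ?_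
  · simp only [map_sub, sub_mul, Finset.sum_sub_distrib, apply_ite (algebraMap K L), map_one,
      map_zero, ite_mul, one_mul, zero_mul, Finset.sum_ite_eq', Finset.mem_univ, if_true,
      sub_eq_zero] at this
    rw [← this]
    refine Finset.sum_eq_zero fun i _ => ?_
    by_cases hi : l i = 0
    · rw [hi, map_zero, zero_mul]
    · rw [(hl0 i hi).2, mul_zero]
  · have h1 : l i = 0 := by_contra fun h => hi (hl0 i h).1
    have h2 : i ≠ e := fun h => hi (h ▸ heF)
    simp [h1, h2]
  · simp [sub_smul, Finset.sum_sub_distrib, hle']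

/-- The coordinates do not all vanish on a set that spans the flat. -/
theorem exists_coord_ne_zero_of_closure_eq (hy : Admissible y)
    (hF : IsConnectedFlat (linearMatroid (K := K) a) F) {X : Set ι}
    (hX : (linearMatroid (K := K) a).closure X = F) : ∃ j ∈ X, coord y F j ≠ 0 := by
  by_contra! h
  obtain ⟨k, hk, hk0⟩ := exists_coord_ne_zero y hF
  have hXF : X ⊆ F := hX ▸ (linearMatroid (K := K) a).subset_closure _ (subset_univ _)
  have hXZ : X ⊆ {j | j ∈ F ∧ coord y F j = 0} := fun j hj => ⟨hXF hj, h j hj⟩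
  have := (linearMatroid (K := K) a).closure_subset_closure hXZ (hX ▸ hk)
  rw [(hy.isFlat_setOf_coord_eq_zero hF).closure] at this
  exact hk0 this.2

/-- If the component of `F` is not in the centre of the projection to `ℙ(V / X_G)`, zero
coordinates are projected to zero coordinates. -/
theorem coord_eq_zero (hy : Admissible y) (hF : IsConnectedFlat (linearMatroid (K := K) a) F)
    (hG : IsConnectedFlat (linearMatroid (K := K) a) G) (hGF : G ⊆ F) {j k : ι} (hj : j ∈ G)
    (hk : k ∈ G) (hFk : coord y F k ≠ 0) (hFj : coord y F j = 0) : coord y G j = 0 := by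
  have := hy.flat F G hF hG hGF k hk j hj
  rw [hFj, zero_mul] at this
  exact (mul_eq_zero.1 this).resolve_left hFk

theorem nestedOf_mem (hy : Admissible y) :
    nestedOf y ∈ nestedSetComplex (linearMatroid (K := K) a) := by
  refine ⟨fun F hF => hF.1, fun T hT hTn hTa hD => ?_⟩
  obtain ⟨k, ⟨F, hF, hkF⟩, hk⟩ := hy.exists_coord_ne_zero_of_closure_eq hD (X := ⋃₀ T) rfl
  have hsub : ∀ G ∈ T, G ⊆ (linearMatroid (K := K) a).closure (⋃₀ T) := fun G hG =>
    (subset_sUnion_of_mem hG).trans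
      ((linearMatroid (K := K) a).subset_closure _ (subset_univ _))
  refine hk ((hT hF).2 _ hD ((hsub F hF).ssubset_of_ne fun h => ?_) k hkF)
  obtain ⟨G, hG, hGF⟩ := hTn.exists_ne F
  exact hTa hG hF hGF (h ▸ hsub G hG)

theorem inChart_nestedOf [Nontrivial ι] (hM : IsConnectedFlat (linearMatroid (K := K) a) univ)
    (hy : Admissible y) : InChart (nestedOf y) y := by
  intro j hj
  have hS := hy.nestedOf_mem
  have hFS := minMember_mem hM hS j
  have hF := isConnectedFlat_of_mem_insert hM hS hFS
  have hjF := mem_minMember (nestedOf y) j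
  set F := minMember (nestedOf y) j with hFdef
  have hZ := hy.isFlat_setOf_coord_eq_zero hF
  set Z : Set ι := {k | k ∈ F ∧ coord y F k = 0} with hZdef
  have hjZ : j ∈ Z := ⟨hjF, hj⟩
  -- The component of the vanishing coordinates that contains `j` would be a smaller member of the
  -- nested set than the smallest one.
  have hD := isConnectedFlat_setOf_sameComponent hM hZ hjZ
  set D : Set ι := {f | SameComponent (linearMatroid (K := K) a) Z j f} with hDdef
  have hDZ : D ⊆ Z := fun f hf => SameComponent.mem hf hjZ
  have hjD : j ∈ D := .inl rfl
  obtain ⟨k, hkF, hk⟩ := exists_coord_ne_zero y hF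
  have hkD : k ∉ D := fun h => hk (hDZ h).2
  suffices h : D ∈ nestedOf y from hkD (minMember_subset (.inr h) hjD hkF)
  refine ⟨⟨hD, fun h => hkD (h ▸ mem_univ k)⟩, fun G hG hDG i hi => ?_⟩
  have hiG := hDG.1 hi
  by_cases hGF : G ⊆ F
  · have : ∃ l ∈ G, coord y F l ≠ 0 := by
      by_contra! h0
      exact hDG.2 fun l hl => (hG.sameComponent (hDG.1 hjD) hl).mono fun m hm => ⟨hGF hm, h0 m hm⟩
    obtain ⟨l, hl, hl0⟩ := this
    exact hy.coord_eq_zero hF hG hGF hiG hl hl0 (hDZ hi).2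
  · have hH := isConnectedFlat_closure_union hM hG hF ⟨j, hDG.1 hjD, hjF⟩
    obtain ⟨l, hl, hl0⟩ := hy.exists_coord_ne_zero_of_closure_eq hH rfl
    have hsub := (linearMatroid (K := K) a).subset_closure (G ∪ F) (subset_univ _)
    have hFH : F ⊂ (linearMatroid (K := K) a).closure (G ∪ F) :=
      ⟨subset_union_right.trans hsub, fun h => hGF (subset_union_left.trans (hsub.trans h))⟩
    have hFn : F ∈ nestedOf y := hFS.resolve_left fun h => hFH.2 (h ▸ subset_univ _)
    have hlG : l ∈ G := hl.resolve_right fun h => hl0 (hFn.2 _ hH hFH l h)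
    exact hy.coord_eq_zero hH hG (subset_union_left.trans hsub) hiG hlG hl0
      (hFn.2 _ hH hFH i (hDZ hi).1)

end Admissible

/-- `nestedOf y` is the smallest nested set whose chart contains `y`. -/
theorem nestedOf_subset [Nontrivial ι] {y : MultiProjective K L (wonderfulCoords a)}
    {S : Set (Set ι)} (hM : IsConnectedFlat (linearMatroid (K := K) a) univ)
    (hS : S ∈ nestedSetComplex (linearMatroid (K := K) a)) (hy : InChart S y) :
    nestedOf y ⊆ S := by
  intro F hF
  by_contra hFS
  obtain ⟨i, hi, h⟩ := exists_mem_forall_subset hM hS hF.1.1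
  have hmem := minMember_mem hM hS i
  have hFG : F ⊆ minMember S i := by
    rcases hmem with h' | h'
    · exact h' ▸ subset_univ F
    · exact h _ h' (mem_minMember S i)
  refine hy i (hF.2 _ (isConnectedFlat_of_mem_insert hM hS hmem) (hFG.ssubset_of_ne fun h' => ?_)
    i hi)
  rw [← h'] at hmem
  exact hmem.elim hF.1.2 hFS

end Admissible

/-! ### The chart of a nested set -/

section ChartPoint

variable {ι : Type} [Fintype ι] {n : ℕ} {K L : Type*} [Field K] [Field L] [Algebra K L]
  {a : ι → Fin n → K} {S : Set (Set ι)} {B : Fin n → ι → K}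
  {y : MultiProjective K L (wonderfulCoords a)}

theorem Corresponds.inChart [Nontrivial ι] (hM : IsConnectedFlat (linearMatroid (K := K) a) univ)
    (hS : S ∈ nestedSetComplex (linearMatroid (K := K) a)) {φ : ToricChart K L (incidenceCone S)}
    (h : Corresponds B φ y) : InChart S y := by
  intro j hj
  obtain ⟨c, hc, hcy⟩ := h.flat_of_isPivot
    (isConnectedFlat_of_mem_insert hM hS (minMember_mem hM hS j)) (isPivot_minMember j)
  rw [hcy j (mem_minMember S j), charDiff_self, φ.val_zero, mul_one] at hj
  exact hc hj

theorem Corresponds.val_charDiff [Nontrivial ι]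
    (hM : IsConnectedFlat (linearMatroid (K := K) a) univ)
    (hS : S ∈ nestedSetComplex (linearMatroid (K := K) a)) {φ : ToricChart K L (incidenceCone S)}
    (h : Corresponds B φ y) {i j : ι} (hj : j ∈ minMember S i) :
    φ.val (charDiff j i) = coord y (minMember S i) j / coord y (minMember S i) i := by
  obtain ⟨c, hc, hcy⟩ := h.flat_of_isPivot
    (isConnectedFlat_of_mem_insert hM hS (minMember_mem hM hS i)) (isPivot_minMember i)
  rw [hcy j hj, hcy i (mem_minMember S i), charDiff_self, φ.val_zero, mul_one,
    mul_div_cancel_left₀ _ hc]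

/-- A point of the chart is determined by the values of the generators of the monoid. -/
theorem eq_of_val_charDiff_eq [Nontrivial ι] {M : Matroid ι} (hM : IsConnectedFlat M univ)
    (hS : S ∈ nestedSetComplex M) {φ ψ : ToricChart K L (incidenceCone S)}
    (h : ∀ i, ∀ j ∈ minMember S i, φ.val (charDiff j i) = ψ.val (charDiff j i)) : φ = ψ := by
  refine ToricChart.ext_val fun m hm => ?_
  have key : ∀ m ∈ AddSubmonoid.closure {d | ∃ i j, j ∈ minMember S i ∧ d = charDiff j i},
      m ∈ dualMonoid (incidenceCone S) ∧ φ.val m = ψ.val m := by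
    intro m hm
    induction hm using AddSubmonoid.closure_induction with
    | mem _ h' =>
      obtain ⟨i, j, hj, rfl⟩ := h'
      exact ⟨(isPivot_minMember i).2 j hj, h i j hj⟩
    | zero => exact ⟨zero_mem _, by rw [φ.val_zero, ψ.val_zero]⟩
    | add m m' _ _ h h' =>
      exact ⟨add_mem h.1 h'.1, by rw [φ.val_add h.1 h'.1, ψ.val_add h.1 h'.1, h.2, h'.2]⟩
  exact (key m (mem_closure_charDiff hM hS hm)).2

theorem Corresponds.unique_chart [Nontrivial ι]
    (hM : IsConnectedFlat (linearMatroid (K := K) a) univ)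
    (hS : S ∈ nestedSetComplex (linearMatroid (K := K) a)) {φ ψ : ToricChart K L (incidenceCone S)}
    (h : Corresponds B φ y) (h' : Corresponds B ψ y) : φ = ψ :=
  eq_of_val_charDiff_eq hM hS fun i j hj => by
    rw [h.val_charDiff hM hS hj, h'.val_charDiff hM hS hj]

open Classical in
/-- If the vector `v (parent S F)` restricts on each member `F` of `S` to a multiple of `v F`, by
the scaling factor `r F`, then each coordinate of `v G` is the product of the same coordinate for the
smallest possible member and of the scaling factors in between. -/
theorem eq_mul_prod_of_parent [Nontrivial ι] {M : Matroid ι} (hM : IsConnectedFlat M univ)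
    (hS : S ∈ nestedSetComplex M) {v : Set ι → ι → L} {r : Set ι → L}
    (hr : ∀ F ∈ S, ∀ i ∈ F, v (parent S F) i = r F * v F i) (j : ι) (T : Finset (Set ι))
    (hT : ∀ F, F ∈ T ↔ F ∈ S) {G : Set ι} (hG : G ∈ insert univ S) (hj : j ∈ G) :
    v G j = v (minMember S j) j * ∏ F ∈ T.filter fun F => j ∈ F ∧ F ⊂ G, r F := by
  induction hn : G.ncard using Nat.strong_induction_on generalizing G with
  | _ N ih =>
  rcases (minMember_subset hG hj).eq_or_ssubset with h | h
  · rw [Finset.filter_false_of_mem, Finset.prod_empty, mul_one, h]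
    rintro F hF ⟨hjF, hFG⟩
    exact hFG.2 (h ▸ minMember_subset (.inr ((hT F).1 hF)) hjF)
  · have hmin : minMember S j ∈ S := (minMember_mem hM hS j).resolve_left fun h' =>
      h.2 (h' ▸ subset_univ G)
    have hfin : {F | F ∈ S ∧ j ∈ F ∧ F ⊂ G}.Finite := toFinite _
    obtain ⟨F, ⟨hFS, hjF, hFG⟩, hmax⟩ :=
      hfin.exists_maximal ⟨_, hmin, mem_minMember S j, h⟩
    have hle : ∀ H ∈ S, j ∈ H → H ⊂ G → H ⊆ F := fun H hH hjH hHG =>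
      (laminar_insert hM hS (.inr hH) (.inr hFS) ⟨j, hjH, hjF⟩).elim id
        fun h' => hmax ⟨hH, hjH, hHG⟩ h'
    have hpar : parent S F = G := by
      obtain ⟨hp, hFp⟩ := parent_mem hM hS hFS
      rcases (parent_subset hG hFG).eq_or_ssubset with h' | h'
      · exact h'
      · have hpS : parent S F ∈ S := hp.resolve_left fun h'' => h'.2 (h'' ▸ subset_univ G)
        exact absurd (hle _ hpS (hFp.1 hjF) h') hFp.2
    have hset : T.filter (fun H => j ∈ H ∧ H ⊂ G) =
        insert F (T.filter fun H => j ∈ H ∧ H ⊂ F) := by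
      ext H
      simp only [Finset.mem_filter, Finset.mem_insert, hT]
      refine ⟨fun ⟨hH, hjH, hHG⟩ => ?_, ?_⟩
      · exact (hle H hH hjH hHG).eq_or_ssubset.imp id fun h' => ⟨hH, hjH, h'⟩
      · rintro (rfl | ⟨hH, hjH, hHF⟩)
        · exact ⟨hFS, hjF, hFG⟩
        · exact ⟨hH, hjH, hHF.trans hFG⟩
    have hv : v G j = r F * v F j := by rw [← hpar, hr F hFS j hjF]
    have hlt : F.ncard < N := hn ▸ ncard_lt_ncard hFG
    rw [hset, Finset.prod_insert (by simp), hv, ih _ hlt (.inr hFS) hjF rfl]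
    ring

open Classical in
/-- The point `m ↦ ∏ j, (w j) ^ (m j) * ∏ F ∈ S, (r F) ^ (m F)` of the chart of the cone over `S`,
where `m F` is the sum of the entries of `m` over `F`. It is nonnegative, so `r F` may be zero. -/
noncomputable def chartPoint (S : Set (Set ι)) (w : ι → Lˣ) (r : Set ι → L) :
    ToricChart K L (incidenceCone S) where
  toFun m := ((∏ j, w j ^ m.toAdd.1 j : Lˣ) : L) *
    ∏ F with F ∈ S, r F ^ (flatSum m.toAdd.1 F).toNat
  map_one' := by simp [flatSum]
  map_mul' m m' := by
    have h1 := (mem_dualMonoid_incidenceCone.1 m.toAdd.2).2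
    have h2 := (mem_dualMonoid_incidenceCone.1 m'.toAdd.2).2
    have : ∏ F with F ∈ S, r F ^ (flatSum (m * m').toAdd.1 F).toNat =
        (∏ F with F ∈ S, r F ^ (flatSum m.toAdd.1 F).toNat) *
          ∏ F with F ∈ S, r F ^ (flatSum m'.toAdd.1 F).toNat := by
      rw [← Finset.prod_mul_distrib]
      refine Finset.prod_congr rfl fun F hF => ?_
      have hF' : F ∈ S := (Finset.mem_filter.1 hF).2
      rw [← pow_add, ← Int.toNat_add (h1 F hF') (h2 F hF')]
      congr 2
      exact flatSum_add _ _ _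
    rw [this]
    simp only [toAdd_mul, AddSubmonoid.coe_add, Pi.add_apply, zpow_add, Finset.prod_mul_distrib,
      Units.val_mul]
    ring

/-- The scaling factors are the quotients of the coordinates for a member of `S` and for its
parent. -/
theorem Admissible.exists_chartPoint [Nontrivial ι]
    (hM : IsConnectedFlat (linearMatroid (K := K) a) univ)
    (hS : S ∈ nestedSetComplex (linearMatroid (K := K) a)) (hy : Admissible y)
    (hyS : InChart S y) : ∃ φ : ToricChart K L (incidenceCone S), ∀ i, ∀ j ∈ minMember S i,
      φ.val (charDiff j i) = coord y (minMember S i) j / coord y (minMember S i) i := by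
  classical
  have hr : ∀ F, ∃ r : L, F ∈ S → ∀ i ∈ F, coord y (parent S F) i = r * coord y F i := by
    intro F
    by_cases hF : F ∈ S
    swap
    · exact ⟨0, fun h => absurd h hF⟩
    obtain ⟨k, hk⟩ := exists_minMember_eq hM hS (.inr hF)
    have hkF : k ∈ F := hk ▸ mem_minMember S k
    have hk0 : coord y F k ≠ 0 := hk ▸ hyS k
    obtain ⟨hp, hFp⟩ := parent_mem hM hS hF
    refine ⟨coord y (parent S F) k / coord y F k, fun _ i hi => ?_⟩
    rw [div_mul_eq_mul_div, eq_div_iff hk0]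
    exact hy.flat _ _ (isConnectedFlat_of_mem_insert hM hS hp)
      (isConnectedFlat_of_mem_insert hM hS (.inr hF)) hFp.1 i hi k hkF
  choose r hr using hr
  let w : ι → Lˣ := fun j => Units.mk0 _ (hyS j)
  refine ⟨chartPoint S w r, fun i j hj => ?_⟩
  have hd : charDiff j i ∈ dualMonoid (incidenceCone S) := (isPivot_minMember i).2 j hj
  rw [ToricChart.val, dif_pos hd]
  change ((∏ k, w k ^ charDiff j i k : Lˣ) : L) *
    ∏ F with F ∈ S, r F ^ (flatSum (charDiff j i) F).toNat = _
  have hG := minMember_mem hM hS i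
  rw [eq_mul_prod_of_parent hM hS (fun F hF => hr F hF) j
    (Finset.univ.filter fun F => F ∈ S) (by simp) hG hj, prod_zpow_charDiff,
    Units.val_div_eq_div_val, div_mul_eq_mul_div, Finset.prod_filter (fun F => j ∈ F ∧ _)]
  change coord y (minMember S j) j * _ / coord y (minMember S i) i = _
  congr 2
  refine Finset.prod_congr rfl fun F hF => ?_
  have hFS : F ∈ S := (Finset.mem_filter.1 hF).2
  rw [flatSum_charDiff]
  by_cases hiF : i ∈ F
  · have hsub := minMember_subset (.inr hFS) hiF
    have hn : ¬ F ⊂ minMember S i := fun h => h.2 hsub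
    simp [hiF, hsub hj, hn]
  · by_cases hjF : j ∈ F
    · have hss : F ⊂ minMember S i :=
        ((laminar_insert hM hS (.inr hFS) hG ⟨j, hjF, hj⟩).resolve_right
          fun h => hiF (h (mem_minMember S i))).ssubset_of_ne
            fun h => hiF (h ▸ mem_minMember S i)
      simp [hjF, hss, hiF]
    · simp [hjF, hiF]

theorem coordinate_eq_sum_formValue (hB : ∀ x, ∑ l, B x l • a l = Pi.single x 1) (v : Fin n → L)
    (x : Fin n) : v x = ∑ l, algebraMap K L (B x l) * formValue (a l) v := by
  classical
  simp only [formValue, Finset.mul_sum]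
  rw [Finset.sum_comm]
  have : ∀ z, ∑ l, algebraMap K L (B x l) * (algebraMap K L (a l z) * v z) =
      algebraMap K L ((Pi.single x 1 : Fin n → K) z) * v z := by
    intro z
    rw [← hB x, Finset.sum_apply, map_sum, Finset.sum_mul]
    exact Finset.sum_congr rfl fun l _ => by
      rw [Pi.smul_apply, smul_eq_mul, map_mul, mul_assoc]
  simp [this, Pi.single_apply, apply_ite (algebraMap K L)]

/-- The chart of the cone over `S` contains a point corresponding to `y` if `y` is in the open
subset given by `S`. -/
theorem Admissible.exists_corresponds [Nontrivial ι]
    (hB : ∀ x, ∑ l, B x l • a l = Pi.single x 1)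
    (hM : IsConnectedFlat (linearMatroid (K := K) a) univ)
    (hS : S ∈ nestedSetComplex (linearMatroid (K := K) a)) (hy : Admissible y)
    (hyS : InChart S y) : ∃ φ : ToricChart K L (incidenceCone S), Corresponds B φ y := by
  obtain ⟨φ, hφ⟩ := hy.exists_chartPoint hM hS hyS
  refine ⟨φ, fun F hF => ?_, ?_⟩
  · obtain ⟨i, hi⟩ := exists_isPivot hM hS hF
    have hG := isConnectedFlat_of_mem_insert hM hS (minMember_mem hM hS i)
    have hFG : F ⊆ minMember S i := fun j hj => by
      rcases minMember_mem hM hS i with h | h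
      · exact h ▸ mem_univ j
      · exact charDiff_mem_iff.1 (hi.2 j hj) _ h (mem_minMember S i)
    have key : ∀ j ∈ F, coord y F j = coord y F i * φ.val (charDiff j i) := fun j hj => by
      rw [hφ i j (hFG hj), mul_div_assoc', eq_div_iff (hyS i), mul_comm,
        hy.flat _ _ hG hF hFG i hi.1 j hj, mul_comm]
    refine ⟨i, hi, coord y F i, fun h => ?_, key⟩
    obtain ⟨k, hk, hk0⟩ := exists_coord_ne_zero y hF
    rw [key k hk, h, zero_mul] at hk0
    exact hk0 rfl
  · obtain ⟨i, hi⟩ := exists_isPivot hM hS hM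
    have hu : minMember S i = univ := (minMember_mem hM hS i).elim id fun h =>
      eq_univ_of_forall fun j => charDiff_mem_iff.1 (hi.2 j (mem_univ j)) _ h (mem_minMember S i)
    have hi0 : coord y univ i ≠ 0 := hu ▸ hyS i
    have key : ∀ x, (y none).rep x = formValue (a i) (y none).rep *
        ∑ l, algebraMap K L (B x l) * φ.val (charDiff l i) := by
      intro x
      refine (coordinate_eq_sum_formValue hB (y none).rep x).trans ?_
      rw [Finset.mul_sum]
      refine Finset.sum_congr rfl fun l _ => ?_
      rw [hφ i l (hu ▸ mem_univ l), hu]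
      have := hy.point i l
      field_simp
      rw [mul_assoc, ← this, mul_assoc]
    refine ⟨i, hi, _, fun h => (y none).rep_nonzero (funext fun x => ?_), key⟩
    rw [key x, h, zero_mul]
    rfl

end ChartPoint

/-! ### Multihomogeneous polynomials and closed conditions -/

section Multihomogeneous

variable {K L : Type*} [Field K] [Field L] [Algebra K L] {κ : Type} {I : κ → Type}

theorem MultiProjective.isClosed_setOf_eval_eq_zero {p : MvPolynomial ((k : κ) × I k) K}
    {d : κ →₀ ℕ} (h : IsMultihomogeneous p d) :
    IsClosed {y : MultiProjective K L I | y.eval p = 0} := by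
  rw [← isOpen_compl_iff]
  exact TopologicalSpace.isOpen_generateFrom_of_mem ⟨p, d, h, rfl⟩

theorem IsMultihomogeneous.zero (d : κ →₀ ℕ) :
    IsMultihomogeneous (0 : MvPolynomial ((k : κ) × I k) K) d :=
  MvPolynomial.isWeightedHomogeneous_zero K _ d

theorem IsMultihomogeneous.X (s : (k : κ) × I k) :
    IsMultihomogeneous (MvPolynomial.X s : MvPolynomial ((k : κ) × I k) K)
      (Finsupp.single s.1 1) :=
  MvPolynomial.isWeightedHomogeneous_X K _ s

theorem IsMultihomogeneous.mul {p q : MvPolynomial ((k : κ) × I k) K} {d e : κ →₀ ℕ}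
    (hp : IsMultihomogeneous p d) (hq : IsMultihomogeneous q e) :
    IsMultihomogeneous (p * q) (d + e) :=
  MvPolynomial.IsWeightedHomogeneous.mul hp hq

theorem IsMultihomogeneous.sum {s : Type*} (t : Finset s) {p : s → MvPolynomial ((k : κ) × I k) K}
    {d : κ →₀ ℕ} (h : ∀ i ∈ t, IsMultihomogeneous (p i) d) :
    IsMultihomogeneous (∑ i ∈ t, p i) d :=
  (MvPolynomial.weightedHomogeneousSubmodule K _ d).sum_mem h

theorem IsMultihomogeneous.add {p q : MvPolynomial ((k : κ) × I k) K} {d : κ →₀ ℕ}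
    (hp : IsMultihomogeneous p d) (hq : IsMultihomogeneous q d) : IsMultihomogeneous (p + q) d :=
  (MvPolynomial.weightedHomogeneousSubmodule K _ d).add_mem hp hq

theorem IsMultihomogeneous.sub {p q : MvPolynomial ((k : κ) × I k) K} {d : κ →₀ ℕ}
    (hp : IsMultihomogeneous p d) (hq : IsMultihomogeneous q d) : IsMultihomogeneous (p - q) d :=
  (MvPolynomial.weightedHomogeneousSubmodule K _ d).sub_mem hp hq

theorem IsMultihomogeneous.smul (c : K) {p : MvPolynomial ((k : κ) × I k) K} {d : κ →₀ ℕ}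
    (hp : IsMultihomogeneous p d) : IsMultihomogeneous (c • p) d :=
  (MvPolynomial.weightedHomogeneousSubmodule K _ d).smul_mem c hp

theorem IsMultihomogeneous.prod {s : Type*} (t : Finset s)
    {p : s → MvPolynomial ((k : κ) × I k) K} {d : s → κ →₀ ℕ}
    (h : ∀ i ∈ t, IsMultihomogeneous (p i) (d i)) :
    IsMultihomogeneous (∏ i ∈ t, p i) (∑ i ∈ t, d i) :=
  MvPolynomial.IsWeightedHomogeneous.prod t p d h

theorem IsMultihomogeneous.pow {p : MvPolynomial ((k : κ) × I k) K} {d : κ →₀ ℕ}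
    (hp : IsMultihomogeneous p d) (N : ℕ) : IsMultihomogeneous (p ^ N) (N • d) := by
  have := IsMultihomogeneous.prod (Finset.range N) (fun _ _ => hp)
  simpa using this

/-- Rescaling the homogeneous coordinates of each factor rescales the value of a multihomogeneous
polynomial. -/
theorem IsMultihomogeneous.aeval_mul {p : MvPolynomial ((k : κ) × I k) K} {d : κ →₀ ℕ}
    (hp : IsMultihomogeneous p d) (c : κ → L) (g : (k : κ) × I k → L) :
    MvPolynomial.aeval (fun s => c s.1 * g s) p =
      (d.prod fun k e => c k ^ e) * MvPolynomial.aeval g p := by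
  rw [MvPolynomial.aeval_def, MvPolynomial.aeval_def, MvPolynomial.eval₂_eq, MvPolynomial.eval₂_eq,
    Finset.mul_sum]
  refine Finset.sum_congr rfl fun m hm => ?_
  have hd : m.sum (fun s e => Finsupp.single s.1 e) = d := by
    rw [← hp (MvPolynomial.mem_support_iff.1 hm), Finsupp.weight_apply]
    refine Finset.sum_congr rfl fun s _ => ?_
    simp
  have : (d.prod fun k e => c k ^ e) = ∏ s ∈ m.support, c s.1 ^ m s := by
    rw [← hd, Finsupp.prod_sum_index (fun _ => pow_zero _) fun _ _ _ => pow_add _ _ _]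
    exact Finset.prod_congr rfl fun s _ => Finsupp.prod_single_index (pow_zero _)
  rw [this]
  simp only [mul_pow, Finset.prod_mul_distrib]
  ring

end Multihomogeneous

section Closed

variable {ι : Type} [Fintype ι] {n : ℕ} {K L : Type*} [Field K] [Field L] [Algebra K L]
  {a : ι → Fin n → K}

variable (a) in
open Classical in
/-- The polynomial with value `coord y F j`. -/
noncomputable def coordVar (F : Set ι) (j : ι) :
    MvPolynomial ((k : Option {F : Set ι // IsConnectedFlat (linearMatroid (K := K) a) F}) ×
      wonderfulCoords a k) K :=
  if h : IsConnectedFlat (linearMatroid (K := K) a) F ∧ j ∈ F then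
    MvPolynomial.X ⟨some ⟨F, h.1⟩, (⟨j, h.2⟩ : F)⟩ else 0

theorem eval_coordVar (y : MultiProjective K L (wonderfulCoords a)) (F : Set ι) (j : ι) :
    y.eval (coordVar a F j) = coord y F j := by
  unfold MultiProjective.eval coordVar coord
  split_ifs with h
  · rw [MvPolynomial.aeval_X]
  · exact map_zero _

theorem isMultihomogeneous_coordVar {F : Set ι}
    (hF : IsConnectedFlat (linearMatroid (K := K) a) F) (j : ι) :
    IsMultihomogeneous (coordVar a F j) (Finsupp.single (some ⟨F, hF⟩) 1) := by
  unfold coordVar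
  split_ifs with h
  · exact IsMultihomogeneous.X _
  · exact IsMultihomogeneous.zero _

variable (a) in
/-- The linear form `a i` as a polynomial in the homogeneous coordinates of `ℙ(V)`. -/
noncomputable def formPoly (i : ι) :
    MvPolynomial ((k : Option {F : Set ι // IsConnectedFlat (linearMatroid (K := K) a) F}) ×
      wonderfulCoords a k) K :=
  ∑ x : Fin n, a i x • MvPolynomial.X ⟨none, x⟩

theorem eval_formPoly (y : MultiProjective K L (wonderfulCoords a)) (i : ι) :
    y.eval (formPoly a i) = formValue (a i) (y none).rep := by
  unfold MultiProjective.eval formPoly formValue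
  rw [map_sum]
  refine Finset.sum_congr rfl fun x _ => ?_
  rw [map_smul, MvPolynomial.aeval_X, Algebra.smul_def]

theorem isMultihomogeneous_formPoly (i : ι) :
    IsMultihomogeneous (formPoly a i) (Finsupp.single none 1) := by
  have h : ∀ x : Fin n, IsMultihomogeneous (K := K) (I := wonderfulCoords a)
      (MvPolynomial.X ⟨none, x⟩) (Finsupp.single none 1) := fun x => IsMultihomogeneous.X _
  exact IsMultihomogeneous.sum _ fun x _ => (h x).smul _

theorem isClosed_setOf_admissible :
    IsClosed {y : MultiProjective K L (wonderfulCoords a) | Admissible y} := by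
  have h1 : IsClosed {y : MultiProjective K L (wonderfulCoords a) |
      ∀ F, IsConnectedFlat (linearMatroid (K := K) a) F → ∀ c : ι → K, (∀ i ∉ F, c i = 0) →
        ∑ i, c i • a i = 0 → ∑ i, algebraMap K L (c i) * coord y F i = 0} := by
    simp only [ofPred_forall]
    refine isClosed_iInter fun F => isClosed_iInter fun hF => isClosed_iInter fun c =>
      isClosed_iInter fun _ => isClosed_iInter fun _ => ?_
    convert MultiProjective.isClosed_setOf_eval_eq_zero (L := L) (IsMultihomogeneous.sum
      Finset.univ fun i _ => (isMultihomogeneous_coordVar hF i).smul (c i)) using 4 with y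
    unfold MultiProjective.eval
    rw [map_sum]
    refine Finset.sum_congr rfl fun i _ => ?_
    rw [map_smul, Algebra.smul_def, ← eval_coordVar]
    rfl
  have h2 : IsClosed {y : MultiProjective K L (wonderfulCoords a) |
      ∀ F G, IsConnectedFlat (linearMatroid (K := K) a) F →
        IsConnectedFlat (linearMatroid (K := K) a) G → G ⊆ F → ∀ i ∈ G, ∀ j ∈ G,
        coord y F i * coord y G j = coord y F j * coord y G i} := by
    simp only [ofPred_forall]
    refine isClosed_iInter fun F => isClosed_iInter fun G => isClosed_iInter fun hF =>
      isClosed_iInter fun hG => isClosed_iInter fun _ => isClosed_iInter fun i =>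
      isClosed_iInter fun _ => isClosed_iInter fun j => isClosed_iInter fun _ => ?_
    convert MultiProjective.isClosed_setOf_eval_eq_zero (L := L)
      (((isMultihomogeneous_coordVar hF i).mul (isMultihomogeneous_coordVar hG j)).sub
        ((isMultihomogeneous_coordVar hF j).mul (isMultihomogeneous_coordVar hG i))) using 3 with y
    unfold MultiProjective.eval
    rw [map_sub, map_mul, map_mul, sub_eq_zero]
    simp only [← eval_coordVar]
    rfl
  have h3 : IsClosed {y : MultiProjective K L (wonderfulCoords a) |
      ∀ i j, formValue (a i) (y none).rep * coord y univ j =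
        formValue (a j) (y none).rep * coord y univ i} := by
    simp only [ofPred_forall]
    refine isClosed_iInter fun i => isClosed_iInter fun j => ?_
    by_cases hM : IsConnectedFlat (linearMatroid (K := K) a) univ
    · convert MultiProjective.isClosed_setOf_eval_eq_zero (L := L)
        (((isMultihomogeneous_formPoly i).mul (isMultihomogeneous_coordVar hM j)).sub
          ((isMultihomogeneous_formPoly j).mul (isMultihomogeneous_coordVar hM i))) using 3 with y
      unfold MultiProjective.eval
      rw [map_sub, map_mul, map_mul, sub_eq_zero]
      simp only [← eval_coordVar, ← eval_formPoly]
      rfl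
    · simp [coord, hM]
  convert h1.inter (h2.inter h3) using 1
  ext y
  exact ⟨fun h => ⟨h.1, h.2, h.3⟩, fun h => ⟨h.1, h.2.1, h.2.2⟩⟩

theorem coord_wonderfulPoint (x : Complement L a) {F : Set ι}
    (hF : IsConnectedFlat (linearMatroid (K := K) a) F) :
    ∃ c : L, c ≠ 0 ∧ ∀ j ∈ F, coord x.wonderfulPoint F j = c * formValue (a j) x.1.rep := by
  have h0 : (fun i : F => formValue (a i.1) x.1.rep) ≠ 0 := fun h => by
    obtain ⟨i, hi⟩ := hF.2.1
    exact x.2 i (congrFun h ⟨i, hi⟩)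
  obtain ⟨c, hc⟩ := Projectivization.exists_smul_eq_mk_rep L _ h0
  refine ⟨c, c.ne_zero, fun j hj => ?_⟩
  rw [coord_eq _ hF hj]
  exact (congrFun hc ⟨j, hj⟩).symm

theorem sum_mul_formValue {c : ι → K} (hc : ∑ i, c i • a i = 0) (v : Fin n → L) :
    ∑ i, algebraMap K L (c i) * formValue (a i) v = 0 := by
  simp only [formValue, Finset.mul_sum]
  rw [Finset.sum_comm]
  refine Finset.sum_eq_zero fun x _ => ?_
  have := congrArg (algebraMap K L) (congrFun hc x)
  rw [Finset.sum_apply, map_sum, Pi.zero_apply, map_zero] at this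
  simp only [← mul_assoc, ← Finset.sum_mul, ← map_mul]
  simp only [Pi.smul_apply, smul_eq_mul] at this
  rw [this, zero_mul]

theorem admissible_wonderfulPoint (x : Complement L a) : Admissible x.wonderfulPoint where
  linear F hF c hc hca := by
    obtain ⟨d, -, hd⟩ := coord_wonderfulPoint x hF
    rw [← mul_zero d, ← sum_mul_formValue hca x.1.rep, Finset.mul_sum]
    refine Finset.sum_congr rfl fun i _ => ?_
    by_cases hi : i ∈ F
    · rw [hd i hi]
      ring
    · rw [hc i hi, map_zero, zero_mul, zero_mul, mul_zero]
  flat F G hF hG hGF i hi j hj := by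
    obtain ⟨d, -, hd⟩ := coord_wonderfulPoint x hF
    obtain ⟨e, -, he⟩ := coord_wonderfulPoint x hG
    rw [hd i (hGF hi), hd j (hGF hj), he i hi, he j hj]
    ring
  point i j := by
    by_cases hM : IsConnectedFlat (linearMatroid (K := K) a) univ
    · obtain ⟨d, -, hd⟩ := coord_wonderfulPoint x hM
      rw [hd i (mem_univ i), hd j (mem_univ j)]
      change formValue (a i) x.1.rep * _ = formValue (a j) x.1.rep * _
      ring
    · simp [coord, hM]

theorem corresponds_torusPoint {B : Fin n → ι → K}
    (hB : ∀ x, ∑ l, B x l • a l = Pi.single x 1) {σ : PointedCone ℝ (TropTorus ι)}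
    (hσ : ∀ F, IsConnectedFlat (linearMatroid (K := K) a) F → ∃ i, IsPivot σ F i)
    (hM : IsConnectedFlat (linearMatroid (K := K) a) univ) (x : Complement L a) :
    Corresponds B (ToricChart.torusPoint (K := K) σ x.formUnits) x.wonderfulPoint where
  flat F hF := by
    obtain ⟨i, hi⟩ := hσ F hF
    obtain ⟨c, hc, hcx⟩ := coord_wonderfulPoint x hF
    refine ⟨i, hi, c * formValue (a i) x.1.rep, mul_ne_zero hc (x.2 i), fun j hj => ?_⟩
    rw [hcx j hj, ToricChart.val_torusPoint _ (hi.2 j hj)]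
    change _ = _ * (formValue (a j) x.1.rep / formValue (a i) x.1.rep)
    have := x.2 i
    field_simp
  point := by
    obtain ⟨i, hi⟩ := hσ univ hM
    refine ⟨i, hi, formValue (a i) x.1.rep, x.2 i, fun z => ?_⟩
    refine (coordinate_eq_sum_formValue hB x.1.rep z).trans ?_
    rw [Finset.mul_sum]
    refine Finset.sum_congr rfl fun l _ => ?_
    rw [ToricChart.val_torusPoint _ (hi.2 l (mem_univ l))]
    change _ = _ * (_ * (formValue (a l) x.1.rep / formValue (a i) x.1.rep))
    have := x.2 i
    field_simp

theorem isLinear_torusPoint {σ : PointedCone ℝ (TropTorus ι)} (x : Complement L a) :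
    IsLinear a (ToricChart.torusPoint (K := K) σ x.formUnits) := by
  intro i hi c hc
  refine Eq.trans ?_ ((congrArg (· / formValue (a i) x.1.rep)
    (sum_mul_formValue hc x.1.rep)).trans (zero_div _))
  rw [Finset.sum_div]
  refine Finset.sum_congr rfl fun l _ => ?_
  rw [ToricChart.val_torusPoint _ (hi.2 l (mem_univ l)), mul_div_assoc]
  rfl

end Closed

/-! ### Pulling back polynomials -/

section Pullback

variable {ι : Type} [Fintype ι] {n : ℕ} {K L : Type*} [Field K] [Field L] [Algebra K L]
  {a : ι → Fin n → K} {σ : PointedCone ℝ (TropTorus ι)} {B : Fin n → ι → K}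

open Classical in
/-- The regular function with value `φ.val m`. -/
noncomputable def character (K : Type*) [Field K] (σ : PointedCone ℝ (TropTorus ι)) (m : ι → ℤ) :
    AddMonoidAlgebra K (dualMonoid σ) :=
  if h : m ∈ dualMonoid σ then
    AddMonoidAlgebra.of K (dualMonoid σ) (Multiplicative.ofAdd ⟨m, h⟩) else 0

theorem eval_character (φ : ToricChart K L σ) (m : ι → ℤ) :
    φ.eval (character K σ m) = φ.val m := by
  unfold character
  split_ifs with h
  · exact φ.eval_of h
  · rw [ToricChart.val, dif_neg h]
    exact map_zero _

theorem isClosed_setOf_isLinear : IsClosed {φ : ToricChart K L σ | IsLinear a φ} := by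
  unfold IsLinear
  simp only [ofPred_forall]
  refine isClosed_iInter fun i => isClosed_iInter fun _ => isClosed_iInter fun c =>
    isClosed_iInter fun _ => ?_
  convert ToricChart.isClosed_setOf_eval_eq_zero (K := K) (L := L) (σ := σ)
    (∑ l, c l • character K σ (charDiff l i)) using 4 with φ
  unfold ToricChart.eval
  rw [map_sum]
  refine Finset.sum_congr rfl fun l _ => ?_
  rw [← eval_character]
  exact (φ.eval_smul _ _).symm

/-- Pulling back polynomials to a chart of the toric variety, by substituting regular functions
for the homogeneous coordinates. -/
theorem exists_pullback (B : Fin n → ι → K)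
    (hσ : ∀ F, IsConnectedFlat (linearMatroid (K := K) a) F → ∃ i, IsPivot σ F i)
    (hM : IsConnectedFlat (linearMatroid (K := K) a) univ) :
    ∃ T : MvPolynomial ((k : Option {F : Set ι // IsConnectedFlat (linearMatroid (K := K) a) F}) ×
      wonderfulCoords a k) K → AddMonoidAlgebra K (dualMonoid σ),
      ∀ (φ : ToricChart K L σ) (y : MultiProjective K L (wonderfulCoords a)), Corresponds B φ y →
        ∀ d, ∃ c : L, c ≠ 0 ∧ ∀ q, IsMultihomogeneous q d → y.eval q = c * φ.eval (T q) := by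
  choose p hp using hσ
  let f : ((k : Option {F : Set ι // IsConnectedFlat (linearMatroid (K := K) a) F}) ×
      wonderfulCoords a k) → AddMonoidAlgebra K (dualMonoid σ) := fun s => match s with
    | ⟨none, x⟩ => ∑ l, B x l • character K σ (charDiff l (p univ hM))
    | ⟨some F, j⟩ => character K σ (charDiff j.1 (p F.1 F.2))
  refine ⟨fun q => MvPolynomial.aeval f q, fun φ y h d => ?_⟩
  have hc : ∀ k, ∃ c : L, c ≠ 0 ∧ ∀ i, (y k).rep i = c * φ.eval (f ⟨k, i⟩) := by
    rintro (_ | F)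
    · obtain ⟨c, hc, hcy⟩ := h.point_of_isPivot (hp univ hM)
      refine ⟨c, hc, fun x => (hcy x).trans ?_⟩
      congr 1
      change _ = φ.eval (∑ l, B x l • character K σ (charDiff l (p univ hM)))
      unfold ToricChart.eval
      rw [map_sum]
      refine Finset.sum_congr rfl fun l _ => ?_
      rw [← eval_character]
      exact (φ.eval_smul _ _).symm
    · obtain ⟨c, hc, hcy⟩ := h.flat_of_isPivot F.2 (hp F.1 F.2)
      refine ⟨c, hc, fun j => ?_⟩
      change _ = c * φ.eval (character K σ (charDiff j.1 (p F.1 F.2)))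
      rw [eval_character, ← hcy j.1 j.2, coord_eq y F.2 j.2]
      rfl
  choose c hc hcy using hc
  refine ⟨d.prod fun k e => c k ^ e, Finset.prod_ne_zero_iff.2 fun k _ => pow_ne_zero _ (hc k),
    fun q hq => ?_⟩
  rw [φ.eval_aeval, ← hq.aeval_mul]
  unfold MultiProjective.eval
  congr 2
  exact funext fun s => hcy s.1 s.2

end Pullback

/-! ### Clearing denominators -/

section ClearDenominators

variable {ι : Type} [Fintype ι] {n : ℕ} {K L : Type*} [Field K] [Field L] [Algebra K L]
  {a : ι → Fin n → K} {B : Fin n → ι → K} {S : Set (Set ι)}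

variable (a) in
/-- The product of the coordinates that are nonzero on the chart of the cone over `S`. -/
noncomputable def chartDenom (S : Set (Set ι)) :
    MvPolynomial ((k : Option {F : Set ι // IsConnectedFlat (linearMatroid (K := K) a) F}) ×
      wonderfulCoords a k) K :=
  ∏ j, coordVar a (minMember S j) j

theorem eval_chartDenom (y : MultiProjective K L (wonderfulCoords a)) :
    y.eval (chartDenom a S) = ∏ j, coord y (minMember S j) j := by
  simp only [← eval_coordVar]
  exact map_prod _ _ _

theorem inChart_iff (y : MultiProjective K L (wonderfulCoords a)) :
    InChart S y ↔ y.eval (chartDenom a S) ≠ 0 := by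
  rw [eval_chartDenom, Finset.prod_ne_zero_iff]
  exact ⟨fun h j _ => h j, fun h j => h j (Finset.mem_univ j)⟩

/-- Every regular function on the chart of the cone over `S` is a quotient of two multihomogeneous
polynomials, the denominator being a power of `chartDenom a S`. -/
theorem exists_isMultihomogeneous_chartDenom [Nontrivial ι]
    (hM : IsConnectedFlat (linearMatroid (K := K) a) univ)
    (hS : S ∈ nestedSetComplex (linearMatroid (K := K) a)) :
    ∃ d, IsMultihomogeneous (chartDenom a S) d ∧
      ∀ p : AddMonoidAlgebra K (dualMonoid (incidenceCone S)), ∃ N₀, ∀ N ≥ N₀, ∃ q,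
        IsMultihomogeneous q (N • d) ∧
        ∀ (φ : ToricChart K L (incidenceCone S)) (y : MultiProjective K L (wonderfulCoords a)),
          Corresponds B φ y → y.eval q = y.eval (chartDenom a S) ^ N * φ.eval p := by
  classical
  have hc : ∀ j, IsConnectedFlat (linearMatroid (K := K) a) (minMember S j) := fun j =>
    isConnectedFlat_of_mem_insert hM hS (minMember_mem hM hS j)
  have hd : ∀ j, IsMultihomogeneous (coordVar a (minMember S j) j)
      (Finsupp.single (some ⟨minMember S j, hc j⟩) 1) := fun j => isMultihomogeneous_coordVar _ _
  have hD := IsMultihomogeneous.prod Finset.univ fun j _ => hd j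
  set d := ∑ j, (Finsupp.single (some ⟨minMember S j, hc j⟩) 1 :
    Option {F : Set ι // IsConnectedFlat (linearMatroid (K := K) a) F} →₀ ℕ) with hddef
  refine ⟨d, hD, fun p => ?_⟩
  -- It suffices to represent characters, and among them the generators.
  let P : AddMonoidAlgebra K (dualMonoid (incidenceCone S)) → Prop := fun p =>
    ∃ N₀, ∀ N ≥ N₀, ∃ q, IsMultihomogeneous q (N • d) ∧
        ∀ (φ : ToricChart K L (incidenceCone S)) (y : MultiProjective K L (wonderfulCoords a)),
          Corresponds B φ y → y.eval q = y.eval (chartDenom a S) ^ N * φ.eval p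
  have h1 : P 1 := ⟨0, fun N _ => ⟨chartDenom a S ^ N, hD.pow N, fun φ y _ => by
    have h := map_one (AddMonoidAlgebra.lift K L (dualMonoid (incidenceCone S)) φ)
    unfold ToricChart.eval
    rw [h, mul_one]
    exact map_pow _ _ _⟩⟩
  have hmul : ∀ p p', P p → P p' → P (p * p') := by
    rintro p p' ⟨N₁, h₁⟩ ⟨N₂, h₂⟩
    refine ⟨N₁ + N₂, fun N hN => ?_⟩
    obtain ⟨q₁, hq₁, hq₁'⟩ := h₁ N₁ le_rfl
    obtain ⟨q₂, hq₂, hq₂'⟩ := h₂ (N - N₁) (by omega)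
    refine ⟨q₁ * q₂, ?_, fun φ y h => ?_⟩
    · have := hq₁.mul hq₂
      rwa [← add_smul, Nat.add_sub_cancel' (by omega)] at this
    · have he : y.eval (q₁ * q₂) = y.eval q₁ * y.eval q₂ := map_mul _ _ _
      rw [he, hq₁' φ y h, hq₂' φ y h, φ.eval_mul]
      conv_rhs => rw [← Nat.add_sub_cancel' (show N₁ ≤ N by omega), pow_add]
      ring
  have hadd : ∀ p p', P p → P p' → P (p + p') := by
    rintro p p' ⟨N₁, h₁⟩ ⟨N₂, h₂⟩
    refine ⟨max N₁ N₂, fun N hN => ?_⟩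
    obtain ⟨q₁, hq₁, hq₁'⟩ := h₁ N ((le_max_left _ _).trans hN)
    obtain ⟨q₂, hq₂, hq₂'⟩ := h₂ N ((le_max_right _ _).trans hN)
    refine ⟨q₁ + q₂, hq₁.add hq₂, fun φ y h => ?_⟩
    have he : y.eval (q₁ + q₂) = y.eval q₁ + y.eval q₂ := map_add _ _ _
    rw [he, hq₁' φ y h, hq₂' φ y h, φ.eval_add, mul_add]
  have hsmul : ∀ (c : K) p, P p → P (c • p) := by
    rintro c p ⟨N₁, h₁⟩
    refine ⟨N₁, fun N hN => ?_⟩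
    obtain ⟨q, hq, hq'⟩ := h₁ N hN
    refine ⟨c • q, hq.smul c, fun φ y h => ?_⟩
    have he : y.eval (c • q) = algebraMap K L c * y.eval q :=
      (map_smul _ _ _).trans (Algebra.smul_def _ _)
    rw [he, hq' φ y h, φ.eval_smul]
    ring
  have hgen : ∀ i, ∀ j ∈ minMember S i, P (character K _ (charDiff j i)) := by
    intro i j hj
    -- `t_j / t_i` has the denominator `t_i`, which is one of the factors of `chartDenom a S`.
    refine ⟨1, fun N hN => ⟨(coordVar a (minMember S i) j *
      ∏ k ∈ Finset.univ.erase i, coordVar a (minMember S k) k) * chartDenom a S ^ (N - 1),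
      ?_, fun φ y h => ?_⟩⟩
    · have h := ((isMultihomogeneous_coordVar (hc i) j).mul
        (IsMultihomogeneous.prod (Finset.univ.erase i) fun k _ => hd k)).mul (hD.pow (N - 1))
      rw [Finset.add_sum_erase _ (fun k => (Finsupp.single (some ⟨minMember S k, hc k⟩) 1 :
        Option {F : Set ι // IsConnectedFlat (linearMatroid (K := K) a) F} →₀ ℕ))
        (Finset.mem_univ i), ← hddef, ← succ_nsmul', Nat.sub_add_cancel hN] at h
      exact h
    · have he : ∀ p q r, y.eval (p * q * r) = y.eval p * y.eval q * y.eval r := fun p q r => by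
        unfold MultiProjective.eval
        rw [map_mul, map_mul]
      have hpow : y.eval (chartDenom a S ^ (N - 1)) = y.eval (chartDenom a S) ^ (N - 1) :=
        map_pow _ _ _
      have hprod : y.eval (∏ k ∈ Finset.univ.erase i, coordVar a (minMember S k) k) =
          ∏ k ∈ Finset.univ.erase i, coord y (minMember S k) k := by
        simp only [← eval_coordVar]
        exact map_prod _ _ _
      rw [he, hpow, hprod, eval_coordVar, eval_character, h.val_charDiff hM hS hj]
      conv_rhs => rw [← Nat.sub_add_cancel hN, pow_succ, eval_chartDenom (S := S) y,
        ← Finset.mul_prod_erase _ _ (Finset.mem_univ i)]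
      rw [eval_chartDenom, ← Finset.mul_prod_erase _ _ (Finset.mem_univ i)]
      have := h.inChart hM hS i
      field_simp
  have hchar : ∀ m : dualMonoid (incidenceCone S), P (character K _ m.1) := by
    intro m
    have key : ∀ m ∈ AddSubmonoid.closure {d | ∃ i j, j ∈ minMember S i ∧ d = charDiff j i},
        m ∈ dualMonoid (incidenceCone S) ∧ P (character K _ m) := by
      intro m hm
      induction hm using AddSubmonoid.closure_induction with
      | mem _ h =>
        obtain ⟨i, j, hj, rfl⟩ := h
        exact ⟨(isPivot_minMember i).2 j hj, hgen i j hj⟩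
      | zero =>
        refine ⟨zero_mem _, ?_⟩
        unfold character
        rw [dif_pos (zero_mem _)]
        exact h1
      | add m m' _ _ h h' =>
        refine ⟨add_mem h.1 h'.1, ?_⟩
        have := hmul _ _ h.2 h'.2
        unfold character at this ⊢
        rw [dif_pos h.1, dif_pos h'.1, ← map_mul] at this
        rw [dif_pos (add_mem h.1 h'.1)]
        exact this
    exact (key m.1 (mem_closure_charDiff hM hS m.2)).2
  change P p
  induction p using AddMonoidAlgebra.induction_on with
  | of m =>
    have := hchar m
    unfold character at this
    rw [dif_pos m.2] at this
    exact this
  | add f g hf hg => exact hadd f g hf hg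
  | smul c f hf => exact hsmul c f hf

end ClearDenominators

/-! ### The isomorphism of the compactifications -/

/-- Continuous maps between closed subsets that exchange two sets restrict to a homeomorphism of
their closures, if they are inverse to each other where this makes sense. -/
theorem exists_homeomorph_closure {X Y : Type*} [TopologicalSpace X] [TopologicalSpace Y]
    {X₁ A : Set X} {Y₁ B : Set Y} (hX : IsClosed X₁) (hY : IsClosed Y₁) (hA : A ⊆ X₁)
    (hB : B ⊆ Y₁) {f : X₁ → Y} {g : Y₁ → X} (hf : Continuous f) (hg : Continuous g)
    (hfA : ∀ x (h : x ∈ A), f ⟨x, hA h⟩ ∈ B) (hgB : ∀ y (h : y ∈ B), g ⟨y, hB h⟩ ∈ A)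
    (hgf : ∀ (x : X₁) (h : f x ∈ Y₁), g ⟨f x, h⟩ = x)
    (hfg : ∀ (y : Y₁) (h : g y ∈ X₁), f ⟨g y, h⟩ = y) :
    ∃ e : closure A ≃ₜ closure B, ∀ (z : closure A) (h : z.1 ∈ X₁), (e z).1 = f ⟨z.1, h⟩ := by
  have hAc : closure A ⊆ X₁ := closure_minimal hA hX
  have hBc : closure B ⊆ Y₁ := closure_minimal hB hY
  have hf' : ∀ z (h : z ∈ closure A), f ⟨z, hAc h⟩ ∈ closure B := fun z h =>
    map_mem_closure (s := ((↑) : X₁ → X) ⁻¹' A) hf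
      (closure_subtype.2 (by rwa [Subtype.image_preimage_coe, inter_eq_right.2 hA]))
      fun x hx => hfA x.1 hx
  have hg' : ∀ z (h : z ∈ closure B), g ⟨z, hBc h⟩ ∈ closure A := fun z h =>
    map_mem_closure (s := ((↑) : Y₁ → Y) ⁻¹' B) hg
      (closure_subtype.2 (by rwa [Subtype.image_preimage_coe, inter_eq_right.2 hB]))
      fun x hx => hgB x.1 hx
  exact ⟨{
    toFun := fun z => ⟨f ⟨z.1, hAc z.2⟩, hf' z.1 z.2⟩
    invFun := fun z => ⟨g ⟨z.1, hBc z.2⟩, hg' z.1 z.2⟩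
    left_inv := fun z => Subtype.ext (hgf ⟨z.1, hAc z.2⟩ (hBc (hf' z.1 z.2)))
    right_inv := fun z => Subtype.ext (hfg ⟨z.1, hBc z.2⟩ (hAc (hg' z.1 z.2)))
    continuous_toFun := (hf.comp (continuous_subtype_val.subtype_mk _)).subtype_mk _
    continuous_invFun := (hg.comp (continuous_subtype_val.subtype_mk _)).subtype_mk _ },
    fun _ _ => rfl⟩

section Gluing

variable {ι : Type} [Fintype ι] {K L : Type*} [Field K] [Field L] [Algebra K L]
  {𝓕 : Set (PointedCone ℝ (TropTorus ι))}

/-- A property of points of charts that is compatible with the inclusions of charts is a property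
of points of the toric variety. -/
theorem chart_eq_iff {P : ∀ σ : 𝓕, ToricChart K L σ.1 → Prop}
    (hP : ∀ (ρ σ : 𝓕) (h : ρ.1 ≤ σ.1) (χ : ToricChart K L ρ.1), P σ (χ.incl h) ↔ P ρ χ)
    {σ τ : 𝓕} {φ : ToricChart K L σ.1} {ψ : ToricChart K L τ.1}
    (h : ToricVariety.chart σ φ = ToricVariety.chart τ ψ) : P σ φ ↔ P τ ψ := by
  have key : ∀ Q R : (σ : 𝓕) × ToricChart K L σ.1, ToricVariety.Glue K L 𝓕 Q R →
      P Q.1 Q.2 = P R.1 R.2 := by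
    rintro ⟨σ, φ⟩ ⟨τ, ψ⟩ ⟨ρ, hρ, h₁, h₂, χ, hφ, hψ⟩
    change P σ φ = P τ ψ
    change χ.incl h₁ = φ at hφ
    change χ.incl h₂ = ψ at hψ
    rw [← hφ, ← hψ]
    exact propext ((hP ⟨ρ, hρ⟩ σ h₁ χ).trans (hP ⟨ρ, hρ⟩ τ h₂ χ).symm)
  exact iff_of_eq (congrArg
    (Quot.lift (fun Q : (σ : 𝓕) × ToricChart K L σ.1 => P Q.1 Q.2) key) h)

end Gluing

section Isomorphism

variable {ι : Type} [Fintype ι] [Nontrivial ι] {n : ℕ} {K L : Type*} [Field K] [Field L]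
  [Algebra K L] {a : ι → Fin n → K} {B : Fin n → ι → K}

variable (a) in
/-- The fan over the nested set complex. -/
abbrev nestedFan : Set (PointedCone ℝ (TropTorus ι)) :=
  incidenceCone '' nestedSetComplex (linearMatroid (K := K) a)

theorem exists_isPivot_nestedFan (hM : IsConnectedFlat (linearMatroid (K := K) a) univ)
    (σ : nestedFan a) (F : Set ι) (hF : IsConnectedFlat (linearMatroid (K := K) a) F) :
    ∃ i, IsPivot σ.1 F i := by
  obtain ⟨_, S, hS, rfl⟩ := σ
  exact exists_isPivot hM hS hF

theorem Corresponds.of_chart_eq (hM : IsConnectedFlat (linearMatroid (K := K) a) univ)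
    {σ τ : nestedFan a} {φ : ToricChart K L σ.1} {ψ : ToricChart K L τ.1}
    (h : ToricVariety.chart σ φ = ToricVariety.chart τ ψ)
    {y : MultiProjective K L (wonderfulCoords a)} (hy : Corresponds B φ y) : Corresponds B ψ y :=
  (chart_eq_iff (P := fun _ φ => Corresponds B φ y) (fun _ σ h _ =>
    ⟨fun h' => h'.of_incl, fun h' => h'.incl h (exists_isPivot_nestedFan hM σ) hM⟩) h).1 hy

theorem isLinear_iff_of_chart_eq (hM : IsConnectedFlat (linearMatroid (K := K) a) univ)
    {σ τ : nestedFan a} {φ : ToricChart K L σ.1} {ψ : ToricChart K L τ.1}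
    (h : ToricVariety.chart σ φ = ToricVariety.chart τ ψ) : IsLinear a φ ↔ IsLinear a ψ :=
  chart_eq_iff (P := fun _ φ => IsLinear a φ) (fun _ σ h _ =>
    isLinear_incl_iff h (exists_isPivot_nestedFan hM σ univ hM)) h

theorem Corresponds.chart_eq_nestedOf (hM : IsConnectedFlat (linearMatroid (K := K) a) univ)
    {y : MultiProjective K L (wonderfulCoords a)} (hy : Admissible y) {σ : nestedFan a}
    {φ : ToricChart K L σ.1} (h : Corresponds B φ y)
    {χ : ToricChart K L (incidenceCone (nestedOf y))} (hχ : Corresponds B χ y) :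
    ToricVariety.chart σ φ =
      ToricVariety.chart (𝓕 := nestedFan a) ⟨_, nestedOf y, hy.nestedOf_mem, rfl⟩ χ := by
  obtain ⟨_, S, hS, rfl⟩ := σ
  have hsub : incidenceCone (nestedOf y) ≤ incidenceCone S :=
    incidenceCone_mono (nestedOf_subset hM hS (h.inChart hM hS))
  rw [h.unique_chart hM hS (hχ.incl hsub (fun F hF => exists_isPivot hM hS hF) hM)]
  exact chart_incl (𝓕 := nestedFan a) (ρ := ⟨_, nestedOf y, hy.nestedOf_mem, rfl⟩)
    (σ := ⟨_, S, hS, rfl⟩) hsub χ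

/-- An admissible point corresponds to only one point of the toric variety. -/
theorem Corresponds.chart_eq (hB : ∀ x, ∑ l, B x l • a l = Pi.single x 1)
    (hM : IsConnectedFlat (linearMatroid (K := K) a) univ)
    {y : MultiProjective K L (wonderfulCoords a)} (hy : Admissible y) {σ τ : nestedFan a}
    {φ : ToricChart K L σ.1} {ψ : ToricChart K L τ.1} (h : Corresponds B φ y)
    (h' : Corresponds B ψ y) : ToricVariety.chart σ φ = ToricVariety.chart τ ψ := by
  obtain ⟨χ, hχ⟩ := hy.exists_corresponds hB hM hy.nestedOf_mem (hy.inChart_nestedOf hM)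
  rw [h.chart_eq_nestedOf hM hy hχ, h'.chart_eq_nestedOf hM hy hχ]

variable (a) in
/-- The points of the toric variety that satisfy the linear relations between the forms. -/
def linearLocus (L : Type*) [Field L] [Algebra K L] : Set (ToricVariety K L (nestedFan a)) :=
  {z | ∃ (σ : nestedFan a) (φ : ToricChart K L σ.1), ToricVariety.chart σ φ = z ∧ IsLinear a φ}

theorem chart_mem_linearLocus_iff (hM : IsConnectedFlat (linearMatroid (K := K) a) univ)
    {σ : nestedFan a} {φ : ToricChart K L σ.1} :
    ToricVariety.chart σ φ ∈ linearLocus a L ↔ IsLinear a φ :=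
  ⟨fun ⟨_, _, h, hl⟩ => (isLinear_iff_of_chart_eq hM h).1 hl, fun h => ⟨σ, φ, rfl, h⟩⟩

theorem isClosed_linearLocus (hM : IsConnectedFlat (linearMatroid (K := K) a) univ) :
    IsClosed (linearLocus a L) := by
  refine isClosed_toricVariety_iff.2 fun σ => ?_
  simp only [chart_mem_linearLocus_iff hM]
  exact isClosed_setOf_isLinear

/-- A map to the product of projective spaces given by the correspondence is continuous. -/
theorem continuous_multiProjective_of_corresponds
    (hM : IsConnectedFlat (linearMatroid (K := K) a) univ)
    {f : linearLocus a L → MultiProjective K L (wonderfulCoords a)}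
    (hf : ∀ z (σ : nestedFan a) (φ : ToricChart K L σ.1), ToricVariety.chart σ φ = z.1 →
      Corresponds B φ (f z)) : Continuous f := by
  refine continuous_generateFrom_iff.2 ?_
  rintro _ ⟨q, d, hq, rfl⟩
  rw [← isClosed_compl_iff]
  have hC : IsClosed {z : ToricVariety K L (nestedFan a) |
      ∃ h : z ∈ linearLocus a L, (f ⟨z, h⟩).eval q = 0} := by
    refine isClosed_toricVariety_iff.2 fun σ => ?_
    obtain ⟨T, hT⟩ := exists_pullback (L := L) B (exists_isPivot_nestedFan hM σ) hM
    convert (isClosed_setOf_isLinear (a := a) (L := L) (σ := σ.1)).inter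
      (ToricChart.isClosed_setOf_eval_eq_zero (T q)) using 1
    ext φ
    have key : ∀ h : ToricVariety.chart σ φ ∈ linearLocus a L,
        (f ⟨_, h⟩).eval q = 0 ↔ φ.eval (T q) = 0 := fun h => by
      obtain ⟨c, hc, hcq⟩ := hT φ _ (hf ⟨_, h⟩ σ φ rfl) d
      rw [hcq q hq, mul_eq_zero, or_iff_right hc]
    exact ⟨fun ⟨h, h'⟩ => ⟨(chart_mem_linearLocus_iff hM).1 h, (key h).1 h'⟩,
      fun ⟨h, h'⟩ => ⟨(chart_mem_linearLocus_iff hM).2 h, (key _).2 h'⟩⟩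
  convert hC.preimage continuous_subtype_val using 1
  ext z
  simp only [mem_compl_iff, mem_preimage, mem_ofPred_eq, not_not]
  exact ⟨fun h => ⟨z.2, h⟩, fun ⟨_, h⟩ => h⟩

/-- A map to the toric variety given by the correspondence is continuous. -/
theorem continuous_toricVariety_of_corresponds (hB : ∀ x, ∑ l, B x l • a l = Pi.single x 1)
    (hM : IsConnectedFlat (linearMatroid (K := K) a) univ)
    {g : {y : MultiProjective K L (wonderfulCoords a) | Admissible y} →
      ToricVariety K L (nestedFan a)}
    (hg : ∀ y (σ : nestedFan a) (φ : ToricChart K L σ.1), Corresponds B φ y.1 →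
      g y = ToricVariety.chart σ φ) : Continuous g := by
  refine continuous_iff_continuousAt.2 fun y => ?_
  have hS := y.2.nestedOf_mem
  set S := nestedOf y.1 with hSdef
  obtain ⟨d, hd, hp⟩ := exists_isMultihomogeneous_chartDenom (L := L) (B := B) hM hS
  -- The domain of the chart is an open neighbourhood of `y`.
  have hopen : ∀ (q : MvPolynomial _ K) (e), IsMultihomogeneous q e →
      IsOpen {y : {y : MultiProjective K L (wonderfulCoords a) | Admissible y} |
        y.1.eval q ≠ 0} := fun q e hq =>
    (TopologicalSpace.isOpen_generateFrom_of_mem ⟨q, e, hq, rfl⟩ :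
      IsOpen {y : MultiProjective K L (wonderfulCoords a) | y.eval q ≠ 0}).preimage
      continuous_subtype_val
  have hU := hopen _ _ hd
  set U := {y : {y : MultiProjective K L (wonderfulCoords a) | Admissible y} |
    y.1.eval (chartDenom a S) ≠ 0} with hUdef
  have hyU : y ∈ U := (inChart_iff y.1).1 (y.2.inChart_nestedOf hM)
  refine ContinuousOn.continuousAt ?_ (hU.mem_nhds hyU)
  rw [continuousOn_iff_continuous_domRestrict]
  choose b hb using fun x : U => x.1.2.exists_corresponds hB hM hS ((inChart_iff x.1.1).2 x.2)
  have hgb : U.domRestrict g = ToricVariety.chart (𝓕 := nestedFan a) ⟨_, S, hS, rfl⟩ ∘ b :=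
    funext fun x => hg x.1 ⟨_, S, hS, rfl⟩ (b x) (hb x)
  rw [hgb]
  refine (continuous_chart _).comp (continuous_generateFrom_iff.2 ?_)
  rintro _ ⟨p, rfl⟩
  obtain ⟨N, hN⟩ := hp p
  obtain ⟨q, hq, hqp⟩ := hN N le_rfl
  convert (hopen q _ hq).preimage (continuous_subtype_val (p := (· ∈ U))) using 1
  ext x
  simp only [mem_preimage, mem_ofPred_eq]
  rw [hqp (b x) x.1.1 (hb x), mul_ne_zero_iff, and_iff_right (pow_ne_zero N x.2)]

/-- Regular functions agree under a bijection given by the correspondence. -/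
theorem isRegularOn_iff (hB : ∀ x, ∑ l, B x l • a l = Pi.single x 1)
    (hM : IsConnectedFlat (linearMatroid (K := K) a) univ)
    {X : Set (ToricVariety K L (nestedFan a))} {Y : Set (MultiProjective K L (wonderfulCoords a))}
    (hY : ∀ y ∈ Y, Admissible y) (e : X ≃ Y)
    (he : ∀ (z : X) (σ : nestedFan a) (φ : ToricChart K L σ.1), ToricVariety.chart σ φ = z.1 →
      Corresponds B φ (e z).1) (W : Set Y) (f : Y → L) :
    MultiProjective.IsRegularOn W f ↔ ToricVariety.IsRegularOn (e ⁻¹' W) (f ∘ e) := by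
  constructor
  · intro h σ φ z hz hzφ
    obtain ⟨p, q, d, hp, hq, hqz, hpq⟩ := h (e z) hz
    obtain ⟨T, hT⟩ := exists_pullback (L := L) B (exists_isPivot_nestedFan hM σ) hM
    refine ⟨T p, T q, fun h0 => ?_, fun x hx ψ hxψ hq0 => ?_⟩
    · obtain ⟨c, -, hcq⟩ := hT φ _ (he z σ φ hzφ.symm) d
      rw [hcq q hq, h0, mul_zero] at hqz
      exact hqz rfl
    · obtain ⟨c, hc, hcq⟩ := hT ψ _ (he x σ ψ hxψ.symm) d
      have := hpq (e x) hx (by rw [hcq q hq]; exact mul_ne_zero hc hq0)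
      rw [hcq q hq, hcq p hp, mul_div_mul_left _ _ hc] at this
      exact this
  · intro h y hy
    obtain ⟨⟨_, S, hS, rfl⟩, φ, hφ⟩ := exists_chart (e.symm y).1
    obtain ⟨p, q, hq, hpq⟩ := h ⟨_, S, hS, rfl⟩ φ (e.symm y) (by simpa using hy) hφ.symm
    have hyφ := he _ _ _ hφ
    rw [e.apply_symm_apply] at hyφ
    obtain ⟨d, hd, hcl⟩ := exists_isMultihomogeneous_chartDenom (L := L) (B := B) hM hS
    obtain ⟨N₁, hN₁⟩ := hcl p
    obtain ⟨N₂, hN₂⟩ := hcl q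
    obtain ⟨P, hP, hPp⟩ := hN₁ (max N₁ N₂) (le_max_left _ _)
    obtain ⟨Q, hQ, hQq⟩ := hN₂ (max N₁ N₂) (le_max_right _ _)
    have hmul : ∀ (x : MultiProjective K L (wonderfulCoords a)) (r s : MvPolynomial _ K),
        x.eval (r * s) = x.eval r * x.eval s := fun x r s => map_mul _ _ _
    -- The additional factor restricts the quotient to the domain of the chart.
    refine ⟨P * chartDenom a S, Q * chartDenom a S, _, hP.mul hd, hQ.mul hd, ?_,
      fun x hx hxQ => ?_⟩
    · have hD := (inChart_iff y.1).1 (hyφ.inChart hM hS)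
      rw [hmul, hQq φ _ hyφ]
      exact mul_ne_zero (mul_ne_zero (pow_ne_zero _ hD) hq) hD
    · rw [hmul] at hxQ
      have hD := right_ne_zero_of_mul hxQ
      obtain ⟨ψ, hψ⟩ := (hY x.1 x.2).exists_corresponds hB hM hS ((inChart_iff x.1).2 hD)
      have hxψ : (e.symm x).1 =
          ToricVariety.chart (𝓕 := nestedFan a) ⟨_, S, hS, rfl⟩ ψ := by
        obtain ⟨τ, χ, hχ⟩ := exists_chart (e.symm x).1
        have h' := he _ _ _ hχ
        rw [e.apply_symm_apply] at h'
        rw [← hχ]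
        exact h'.chart_eq hB hM (hY x.1 x.2) hψ
      have hQ0 := left_ne_zero_of_mul hxQ
      rw [hQq ψ _ hψ] at hQ0
      have := hpq (e.symm x) (by simpa using hx) ψ hxψ (right_ne_zero_of_mul hQ0)
      rw [Function.comp_apply, e.apply_symm_apply] at this
      rw [this, hmul, hmul, hPp ψ _ hψ, hQq ψ _ hψ, mul_div_mul_right _ _ hD,
        mul_div_mul_left _ _ (pow_ne_zero _ hD)]

/-- For a connected essential arrangement, the closure of the complement in the toric variety of
the fan over the nested set complex is the wonderful compactification. -/
theorem compactificationsCoincide_nestedFan (hB : ∀ x, ∑ l, B x l • a l = Pi.single x 1)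
    (hM : IsConnectedFlat (linearMatroid (K := K) a) univ) :
    CompactificationsCoincide L a (nestedFan a) := by
  have hσ := exists_isPivot_nestedFan hM
  have hex : ∀ z : linearLocus a L, ∃ y : MultiProjective K L (wonderfulCoords a),
      ∀ (σ : nestedFan a) (φ : ToricChart K L σ.1), ToricVariety.chart σ φ = z.1 →
        Corresponds B φ y := by
    rintro ⟨_, σ, φ, rfl, hl⟩
    obtain ⟨y, hy⟩ := exists_corresponds hB hM (hσ σ) hl
    exact ⟨y, fun τ ψ h => hy.of_chart_eq hM h.symm⟩
  choose f hf using hex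
  have hey : ∀ y : {y : MultiProjective K L (wonderfulCoords a) | Admissible y},
      ∃ z : ToricVariety K L (nestedFan a), (∀ (σ : nestedFan a) (φ : ToricChart K L σ.1),
        Corresponds B φ y.1 → z = ToricVariety.chart σ φ) ∧
        ∃ (σ : nestedFan a) (φ : ToricChart K L σ.1), Corresponds B φ y.1 := fun y => by
    obtain ⟨χ, hχ⟩ := y.2.exists_corresponds hB hM y.2.nestedOf_mem (y.2.inChart_nestedOf hM)
    refine ⟨ToricVariety.chart ⟨_, _, y.2.nestedOf_mem, rfl⟩ χ, fun σ φ h => ?_,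
      ⟨_, _, y.2.nestedOf_mem, rfl⟩, χ, hχ⟩
    exact (h.chart_eq_nestedOf hM y.2 hχ).symm
  choose g hg hg' using hey
  have hA : {P : ToricVariety K L (nestedFan a) | ∃ (x : Complement L a) (σ : nestedFan a),
      P = x.toricPoint σ} ⊆ linearLocus a L := by
    rintro _ ⟨x, σ, rfl⟩
    exact ⟨σ, _, rfl, isLinear_torusPoint x⟩
  have hfx : ∀ (x : Complement L a) (σ : nestedFan a) (h : x.toricPoint σ ∈ linearLocus a L),
      f ⟨_, h⟩ = x.wonderfulPoint := fun x σ h =>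
    (hf ⟨_, h⟩ σ _ rfl).unique (corresponds_torusPoint hB (hσ σ) hM x)
  have hfA : ∀ z (h : z ∈ {P : ToricVariety K L (nestedFan a) |
      ∃ (x : Complement L a) (σ : nestedFan a), P = x.toricPoint σ}),
      f ⟨z, hA h⟩ ∈ range (Complement.wonderfulPoint (L := L) (a := a)) := by
    rintro _ ⟨x, σ, rfl⟩
    exact ⟨x, (hfx x σ _).symm⟩
  have hgB : ∀ y (h : y ∈ range (Complement.wonderfulPoint (L := L) (a := a))),
      g ⟨y, range_subset_iff.2 admissible_wonderfulPoint h⟩ ∈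
        {P : ToricVariety K L (nestedFan a) |
          ∃ (x : Complement L a) (σ : nestedFan a), P = x.toricPoint σ} := by
    rintro _ ⟨x, rfl⟩
    obtain ⟨σ, -, -⟩ := hg' ⟨_, admissible_wonderfulPoint x⟩
    exact ⟨x, σ, hg _ σ _ (corresponds_torusPoint hB (hσ σ) hM x)⟩
  obtain ⟨e, he⟩ := exists_homeomorph_closure (isClosed_linearLocus hM)
    isClosed_setOf_admissible hA (B := range Complement.wonderfulPoint)
    (range_subset_iff.2 admissible_wonderfulPoint) (continuous_multiProjective_of_corresponds hM hf)
    (continuous_toricVariety_of_corresponds hB hM hg) hfA hgB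
    (fun ⟨_, σ, φ, hφ, _⟩ _ => (hg _ σ φ (hf _ σ φ hφ)).trans hφ) fun y h => by
      obtain ⟨σ, φ, hφ⟩ := hg' y
      exact (hf ⟨_, h⟩ σ φ (hg y σ φ hφ).symm).unique hφ
  have hcl : closure {P : ToricVariety K L (nestedFan a) |
      ∃ (x : Complement L a) (σ : nestedFan a), P = x.toricPoint σ} ⊆ linearLocus a L :=
    closure_minimal hA (isClosed_linearLocus hM)
  refine ⟨e, fun W _ f' => ?_, fun x σ z hz => ?_⟩
  · refine isRegularOn_iff hB hM (fun y hy => ?_) e.toEquiv (fun z σ φ hφ => ?_) W f'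
    · exact closure_minimal (range_subset_iff.2 admissible_wonderfulPoint)
        isClosed_setOf_admissible hy
    · have h : (e z).1 = f ⟨z.1, hcl z.2⟩ := he z (hcl z.2)
      change Corresponds B φ (e z).1
      rw [h]
      exact hf ⟨z.1, hcl z.2⟩ σ φ hφ
  · refine (he z (hcl z.2)).trans ?_
    have : (⟨z.1, hcl z.2⟩ : linearLocus a L) = ⟨x.toricPoint σ, hz ▸ hcl z.2⟩ :=
      Subtype.ext hz
    rw [this]
    exact hfx x σ _

end Isomorphism

end Arr

theorem mainTheorem9 {K L : Type*} [Field K] [Field L] [Algebra K L] [IsAlgClosed L]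
    (h2 : (2 : K) ≠ 0) (h3 : (3 : K) ≠ 0) (ω : K) (hω : IsPrimitiveRoot ω 3) :
    (∃! 𝓕 : Set (PointedCone ℝ (Arr.TropTorus Arr.G32Index)),
      Arr.IsBergmanFan (Arr.g32Matroid ω) 𝓕) ∧
    ∀ 𝓕 : Set (PointedCone ℝ (Arr.TropTorus Arr.G32Index)),
      Arr.IsBergmanFan (Arr.g32Matroid ω) 𝓕 →
        Arr.IsFanOver 𝓕 (Arr.nestedSetComplex (Arr.g32Matroid ω)) ∧
        Arr.CompactificationsCoincide L (Arr.g32Form ω) 𝓕 := by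
  have hω' : ω ^ 2 + ω + 1 = 0 := by
    have h := hω.geom_sum_eq_zero (by norm_num)
    simp only [Finset.sum_range_succ, Finset.range_zero, Finset.sum_empty] at h
    linear_combination h
  have : Nontrivial Arr.G32Index := ⟨⟨.inl 0, .inl 1, by decide⟩⟩
  have hM := Arr.isConnectedFlat_g32 h3 hω'
  have hfan := Arr.isBergmanFan_nestedFan hM (Arr.g32_eq_of_union h2 h3 hω')
  -- `ω - ω²` is a square root of `-3`.
  have hd : ω - ω ^ 2 ≠ 0 := fun h => h3 (by
    linear_combination (ω ^ 2 - 3 * ω + 3) * hω' - (ω - ω ^ 2) * h)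
  refine ⟨⟨_, hfan, fun 𝓖 h => h.eq hfan⟩, fun 𝓕 h => ?_⟩
  obtain rfl := h.eq hfan
  refine ⟨Arr.isFanOver_nestedFan hM, ?_⟩
  -- The multiples of the coordinates by `ω - ω²` are among the forms.
  refine Arr.compactificationsCoincide_nestedFan
    (B := fun x l => if l = Sum.inl x then (ω - ω ^ 2)⁻¹ else 0) (fun x => ?_) hM
  rw [Finset.sum_eq_single (Sum.inl x) (fun l _ hl => by rw [if_neg hl, zero_smul])
    (fun h => absurd (Finset.mem_univ _) h), if_pos rfl]
  change (ω - ω ^ 2)⁻¹ • (Pi.single x (ω - ω ^ 2) : Fin 4 → K) = _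
  rw [← Pi.single_smul, smul_eq_mul, inv_mul_cancel₀ hd]
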